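/- **Setting.** Let $d\ge 1$, $m>0$, $\beta>2$, $\gamma>0$, $R>0$, let $\chi:\mathbb{R}_+\to[0,1]$ be smooth, supported in $[0,2]$ and equal to $1$ on $[0,1]$. For $\eta\in\{0,1\}$ put $\bar\eta=1-\eta$, and let $Q^\eta:\mathbb{R}^d\times\mathbb{R}^d\to\mathbb{C}$ be symmetric, differentiable and bounded together with its gradient, with $Q^\eta(-\xi,-\zeta)=\overline{Q^\eta(\xi,\zeta)}$ and $Q^\eta(\xi,-\xi)=0$. For $\eta,\eta'\in\{0,1\}$ let $M^{\eta,\eta'}:\mathbb{R}^d\to\mathbb{C}$ belong to $W^{1,\infty}(\mathbb{R}^d)\cap W^{1,1}(\mathbb{R}^d)$ (continuous representative), be supported in the ball $B(0,R)$, and satisfy $M^{\eta,\eta'}=\overline{M^{\eta',\eta}}$, $|M^{\eta,\eta'}|^2\le|M^{\eta,\eta}||M^{\eta',\eta'}|$. For $L>0$ put $\varepsilon=L^{-1/\beta}$ and $\mathbb{Z}_L^d=\frac1L\mathbb{Z}^d$. Write $\langle k\rangle=\sqrt{m+|k|^2}$, $z^{+}=z$, $z^{-}=\bar z$, $$q^\eta(k_1,k_2)=\frac{Q^\eta(k_1,k_2)}{4(2\pi)^{d/2}\langle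 k_1\rangle\langle k_2\rangle},$$ $$q^\eta_\iota(k_1,k_2,k_3)=\frac{4\langle k_1+k_3\rangle\, q^{\bar\eta}(k_1,k_3)\,q^\eta(k_1+k_3,k_2)}{m+2\big((k_1+k_2+k_3)\cdot k_2-\iota\langle k_1+k_2+k_3\rangle\langle k_2\rangle\big)} ,\qquad \iota\in\{\pm\}.$$ With $a(k)=\chi(\varepsilon^{-\gamma}|k|)$ set $\chi_{\mathrm{low}\text{-}\ell}(k_1,k_2,k_3)=a(k_2+k_3)(1-a(k_1+k_2))(1-a(k_1+k_3))$, $\chi_{\mathrm{low}\text{-}m}(k_1,k_2,k_3)=a(k_1+k_3)(1-a(k_2+k_3))(1-a(k_1+k_2))$, $\chi_{\mathrm{low}\text{-}r}(k_1,k_2,k_3)=a(k_1+k_2)(1-a(k_1+k_3))(1-a(k_2+k_3))$, $\chi_{\mathrm{high}}=1-\chi_{\mathrm{low}\text{-}\ell}-\chi_{\mathrm{low}\text{-}m}-\chi_{\mathrm{low}\text{-}r}$. **Trees.** Trees are the finite rooted ordered trees obtained from the single leaf $\bot$ and the initial binary tree $B_{\mathrm{in}}(\bot,\bot)$ by repeatedly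 forming $B_{\mathrm{st}}(A_1,A_2)$ (standard binary root) and $T_*(A_1,A_2,A_3)$ (ternary root of type $*\in\{\mathrm{low}\text{-}\ell,\mathrm{low}\text{-}m,\mathrm{low}\text{-}r,\mathrm{high}\}$). Let $\mathcal{L}(A)$, $\mathcal{N}(A)$, $\mathcal{N}_B(A)$, $\mathcal{N}_T(A)$ be the sets of leaves, branching nodes, binary nodes and ternary nodes of $A$; write $j\le j'$ if $j'$ lies on the path from $j$ to the root (both ends included), and call a node *low* if it is ternary of one of the three low types. A tree is *signed and coloured* if it carries a map $\varphi:\mathcal{L}(A)\sqcup\mathcal{N}(A)\to\{\pm\}$ and a map $c:\mathcal{L}(A)\sqcup\mathcal{N}(A)\to\{0,1\}$ such that every child of a binary node $j$ has colour $\overline{c(j)}$, and the left, middle, right children of a ternary node $j$ have colours $c(j),\overline{c(j)},c(j)$. **Couplings.** A coupling $C$ consists of two signed and coloured trees $A_1,A_2$ (sign and colour maps still denoted by $\varphi$, $c$) and an involution $\sigma$ of $\mathcal{L}(C)=\mathcal{L}(A_1)\sqcup\mathcal{L}(A_2)$ that maps the set $\mathcal{L}(C)_-$ of negative leaves bijectively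 onto the set $\mathcal{L}(C)_+$ of positive leaves. Set $\mathcal{N}_\bullet(C)=\mathcal{N}_\bullet(A_1)\sqcup\mathcal{N}_\bullet(A_2)$, $n_B(C)=\#\mathcal{N}_B(C)$, $n_T(C)=\#\mathcal{N}_T(C)$ and $n(C)=n_B(C)+2n_T(C)$. For $k\in\mathbb{Z}_L^d$ let $\mathcal{D}_k(C)$ be the set of maps $\kappa:\mathcal{L}(C)\sqcup\mathcal{N}(C)\to\mathbb{R}^d$ such that $\kappa(j)$ is the sum of $\kappa$ over the children of $j$ for every branching node $j$, $\kappa(\ell)+\kappa(\sigma(\ell))=0$ and $\kappa(\ell)\in\mathbb{Z}_L^d$ for every leaf $\ell$, and $\kappa=k$ at the root of $A_1$. Given such a $\kappa$ and a branching node $j$, with children $\ell,r$ (binary) or $\ell,m,r$ (ternary), put $$\Delta'_j=\varphi(j)\langle\kappa(j)\rangle-\sum_{j'\text{ child of }j}\varphi(j')\langle\kappa(j')\rangle ,$$ $\Delta_j=0$ if $j$ is initial binary and $\Delta_j=\Delta'_j$ otherwise, and $$q_j=\begin{cases}\varphi(j)\,q^{c(j)}(\kappa(\ell),\kappa(r))/\Delta_j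 & (j\text{ standard binary}),\\ -\varphi(j)\,q^{c(j)}(\kappa(\ell),\kappa(r))/\Delta'_j & (j\text{ initial binary}),\\ \varphi(j)\,\chi_*(\kappa(\ell),\kappa(m),\kappa(r))\,q^{c(j)}_{\varphi(j)\varphi(m)}(\kappa(\ell),\kappa(m),\kappa(r)) & (j\text{ ternary of type }*).\end{cases}$$ For $j\in\mathcal{N}_T(C)$ let $\Omega_j$ be the sum of $\Delta_{j'}$ over the branching nodes $j'\le j$ for which $j$ is the least ternary node $\ge j'$; let $\Omega_{-1}$ be the sum of $\Delta_{j'}$ over the binary nodes $j'$ with no ternary node $\ge j'$. With $I_C(t)=\{(t_j)\in[0,t]^{\mathcal{N}_T(C)}: j\le j'\Rightarrow t_j\le t_{j'}\}$ define $$\widehat{F_C}(\varepsilon^{-2}t,k)=\frac{\varepsilon^{n_B(C)}}{L^{n(C)d/2}}(-i)^{n_T(C)}\sum_{\kappa\in\mathcal{D}_k(C)}e^{i\varepsilon^{-2}\Omega_{-1}t}\prod_{j\in\mathcal{N}(C)}q_j\int_{I_C(t)}\prod_{j\in\mathcal{N}_T(C)}e^{i\Omega_j\varepsilon^{-2}t_j}\,dt_j\prod_{\ell\in\mathcal{L}(C)_-}M^{c(\ell),c(\sigma(\ell))}(\varphi(\ell)\kappa(\ell))^{\varphi(\ell)},$$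 where the time integral is $1$ if $n_T(C)=0$. **Resonant nodes.** A node or leaf is *marked* if it is the middle or right child of a low-$\ell$ node, the left or right child of a low-$m$ node, or the left or middle child of a low-$r$ node. The prebush of a leaf $\ell$ is $\{\ell\}$; the prebush of a branching node is the union of the prebushes of its unmarked children. The bush of a low node is the union of the prebushes of its two marked children; it is *self-coupled* if its subsets $B_+$, $B_-$ of positive and negative leaves have the same cardinality and $\sigma(B_+)=B_-$. A branching node $j$ of $C$ is *resonant* if it is low, its bush is self-coupled, its two marked children have opposite signs, and its unmarked child has the same sign as $j$. **Proposition.** There exist $\alpha,\Lambda>0$, depending only on $d,m,Q^\eta,M^{\eta,\eta'},R,\beta,\gamma,\chi$, such that for every coupling $C$ with at least one non-resonant branching node, every $L>0$ with $\varepsilon=L^{-1/\beta}$, every $\delta\ge\varepsilon$ and every $k\in\mathbb{Z}_L^d$, $$\sup_{t\in[0,\delta]}\big|\widehat{F_C}(\varepsilon^{-2}t,k)\big|\le\Lambda^{n(C)+1}\,\delta^{n(C)/2}\,\varepsilon^{\alpha}.$$ -/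

import Mathlib

open scoped ComplexConjugate ContDiff
open MeasureTheory

noncomputable section

namespace KleinGordon

/-! ## The system: nonlinearities, correlations of the initial data, cut-off -/

/-- The Euclidean space `ℝ^d`. -/
abbrev E (d : ℕ) : Type := EuclideanSpace ℝ (Fin d)

/-- `f ∈ W^{1,p}(ℝ^d)`: `f` and its weak partial derivatives belong to `L^p`. -/
def MemW1 {d : ℕ} (f : E d → ℂ) (p : ENNReal) : Prop :=
  MemLp f p volume ∧ ∃ g : Fin d → E d → ℂ, ∀ i, MemLp (g i) p volume ∧
    ∀ φ : E d → ℝ, ContDiff ℝ ∞ φ → HasCompactSupport φ →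
      ∫ x, f x * ((fderiv ℝ φ x (EuclideanSpace.single i 1) : ℝ) : ℂ)
        = - ∫ x, g i x * ((φ x : ℝ) : ℂ)

/-- The data of the Klein-Gordon system: the mass `m`, the symbols `Q⁰, Q¹` of the bilinear
nonlinearities and the functions `M^{η,η'}` giving the correlations
`𝔼(μ^η_k conj(μ^{η'}_{k'})) = δ_{k-k'} M^{η,η'}(k)` of the Gaussian initial data. -/
structure System (d : ℕ) where
  m : ℝ
  m_pos : 0 < m
  Q : Fin 2 → E d → E d → ℂ
  Q_symm : ∀ η ξ ζ, Q η ξ ζ = Q η ζ ξ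
  Q_differentiable : ∀ η, Differentiable ℝ (fun x : E d × E d => Q η x.1 x.2)
  Q_bounded : ∀ η, ∃ B : ℝ, ∀ x : E d × E d,
    ‖Q η x.1 x.2‖ ≤ B ∧ ‖fderiv ℝ (fun y : E d × E d => Q η y.1 y.2) x‖ ≤ B
  Q_neg : ∀ η ξ ζ, Q η (-ξ) (-ζ) = conj (Q η ξ ζ)
  Q_opposite : ∀ η ξ, Q η ξ (-ξ) = 0
  M : Fin 2 → Fin 2 → E d → ℂ
  /-- `M^{η,η'}` is evaluated pointwise: it is the continuous representative. -/
  M_continuous : ∀ η η', Continuous (M η η')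
  M_sobolev_top : ∀ η η', MemW1 (M η η') ⊤
  M_sobolev_one : ∀ η η', MemW1 (M η η') 1
  M_conj : ∀ η η' ξ, M η η' ξ = conj (M η' η ξ)
  M_cauchySchwarz : ∀ η η' ξ, ‖M η η' ξ‖ ^ 2 ≤ ‖M η η ξ‖ * ‖M η' η' ξ‖
  R : ℝ
  R_pos : 0 < R
  M_support : ∀ η η', Function.support (M η η') ⊆ Metric.closedBall 0 R

/-- The cut-off: an exponent `γ > 0` and a smooth `χ : ℝ₊ → [0,1]` supported on `[0,2]` and equal
to `1` on `[0,1]` (only the values of `χ` on `[0,∞)` are used). -/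
structure Cutoff where
  γ : ℝ
  γ_pos : 0 < γ
  χ : ℝ → ℝ
  χ_smooth : ContDiffOn ℝ ∞ χ (Set.Ici 0)
  χ_mem : ∀ x, 0 ≤ x → χ x ∈ Set.Icc (0 : ℝ) 1
  χ_one : ∀ x, 0 ≤ x → x ≤ 1 → χ x = 1
  χ_zero : ∀ x, 2 < x → χ x = 0

/-- Signs `±` are the units `1, -1` of `ℤ`; this is the corresponding real number. -/
def sgn (ι : ℤˣ) : ℝ := ((ι : ℤ) : ℝ)

/-- `z^ι`, i.e. `z` if `ι = +` and the conjugate of `z` if `ι = -`. -/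
def signPow (z : ℂ) (ι : ℤˣ) : ℂ := if ι = 1 then z else conj z

/-- The lattice `ℤ_L^d = (1/L) ℤ^d`. -/
def lattice (d : ℕ) (L : ℝ) : Set (E d) := {k | ∀ i, ∃ n : ℤ, k i = (n : ℝ) / L}

namespace System

variable {d : ℕ} (S : System d)

/-- The Japanese bracket `⟨k⟩ = √(m + |k|²)`. -/
def bracket (k : E d) : ℝ := Real.sqrt (S.m + ‖k‖ ^ 2)

/-- `q^η(k₁,k₂) = Q^η(k₁,k₂) / (4 (2π)^{d/2} ⟨k₁⟩ ⟨k₂⟩)`. -/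
def q2 (η : Fin 2) (k₁ k₂ : E d) : ℂ :=
  S.Q η k₁ k₂ /
    ((4 * (2 * Real.pi) ^ ((d : ℝ) / 2) * S.bracket k₁ * S.bracket k₂ : ℝ) : ℂ)

/-- `q^η_ι(k₁,k₂,k₃)`; the conjugate colour of `η` is `1 - η`. -/
def q3 (η : Fin 2) (ι : ℤˣ) (k₁ k₂ k₃ : E d) : ℂ :=
  ((4 * S.bracket (k₁ + k₃) /
      (S.m + 2 * (inner ℝ (k₁ + k₂ + k₃) k₂
        - sgn ι * S.bracket (k₁ + k₂ + k₃) * S.bracket k₂)) : ℝ) : ℂ)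
    * S.q2 (1 - η) k₁ k₃ * S.q2 η (k₁ + k₃) k₂

end System

/-! ## Trees -/

/-- Position of a child below its parent. Binary nodes only have a left and a right child. -/
inductive Dir
  | left | mid | right
  deriving DecidableEq

instance : Fintype Dir := ⟨{.left, .mid, .right}, by intro x; cases x <;> simp⟩

/-- The four types of ternary nodes. -/
inductive TernaryType
  | lowL | lowM | lowR | high
  deriving DecidableEq

/-- The positions of the marked children of a ternary node. -/
def TernaryType.marks : TernaryType → Dir → Bool
  | .lowL, .mid => true
  | .lowL, .right => true
  | .lowM, .left => true
  | .lowM, .right => true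
  | .lowR, .left => true
  | .lowR, .mid => true
  | _, _ => false

/-- The cut-off functions `χ_{low-ℓ}, χ_{low-m}, χ_{low-r}, χ_high` in frequency space. -/
def Cutoff.chi {d : ℕ} (K : Cutoff) (ε : ℝ) (k₁ k₂ k₃ : E d) : TernaryType → ℝ :=
  let a : E d → ℝ := fun k => K.χ (ε ^ (-K.γ) * ‖k‖)
  let lowL := a (k₂ + k₃) * (1 - a (k₂ + k₁)) * (1 - a (k₃ + k₁))
  let lowM := a (k₃ + k₁) * (1 - a (k₃ + k₂)) * (1 - a (k₁ + k₂))
  let lowR := a (k₁ + k₂) * (1 - a (k₁ + k₃)) * (1 - a (k₂ + k₃))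
  fun s => match s with
    | .lowL => lowL
    | .lowM => lowM
    | .lowR => lowR
    | .high => 1 - lowL - lowM - lowR

/-- Rooted trees: the trivial tree `⊥`, `B_in(⊥,⊥)`, `B_st(A₁,A₂)` and `T_*(A₁,A₂,A₃)`. The two
children of an initial binary node are always leaves. -/
inductive Tree
  | leaf : Tree
  | binIn : Tree
  | binSt (A₁ A₂ : Tree) : Tree
  | ter (s : TernaryType) (A₁ A₂ A₃ : Tree) : Tree

/-- What sits at a vertex of a tree: a leaf, an initial or standard binary node, or a ternary node
of a given type. -/
inductive Kind
  | leaf | binIn | binSt | ter (s : TernaryType)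
  deriving DecidableEq

namespace Kind

def isLeaf : Kind → Bool
  | .leaf => true
  | _ => false

/-- Branching node (binary or ternary). -/
def isNode : Kind → Bool
  | .leaf => false
  | _ => true

def isBinary : Kind → Bool
  | .binIn => true
  | .binSt => true
  | _ => false

def isTernary : Kind → Bool
  | .ter _ => true
  | _ => false

def isLow : Kind → Bool
  | .ter .lowL => true
  | .ter .lowM => true
  | .ter .lowR => true
  | _ => false

end Kind

namespace Tree

/-- The `n` such that the tree belongs to `Ã_n`. -/
def size : Tree → ℕ
  | leaf => 0
  | binIn => 1
  | binSt A₁ A₂ => A₁.size + A₂.size + 1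
  | ter _ A₁ A₂ A₃ => A₁.size + A₂.size + A₃.size + 2

/-- A vertex (node or leaf) is encoded by the path from the root to it. -/
def vertices : Tree → Finset (List Dir)
  | leaf => {[]}
  | binIn => {[], [Dir.left], [Dir.right]}
  | binSt A₁ A₂ =>
      insert [] (A₁.vertices.image (Dir.left :: ·) ∪ A₂.vertices.image (Dir.right :: ·))
  | ter _ A₁ A₂ A₃ =>
      insert [] (A₁.vertices.image (Dir.left :: ·) ∪ A₂.vertices.image (Dir.mid :: ·)
        ∪ A₃.vertices.image (Dir.right :: ·))

/-- The kind of the vertex reached by a path (only relevant on `vertices`). -/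
def kindAt : Tree → List Dir → Kind
  | leaf, _ => .leaf
  | binIn, [] => .binIn
  | binIn, _ :: _ => .leaf
  | binSt _ _, [] => .binSt
  | binSt A₁ _, .left :: p => A₁.kindAt p
  | binSt _ _, .mid :: _ => .leaf
  | binSt _ A₂, .right :: p => A₂.kindAt p
  | ter s _ _ _, [] => .ter s
  | ter _ A₁ _ _, .left :: p => A₁.kindAt p
  | ter _ _ A₂ _, .mid :: p => A₂.kindAt p
  | ter _ _ _ A₃, .right :: p => A₃.kindAt p

theorem nil_mem_vertices (A : Tree) : [] ∈ A.vertices := by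
  cases A <;> simp [vertices]

/-- The vertices `𝓝(A) ⊔ 𝓛(A)`. -/
def Vertex (A : Tree) : Type := {p : List Dir // p ∈ A.vertices}

instance (A : Tree) : Fintype A.Vertex := inferInstanceAs (Fintype {p // p ∈ A.vertices})

instance (A : Tree) : DecidableEq A.Vertex :=
  inferInstanceAs (DecidableEq {p // p ∈ A.vertices})

/-- Parentality order: `j ≤ j'` iff `j'` lies on the path from the root to `j`. -/
instance (A : Tree) : PartialOrder A.Vertex where
  le j j' := j'.1 <+: j.1
  le_refl j := List.prefix_refl _
  le_trans _ _ _ h h' := h'.trans h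
  le_antisymm _ _ h h' :=
    Subtype.ext (h'.eq_of_length (le_antisymm h'.length_le h.length_le))

variable {A : Tree}

def root (A : Tree) : A.Vertex := ⟨[], A.nil_mem_vertices⟩

namespace Vertex

def kind (v : A.Vertex) : Kind := A.kindAt v.1

/-- The set of children of a vertex. -/
def children (j : A.Vertex) : Finset A.Vertex :=
  Finset.univ.filter fun j' => ∃ e : Dir, j'.1 = j.1 ++ [e]

/-- The left, middle or right child of `j` (a dummy value if there is no such child). -/
def child (j : A.Vertex) (e : Dir) : A.Vertex :=
  if h : j.1 ++ [e] ∈ A.vertices then ⟨j.1 ++ [e], h⟩ else j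

/-- A vertex is marked if it is one of the two children of a low ternary node that take part in
its low-frequency interaction. -/
def IsMarked (v : A.Vertex) : Prop :=
  ∃ (j : A.Vertex) (s : TernaryType) (e : Dir),
    j.kind = .ter s ∧ s.marks e = true ∧ v.1 = j.1 ++ [e]

end Vertex

/-- Leaves `𝓛(A)`. -/
abbrev Leaf (A : Tree) : Type := {v : A.Vertex // v.kind.isLeaf = true}

/-- Branching nodes `𝓝(A)`. -/
abbrev Node (A : Tree) : Type := {v : A.Vertex // v.kind.isNode = true}

/-- Binary nodes `𝓝_B(A)`. -/
abbrev BNode (A : Tree) : Type := {v : A.Vertex // v.kind.isBinary = true}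

/-- Ternary nodes `𝓝_T(A)`. -/
abbrev TNode (A : Tree) : Type := {v : A.Vertex // v.kind.isTernary = true}

/-- `InPrebush j ℓ` means `ℓ ∈ prebush(j)`: the prebush of a leaf is the leaf itself, and the
prebush of a node is the union of the prebushes of its unmarked children. -/
inductive InPrebush : A.Vertex → A.Leaf → Prop
  | leaf (ℓ : A.Leaf) : InPrebush ℓ.1 ℓ
  | node (j j' : A.Vertex) (ℓ : A.Leaf) : j.kind.isNode = true → j' ∈ j.children →
      ¬ j'.IsMarked → InPrebush j' ℓ → InPrebush j ℓ

/-- The bush of a low ternary node: the union of the prebushes of its marked children. -/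
def bush (j : A.Vertex) : Set A.Leaf :=
  {ℓ | ∃ j' ∈ j.children, j'.IsMarked ∧ InPrebush j' ℓ}

/-- Decoration maps of a tree. -/
def IsDecoration {d : ℕ} (κ : A.Vertex → E d) : Prop :=
  ∀ j : A.Vertex, j.kind.isNode = true → κ j = ∑ j' ∈ j.children, κ j'

/-- The domain `I_A(t)` of the time integrals. -/
def timeDomain (A : Tree) (t : ℝ) : Set (A.TNode → ℝ) :=
  {s | (∀ j, s j ∈ Set.Icc 0 t) ∧ ∀ j j' : A.TNode, j.1 ≤ j'.1 → s j ≤ s j'}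

end Tree

/-! ## Signed and coloured trees -/

/-- A tree with a sign map and a colour map. -/
structure SCTree where
  tree : Tree
  sign : tree.Vertex → ℤˣ
  colour : tree.Vertex → Fin 2
  colour_binary : ∀ j : tree.Vertex, j.kind.isBinary = true →
    ∀ j' ∈ j.children, colour j' = 1 - colour j
  colour_ternary : ∀ j : tree.Vertex, j.kind.isTernary = true →
    colour (j.child .left) = colour j ∧ colour (j.child .mid) = 1 - colour j ∧
      colour (j.child .right) = colour j

namespace SCTree

variable {d : ℕ} (S : System d) (K : Cutoff) (ε : ℝ) (T : SCTree) (κ : T.tree.Vertex → E d)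

/-- `φ(j)⟨κ(j)⟩ - ∑_{j' child of j} φ(j')⟨κ(j')⟩`: this is `Δ_j` for ternary and standard binary
nodes and `Δ'_j` for initial binary nodes. -/
def phase (j : T.tree.Vertex) : ℝ :=
  sgn (T.sign j) * S.bracket (κ j) - ∑ j' ∈ j.children, sgn (T.sign j') * S.bracket (κ j')

/-- `Δ_j`, which vanishes for initial binary nodes. -/
def delta (j : T.tree.Vertex) : ℝ :=
  if j.kind = .binIn then 0 else T.phase S κ j

open Classical in
/-- `Ω_j` for a ternary node `j`: the sum of `Δ_{j'}` over the nodes `j'` with `int(j') = j`, i.e.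
such that `j` is the least ternary node above (or equal to) `j'`. -/
def omega (j : T.tree.TNode) : ℝ :=
  ∑ j' : T.tree.Node,
    if IsLeast {i : T.tree.Vertex | i.kind.isTernary = true ∧ j'.1 ≤ i} j.1
    then T.delta S κ j'.1 else 0

open Classical in
/-- `Ω_{-1}`: the sum of `Δ_j` over the binary nodes `j` without any ternary node above them. -/
def omegaRoot : ℝ :=
  ∑ j : T.tree.BNode,
    if ∃ i : T.tree.Vertex, i.kind.isTernary = true ∧ j.1 ≤ i then 0 else T.delta S κ j.1

/-- The factor `q_j` attached to a branching node `j`. -/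
def q (j : T.tree.Vertex) : ℂ :=
  match j.kind with
  | .leaf => 1
  | .binSt => ((sgn (T.sign j) : ℝ) : ℂ)
      * (S.q2 (T.colour j) (κ (j.child .left)) (κ (j.child .right))
          / ((T.delta S κ j : ℝ) : ℂ))
  | .binIn => -((sgn (T.sign j) : ℝ) : ℂ)
      * (S.q2 (T.colour j) (κ (j.child .left)) (κ (j.child .right))
          / ((T.phase S κ j : ℝ) : ℂ))
  | .ter s => ((sgn (T.sign j) : ℝ) : ℂ)
      * ((K.chi ε (κ (j.child .left)) (κ (j.child .mid)) (κ (j.child .right)) s : ℝ) : ℂ)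
      * S.q3 (T.colour j) (T.sign j * T.sign (j.child .mid))
          (κ (j.child .left)) (κ (j.child .mid)) (κ (j.child .right))

end SCTree

/-! ## Couplings -/

/-- A coupling: two signed coloured trees (`part 0` and `part 1`) with the same overall number of
negative and positive leaves, and an involution `σ` of the leaves which maps the negative leaves
bijectively onto the positive ones. -/
structure Coupling where
  part : Fin 2 → SCTree
  σ : (Σ i, (part i).tree.Leaf) → (Σ i, (part i).tree.Leaf)
  card_eq : {ℓ : Σ i, (part i).tree.Leaf | (part ℓ.1).sign ℓ.2.1 = -1}.ncard
    = {ℓ : Σ i, (part i).tree.Leaf | (part ℓ.1).sign ℓ.2.1 = 1}.ncard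
  involutive : Function.Involutive σ
  bijOn : Set.BijOn σ {ℓ | (part ℓ.1).sign ℓ.2.1 = -1} {ℓ | (part ℓ.1).sign ℓ.2.1 = 1}

namespace Coupling

variable (C : Coupling)

/-- Leaves `𝓛(C)`. -/
abbrev Leaf : Type := Σ i, (C.part i).tree.Leaf

/-- Branching nodes `𝓝(C)`. -/
abbrev Node : Type := Σ i, (C.part i).tree.Node

/-- Sign of a leaf. -/
def leafSign (ℓ : C.Leaf) : ℤˣ := (C.part ℓ.1).sign ℓ.2.1

/-- Colour of a leaf. -/
def leafColour (ℓ : C.Leaf) : Fin 2 := (C.part ℓ.1).colour ℓ.2.1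

/-- `n(C)`. -/
def n : ℕ := ∑ i, (C.part i).tree.size

/-- `n_B(C)`. -/
def nB : ℕ := ∑ i, Fintype.card (C.part i).tree.BNode

/-- `n_T(C)`. -/
def nT : ℕ := ∑ i, Fintype.card (C.part i).tree.TNode

/-- The bush of a node of `C`. -/
def bush (j : C.Node) : Set C.Leaf :=
  {ℓ | ∃ ℓ' ∈ Tree.bush j.2.1, ℓ = ⟨j.1, ℓ'⟩}

/-- A set `B` of leaves (a bush) is self-coupled if `B₊` and `B₋` have the same cardinal and
`σ(B₊) = B₋`. -/
def IsSelfCoupled (B : Set C.Leaf) : Prop :=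
  (B ∩ {ℓ | C.leafSign ℓ = 1}).ncard = (B ∩ {ℓ | C.leafSign ℓ = -1}).ncard ∧
    C.σ '' (B ∩ {ℓ | C.leafSign ℓ = 1}) = B ∩ {ℓ | C.leafSign ℓ = -1}

/-- Resonant nodes: low ternary nodes with self-coupled bush, whose two marked children have
opposite signs and whose unmarked child has the sign of the node. -/
def IsResonant (j : C.Node) : Prop :=
  j.2.1.kind.isLow = true ∧
  C.IsSelfCoupled (C.bush j) ∧
  (∀ j₁ ∈ j.2.1.children, ∀ j₂ ∈ j.2.1.children, j₁.IsMarked → j₂.IsMarked → j₁ ≠ j₂ →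
    (C.part j.1).sign j₁ = -(C.part j.1).sign j₂) ∧
  (∀ j₃ ∈ j.2.1.children, ¬ j₃.IsMarked → (C.part j.1).sign j₃ = (C.part j.1).sign j.2.1)

/-- `k`-decorations of a coupling. -/
structure IsKDecoration {d : ℕ} (L : ℝ) (k : E d)
    (κ : ∀ i, (C.part i).tree.Vertex → E d) : Prop where
  decoration : ∀ i, Tree.IsDecoration (κ i)
  pairing : ∀ ℓ : C.Leaf, κ ℓ.1 ℓ.2.1 + κ (C.σ ℓ).1 (C.σ ℓ).2.1 = 0
  root_eq : κ 0 (C.part 0).tree.root = k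
  leaf_mem : ∀ ℓ : C.Leaf, κ ℓ.1 ℓ.2.1 ∈ lattice d L

open Complex in
/-- The contribution of a coupling, `F̂_C(ε^{-2} t, k)`, as a function of the rescaled time `t`. The
sum over decorations has only finitely many nonzero terms, since the `M^{η,η'}` have compact
support. Without ternary nodes the time integral is over a one-point space and equals `1`. -/
def Fhat {d : ℕ} (S : System d) (K : Cutoff) (L ε t : ℝ) (k : E d) : ℂ :=
  ((ε ^ C.nB / L ^ ((C.n : ℝ) * d / 2) : ℝ) : ℂ) * (-I) ^ C.nT *
    ∑' κ : {κ : ∀ i, (C.part i).tree.Vertex → E d // C.IsKDecoration L k κ},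
      exp (I * ((ε ^ (-2 : ℤ) * (∑ i, (C.part i).omegaRoot S (κ.1 i)) * t : ℝ) : ℂ))
      * (∏ i, ∏ j : (C.part i).tree.Node, (C.part i).q S K ε (κ.1 i) j.1)
      * (∫ s in Set.pi Set.univ (fun i => (C.part i).tree.timeDomain t),
          ∏ i, ∏ j : (C.part i).tree.TNode,
            exp (I * (((C.part i).omega S (κ.1 i) j * ε ^ (-2 : ℤ) * s i j : ℝ) : ℂ)))
      * ∏ ℓ ∈ Finset.univ.filter (fun ℓ : C.Leaf => C.leafSign ℓ = -1),
          signPow (S.M (C.leafColour ℓ) (C.leafColour (C.σ ℓ))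
            (sgn (C.leafSign ℓ) • κ.1 ℓ.1 ℓ.2.1)) (C.leafSign ℓ)

end Coupling

end KleinGordon

end

/-! The normalization `L ^ (-n d / 2)` exactly pays for the number of decorations. A coupling has `n
+ 2` leaves, hence `n / 2 + 1` pairs, each carrying one free lattice vector of size at most `R`, and
prescribing the root momentum `k` removes one of them (`pairedSet_finite_card`), provided some pair
joins the two trees. If none does, the root momentum is zero and the root factor vanishes because
`Q(ξ,-ξ) = 0`; the same happens at any branching node when `R L < 1`, since the only admissible
lattice vector is then `0`. In all other cases node factors and correlations are bounded, the time
integral is at most `δ ^ nT`, and this gives `ε ^ nB * δ ^ nT` up to a constant to the power `n + 1`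
(`norm_Fhat_le`). Comparing with `δ ^ (n/2) = δ ^ (nB/2) * δ ^ nT` and using `ε ≤ δ`, the factor `ε
^ (nB/2)` is left over, so a single binary node already provides the gain.

There remain the couplings with ternary nodes only. Every vertex then has an odd number of leaves
below it (`odd_card_leavesBelow`), and this parity drives the combinatorics. If the leaves under the
marked children of each low node are paired among themselves, so are all bushes
(`isSelfCoupled_bush`). Hence a non-resonant node yields one of: a low node whose marked leaves are
not stable under the pairing, a high node, or a low node with stable marked leaves and the wrong
signs (`nonresonant_cases`).

Fix such a node `j`. If `|Ω_j| > ε ^ (1/2)`, integrating in `t_j` gains `ε ^ (1/2)`, since the phase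
is multiplied by `ε ^ (-2)` (`norm_timeIntegral_le_of_lt`). The other decorations satisfy `|Ω_j| ≤ ε
^ (1/2)` and lie in the support of the cut-off at `j`, and they are shown to be few (`exists_gain`).
The counting device is `ncard_le_of_separated`: if moving a point of `S` by `1, 2, ...` steps of
length at most `s` along an integer direction always leaves `S`, until the total displacement is of
order one, then `S` occupies at most a fraction `s` of a slightly larger ball. Admissible directions
move one pair, or two pairs whose effects on the root cancel; parity guarantees that suitable ones
exist.

Three obstructions force a translate out of `S`: smallness of a momentum that moves
(`ncard_le_of_linear`), near-constancy of a sum of two moving brackets, which is uniformly convex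
(`ncard_le_of_convex`), and near-constancy of a difference of two moving brackets whose arguments
are not too close, which is monotone in the direction of their difference
(`ncard_le_of_difference`). A high node is handled by the first when a pair of its children has
small total momentum, and by the last two otherwise. In the remaining low case with opposite marked
signs the marked contributions cancel and `|Ω_j| ≥ 2 √m`, so nothing is left to count unless `ε` is
bounded below. -/

namespace KleinGordon

/-! ### Paths, children and leaves of a tree. -/

namespace Tree

/-- Vertices are paths, so the part of the tree hanging below a path is again a tree. This reduces
local statements at a vertex to statements at the root. -/
theorem exists_subtree (A : Tree) (p : List Dir) (hp : p ∈ A.vertices) :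
    ∃ B : Tree, ∀ q, (p ++ q ∈ A.vertices ↔ q ∈ B.vertices) ∧ A.kindAt (p ++ q) = B.kindAt q := by
  induction A generalizing p with
  | leaf => 
    simp only [vertices, Finset.mem_singleton] at hp
    subst hp
    exact ⟨leaf, fun q => ⟨Iff.rfl, rfl⟩⟩
  | binIn =>
    simp only [vertices, Finset.mem_singleton, Finset.mem_insert] at hp
    rcases hp with rfl | rfl | rfl
    · exact ⟨binIn, fun q => ⟨Iff.rfl, rfl⟩⟩
    · exact ⟨leaf, fun q => ⟨by simp [vertices], rfl⟩⟩
    · exact ⟨leaf, fun q => ⟨by simp [vertices], rfl⟩⟩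
  | binSt A₁ A₂ h₁ h₂ =>
    simp only [vertices, Finset.mem_insert, Finset.mem_union, Finset.mem_image] at hp
    rcases hp with rfl | ⟨p', hp', rfl⟩ | ⟨p', hp', rfl⟩
    · exact ⟨binSt A₁ A₂, fun q => ⟨Iff.rfl, rfl⟩⟩
    · obtain ⟨B, hB⟩ := h₁ p' hp'
      exact ⟨B, fun q => ⟨by simpa [vertices] using (hB q).1, (hB q).2⟩⟩
    · obtain ⟨B, hB⟩ := h₂ p' hp'
      exact ⟨B, fun q => ⟨by simpa [vertices] using (hB q).1, (hB q).2⟩⟩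
  | ter s A₁ A₂ A₃ h₁ h₂ h₃ =>
    simp only [vertices, Finset.mem_insert, Finset.mem_union, Finset.mem_image] at hp
    rcases hp with rfl | (⟨p', hp', rfl⟩ | ⟨p', hp', rfl⟩) | ⟨p', hp', rfl⟩
    · exact ⟨ter s A₁ A₂ A₃, fun q => ⟨Iff.rfl, rfl⟩⟩
    · obtain ⟨B, hB⟩ := h₁ p' hp'
      exact ⟨B, fun q => ⟨by simpa [vertices] using (hB q).1, (hB q).2⟩⟩
    · obtain ⟨B, hB⟩ := h₂ p' hp'
      exact ⟨B, fun q => ⟨by simpa [vertices] using (hB q).1, (hB q).2⟩⟩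
    · obtain ⟨B, hB⟩ := h₃ p' hp'
      exact ⟨B, fun q => ⟨by simpa [vertices] using (hB q).1, (hB q).2⟩⟩

theorem vertices_of_append (A : Tree) (p q : List Dir) (h : p ++ q ∈ A.vertices) :
    p ∈ A.vertices := by
  induction A generalizing p with
  | leaf => simp_all [vertices]
  | binIn =>
    cases p with
    | nil => simp [vertices]
    | cons e p => cases p <;> simp_all [vertices]; tauto
  | binSt A₁ A₂ h₁ h₂ =>
    cases p with
    | nil => simp [vertices]
    | cons e p =>
      simp only [vertices, Finset.mem_insert, Finset.mem_union, Finset.mem_image, List.cons_append,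
        List.cons.injEq, reduceCtorEq, false_or] at h ⊢
      rcases h with ⟨r, hr, rfl, rfl⟩ | ⟨r, hr, rfl, rfl⟩
      · exact .inl ⟨p, h₁ p hr, rfl, rfl⟩
      · exact .inr ⟨p, h₂ p hr, rfl, rfl⟩
  | ter s A₁ A₂ A₃ h₁ h₂ h₃ =>
    cases p with
    | nil => simp [vertices]
    | cons e p =>
      simp only [vertices, Finset.mem_insert, Finset.mem_union, Finset.mem_image, List.cons_append,
        List.cons.injEq, reduceCtorEq, false_or] at h ⊢
      rcases h with (⟨r, hr, rfl, rfl⟩ | ⟨r, hr, rfl, rfl⟩) | ⟨r, hr, rfl, rfl⟩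
      · exact .inl (.inl ⟨p, h₁ p hr, rfl, rfl⟩)
      · exact .inl (.inr ⟨p, h₂ p hr, rfl, rfl⟩)
      · exact .inr ⟨p, h₃ p hr, rfl, rfl⟩

theorem cons_mem_vertices_of_kind (B : Tree) (e : Dir) :
    [e] ∈ B.vertices ↔ (B.kindAt []).isTernary = true ∨
      ((B.kindAt []).isBinary = true ∧ e ≠ Dir.mid) := by
  cases B <;> cases e <;>
    simp [vertices, kindAt, Kind.isTernary, Kind.isBinary, nil_mem_vertices]

variable {A : Tree}

theorem append_mem_vertices_iff (j : A.Vertex) (e : Dir) :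
    j.1 ++ [e] ∈ A.vertices ↔ j.kind.isTernary = true ∨ (j.kind.isBinary = true ∧ e ≠ Dir.mid) := by
  obtain ⟨B, hB⟩ := exists_subtree A j.1 j.2
  have h0 := (hB []).2
  rw [List.append_nil] at h0
  rw [(hB [e]).1, cons_mem_vertices_of_kind, ← h0]
  rfl

theorem isNode_iff_not_isLeaf (k : Kind) : k.isNode = true ↔ ¬ k.isLeaf = true := by
  cases k <;> simp [Kind.isLeaf, Kind.isNode]

theorem isNode_iff (k : Kind) : k.isNode = true ↔ k.isBinary = true ∨ k.isTernary = true := by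
  cases k <;> simp [Kind.isBinary, Kind.isNode, Kind.isTernary]

theorem isTernary_iff (k : Kind) : k.isTernary = true ↔ ∃ s, k = .ter s := by
  cases k <;> simp [Kind.isTernary]

theorem Vertex.le_def (v w : A.Vertex) : v ≤ w ↔ w.1 <+: v.1 := Iff.rfl

theorem mem_children_iff (j c : A.Vertex) : c ∈ j.children ↔ ∃ e : Dir, c.1 = j.1 ++ [e] := by
  simp [Vertex.children]

theorem child_val {j : A.Vertex} {e : Dir} (h : j.1 ++ [e] ∈ A.vertices) :
    (j.child e).1 = j.1 ++ [e] := by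
  simp [Vertex.child, h]

theorem child_val_ternary {j : A.Vertex} (h : j.kind.isTernary = true) (e : Dir) :
    (j.child e).1 = j.1 ++ [e] :=
  child_val ((append_mem_vertices_iff j e).2 (.inl h))

theorem child_injective {j : A.Vertex} (h : j.kind.isTernary = true) :
    Function.Injective j.child := by
  intro e e' he
  have := congrArg Subtype.val he
  rw [child_val_ternary h, child_val_ternary h] at this
  simpa using this

theorem children_ternary {j : A.Vertex} (h : j.kind.isTernary = true) :
    j.children = Finset.univ.image j.child := by
  ext c
  rw [mem_children_iff]
  simp only [Finset.mem_image, Finset.mem_univ, true_and]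
  constructor
  · rintro ⟨e, he⟩
    exact ⟨e, Subtype.ext ((child_val_ternary h e).trans he.symm)⟩
  · rintro ⟨e, rfl⟩
    exact ⟨e, child_val_ternary h e⟩

theorem sum_children_ternary {M : Type*} [AddCommMonoid M] {j : A.Vertex}
    (h : j.kind.isTernary = true) (f : A.Vertex → M) :
    ∑ c ∈ j.children, f c = ∑ e, f (j.child e) := by
  rw [children_ternary h, Finset.sum_image (fun a _ b _ hab => child_injective h hab)]

theorem sum_dir {M : Type*} [AddCommMonoid M] (f : Dir → M) :
    ∑ e, f e = f .left + f .mid + f .right := by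
  have : (Finset.univ : Finset Dir) = {.left, .mid, .right} := rfl
  rw [this]
  simp [add_assoc]

theorem children_binary {j : A.Vertex} (h : j.kind.isBinary = true) :
    j.children = {j.child .left, j.child .right} ∧ j.child .left ≠ j.child .right := by
  have hl := child_val ((append_mem_vertices_iff j .left).2 (.inr ⟨h, by simp⟩))
  have hr := child_val ((append_mem_vertices_iff j .right).2 (.inr ⟨h, by simp⟩))
  have hm : ¬ j.kind.isTernary = true := by
    revert h
    cases j.kind <;> simp [Kind.isBinary, Kind.isTernary]
  refine ⟨?_, fun H => ?_⟩
  · ext c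
    rw [mem_children_iff]
    simp only [Finset.mem_insert, Finset.mem_singleton]
    constructor
    · rintro ⟨e, he⟩
      cases e with
      | left => exact .inl (Subtype.ext (he.trans hl.symm))
      | right => exact .inr (Subtype.ext (he.trans hr.symm))
      | mid =>
        have := (append_mem_vertices_iff j .mid).1 (he ▸ c.2)
        simp [hm] at this
    · rintro (rfl | rfl)
      · exact ⟨_, hl⟩
      · exact ⟨_, hr⟩
  · have := congrArg Subtype.val H
    rw [hl, hr] at this
    simp at this

theorem sum_children_binary {M : Type*} [AddCommMonoid M] {j : A.Vertex}
    (h : j.kind.isBinary = true) (f : A.Vertex → M) :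
    ∑ c ∈ j.children, f c = f (j.child .left) + f (j.child .right) := by
  rw [(children_binary h).1, Finset.sum_pair (children_binary h).2]

theorem child_lt_of_mem {j c : A.Vertex} (h : c ∈ j.children) : c < j := by
  obtain ⟨e, he⟩ := (mem_children_iff j c).1 h
  refine lt_of_le_of_ne ⟨[e], he.symm⟩ ?_
  rintro rfl
  simp at he

/-- Below a branching node one passes through one of its children. -/
theorem exists_child_of_lt {v j : A.Vertex} (h : v < j) : ∃ c ∈ j.children, v ≤ c := by
  obtain ⟨r, hr⟩ := (Vertex.le_def _ _).1 h.le
  cases r with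
  | nil =>
    rw [List.append_nil] at hr
    exact absurd (Subtype.ext hr) h.ne'
  | cons e r =>
    have hc : j.1 ++ [e] ∈ A.vertices := by
      apply vertices_of_append A _ r
      simpa [hr] using v.2
    refine ⟨⟨_, hc⟩, (mem_children_iff _ _).2 ⟨e, rfl⟩, ⟨r, ?_⟩⟩
    simpa using hr

theorem le_total_of_le {v w w' : A.Vertex} (h : v ≤ w) (h' : v ≤ w') : w ≤ w' ∨ w' ≤ w :=
  (List.prefix_or_prefix_of_prefix h h').symm

theorem child_unique {v j c c' : A.Vertex} (hc : c ∈ j.children) (hc' : c' ∈ j.children)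
    (h : v ≤ c) (h' : v ≤ c') : c = c' := by
  obtain ⟨e, he⟩ := (mem_children_iff j c).1 hc
  obtain ⟨e', he'⟩ := (mem_children_iff j c').1 hc'
  have : c.1.length = c'.1.length := by rw [he, he']; simp
  rcases le_total_of_le h h' with H | H
  · exact (Subtype.ext (List.IsPrefix.eq_of_length H this.symm)).symm
  · exact Subtype.ext (List.IsPrefix.eq_of_length H this)

theorem not_lt_leaf {v ℓ : A.Vertex} (h : ℓ.kind.isLeaf = true) : ¬ v < ℓ := by
  intro hv
  obtain ⟨c, hc, -⟩ := exists_child_of_lt hv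
  obtain ⟨e, he⟩ := (mem_children_iff ℓ c).1 hc
  have := (append_mem_vertices_iff ℓ e).1 (he ▸ c.2)
  revert this h
  cases ℓ.kind <;> simp [Kind.isLeaf, Kind.isTernary, Kind.isBinary]

instance : WellFoundedLT A.Vertex := Finite.to_wellFoundedLT

/-- Induction from the leaves to the root. -/
theorem vertex_induction {P : A.Vertex → Prop}
    (leaf : ∀ v : A.Vertex, v.kind.isLeaf = true → P v)
    (node : ∀ v : A.Vertex, v.kind.isNode = true → (∀ c ∈ v.children, P c) → P v)
    (v : A.Vertex) : P v := by
  induction v using WellFoundedLT.induction with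
  | ind v ih =>
    by_cases h : v.kind.isLeaf = true
    · exact leaf v h
    · exact node v ((isNode_iff_not_isLeaf _).2 h) fun c hc => ih c (child_lt_of_mem hc)

open Classical in
/-- The leaves below a vertex. -/
noncomputable def leavesBelow (v : A.Vertex) : Finset A.Leaf :=
  Finset.univ.filter fun ℓ => ℓ.1 ≤ v

theorem mem_leavesBelow {v : A.Vertex} {ℓ : A.Leaf} : ℓ ∈ leavesBelow v ↔ ℓ.1 ≤ v := by
  simp [leavesBelow]

theorem leavesBelow_leaf {v : A.Vertex} (h : v.kind.isLeaf = true) :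
    leavesBelow v = {⟨v, h⟩} := by
  ext ℓ
  rw [mem_leavesBelow, Finset.mem_singleton]
  constructor
  · intro hl
    rcases hl.lt_or_eq with hlt | heq
    · exact absurd hlt (not_lt_leaf h)
    · exact Subtype.ext heq
  · rintro rfl
    exact le_rfl

theorem leaf_le_node_iff {j : A.Vertex} (h : j.kind.isNode = true) (ℓ : A.Leaf) :
    ℓ.1 ≤ j ↔ ∃ c ∈ j.children, ℓ.1 ≤ c := by
  constructor
  · intro hl
    refine exists_child_of_lt (lt_of_le_of_ne hl ?_)
    rintro rfl
    exact (isNode_iff_not_isLeaf _).1 h ℓ.2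
  · rintro ⟨c, hc, hl⟩
    exact hl.trans (child_lt_of_mem hc).le

theorem sum_leavesBelow_node {M : Type*} [AddCommMonoid M] {j : A.Vertex}
    (h : j.kind.isNode = true) (f : A.Leaf → M) :
    ∑ ℓ ∈ leavesBelow j, f ℓ = ∑ c ∈ j.children, ∑ ℓ ∈ leavesBelow c, f ℓ := by
  classical
  rw [← Finset.sum_biUnion]
  · congr 1
    ext ℓ
    simp only [mem_leavesBelow, Finset.mem_biUnion, leaf_le_node_iff h]
  · intro c hc c' hc' hne
    refine Finset.disjoint_left.2 fun ℓ hl hl' => hne ?_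
    exact child_unique hc hc' (mem_leavesBelow.1 hl) (mem_leavesBelow.1 hl')

/-- Iterating the sum rule down to the leaves shows that leaf values determine a decoration, so that
counting decorations becomes counting families indexed by leaves. -/
theorem isDecoration_iff {d : ℕ} (κ : A.Vertex → E d) :
    IsDecoration κ ↔ ∀ v, κ v = ∑ ℓ ∈ leavesBelow v, κ ℓ.1 := by
  constructor
  · intro h v
    induction v using vertex_induction with
    | leaf v hv => rw [leavesBelow_leaf hv, Finset.sum_singleton]
    | node v hv ih => rw [h v hv, sum_leavesBelow_node hv]; exact Finset.sum_congr rfl ih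
  · intro h j hj
    rw [h j, sum_leavesBelow_node hj]
    exact Finset.sum_congr rfl fun c _ => (h c).symm

/-- Without binary nodes below it, a vertex has an odd number of leaves below it. -/
theorem odd_card_leavesBelow (hA : ∀ v : A.Vertex, ¬ v.kind.isBinary = true) (v : A.Vertex) :
    Odd (leavesBelow v).card := by
  induction v using vertex_induction with
  | leaf v hv => simp [leavesBelow_leaf hv]
  | node v hv ih =>
    have ht : v.kind.isTernary = true := ((isNode_iff _).1 hv).resolve_left (hA v)
    have hc : ∀ e, v.child e ∈ v.children := fun e => by
      rw [children_ternary ht]; simp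
    rw [Finset.card_eq_sum_ones, sum_leavesBelow_node hv, sum_children_ternary ht, sum_dir]
    simp only [← Finset.card_eq_sum_ones]
    exact ((ih _ (hc _)).add_odd (ih _ (hc _))).add_odd (ih _ (hc _))

/-! ### Counting vertices by kind. -/

theorem card_filter_vertex (P : Kind → Bool) :
    Fintype.card {v : A.Vertex // P v.kind = true}
      = (A.vertices.filter fun p => P (A.kindAt p) = true).card := by
  rw [Fintype.card_subtype]
  refine Finset.card_bij (fun v _ => v.1) ?_ ?_ ?_
  · intro v hv
    simp only [Finset.mem_filter, Finset.mem_univ, true_and] at hv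
    exact Finset.mem_filter.2 ⟨v.2, hv⟩
  · intro v _ w _ h
    exact Subtype.ext h
  · intro p hp
    rw [Finset.mem_filter] at hp
    exact ⟨⟨p, hp.1⟩, Finset.mem_filter.2 ⟨Finset.mem_univ _, hp.2⟩, rfl⟩

theorem card_filter_image (B : Tree) (e : Dir) (Q : List Dir → Prop) [DecidablePred Q] :
    ((B.vertices.image (e :: ·)).filter Q).card = (B.vertices.filter fun p => Q (e :: p)).card := by
  rw [Finset.filter_image, Finset.card_image_of_injective _ (List.cons_injective)]

theorem card_filter_binSt (A₁ A₂ : Tree) (P : Kind → Bool) :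
    (((binSt A₁ A₂).vertices).filter fun p => P ((binSt A₁ A₂).kindAt p) = true).card
      = (if P .binSt then 1 else 0) + (A₁.vertices.filter fun p => P (A₁.kindAt p) = true).card
        + (A₂.vertices.filter fun p => P (A₂.kindAt p) = true).card := by
  rw [vertices, Finset.filter_insert, Finset.filter_union]
  have hd : Disjoint
      ((A₁.vertices.image (Dir.left :: ·)).filter fun p => P ((binSt A₁ A₂).kindAt p) = true)
      ((A₂.vertices.image (Dir.right :: ·)).filter fun p => P ((binSt A₁ A₂).kindAt p) = true) := by
    refine Finset.disjoint_filter_filter (Finset.disjoint_left.2 ?_)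
    simp
  have hu := Finset.card_union_of_disjoint hd
  rw [card_filter_image, card_filter_image] at hu
  simp only [show ∀ p, (binSt A₁ A₂).kindAt (Dir.left :: p) = A₁.kindAt p from fun _ => rfl,
    show ∀ p, (binSt A₁ A₂).kindAt (Dir.right :: p) = A₂.kindAt p from fun _ => rfl] at hu
  by_cases h : P .binSt = true
  · have h' : P ((binSt A₁ A₂).kindAt []) = true := h
    rw [if_pos h', if_pos h, Finset.card_insert_of_notMem (by simp), hu]
    ring
  · have h' : ¬ P ((binSt A₁ A₂).kindAt []) = true := h
    rw [if_neg h', if_neg h, hu]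
    ring

theorem card_filter_ter (s : TernaryType) (A₁ A₂ A₃ : Tree) (P : Kind → Bool) :
    (((ter s A₁ A₂ A₃).vertices).filter fun p => P ((ter s A₁ A₂ A₃).kindAt p) = true).card
      = (if P (.ter s) then 1 else 0)
        + (A₁.vertices.filter fun p => P (A₁.kindAt p) = true).card
        + (A₂.vertices.filter fun p => P (A₂.kindAt p) = true).card
        + (A₃.vertices.filter fun p => P (A₃.kindAt p) = true).card := by
  rw [vertices, Finset.filter_insert, Finset.filter_union, Finset.filter_union]
  have hd : Disjoint
      ((A₁.vertices.image (Dir.left :: ·)).filter fun p => P ((ter s A₁ A₂ A₃).kindAt p) = true)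
      ((A₂.vertices.image (Dir.mid :: ·)).filter
        fun p => P ((ter s A₁ A₂ A₃).kindAt p) = true) := by
    refine Finset.disjoint_filter_filter (Finset.disjoint_left.2 ?_)
    simp
  have hd' : Disjoint
      (((A₁.vertices.image (Dir.left :: ·)).filter fun p => P ((ter s A₁ A₂ A₃).kindAt p) = true) ∪
      ((A₂.vertices.image (Dir.mid :: ·)).filter
        fun p => P ((ter s A₁ A₂ A₃).kindAt p) = true))
      ((A₃.vertices.image (Dir.right :: ·)).filter
        fun p => P ((ter s A₁ A₂ A₃).kindAt p) = true) := by
    rw [← Finset.filter_union]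
    refine Finset.disjoint_filter_filter (Finset.disjoint_left.2 ?_)
    simp only [Finset.mem_union, Finset.mem_image]
    rintro p (⟨a, -, rfl⟩ | ⟨a, -, rfl⟩) <;> simp
  have hu := Finset.card_union_of_disjoint hd'
  rw [Finset.card_union_of_disjoint hd, card_filter_image, card_filter_image,
    card_filter_image] at hu
  simp only [show ∀ p, (ter s A₁ A₂ A₃).kindAt (Dir.left :: p) = A₁.kindAt p from fun _ => rfl,
    show ∀ p, (ter s A₁ A₂ A₃).kindAt (Dir.mid :: p) = A₂.kindAt p from fun _ => rfl,
    show ∀ p, (ter s A₁ A₂ A₃).kindAt (Dir.right :: p) = A₃.kindAt p from fun _ => rfl] at hu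
  by_cases h : P (.ter s) = true
  · have h' : P ((ter s A₁ A₂ A₃).kindAt []) = true := h
    rw [if_pos h', if_pos h, Finset.card_insert_of_notMem (by simp), hu]
    ring
  · have h' : ¬ P ((ter s A₁ A₂ A₃).kindAt []) = true := h
    rw [if_neg h', if_neg h, hu]
    ring

theorem card_vertices_aux (A : Tree) :
    (A.vertices.filter fun p => (A.kindAt p).isLeaf = true).card = A.size + 1 ∧
    A.size = (A.vertices.filter fun p => (A.kindAt p).isBinary = true).card
      + 2 * (A.vertices.filter fun p => (A.kindAt p).isTernary = true).card ∧
    (A.vertices.filter fun p => (A.kindAt p).isNode = true).card ≤ A.size := by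
  induction A with
  | leaf => decide
  | binIn => decide
  | binSt A₁ A₂ h₁ h₂ =>
    rw [card_filter_binSt, card_filter_binSt, card_filter_binSt, card_filter_binSt]
    simp only [show (Kind.binSt).isLeaf = false from rfl, show (Kind.binSt).isNode = true from rfl,
      show (Kind.binSt).isBinary = true from rfl, show (Kind.binSt).isTernary = false from rfl, size,
      Bool.false_eq_true, if_true, if_false]
    omega
  | ter s A₁ A₂ A₃ h₁ h₂ h₃ =>
    rw [card_filter_ter, card_filter_ter, card_filter_ter, card_filter_ter]
    simp only [show (Kind.ter s).isLeaf = false from rfl, show (Kind.ter s).isNode = true from rfl,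
      show (Kind.ter s).isBinary = false from rfl, show (Kind.ter s).isTernary = true from rfl, size,
      Bool.false_eq_true, if_true, if_false]
    omega

theorem card_leaf (A : Tree) : Fintype.card A.Leaf = A.size + 1 := by
  rw [card_filter_vertex Kind.isLeaf, A.card_vertices_aux.1]

theorem size_eq (A : Tree) :
    A.size = Fintype.card A.BNode + 2 * Fintype.card A.TNode := by
  rw [card_filter_vertex Kind.isBinary, card_filter_vertex Kind.isTernary]
  exact A.card_vertices_aux.2.1

theorem card_node_le (A : Tree) : Fintype.card A.Node ≤ A.size := by
  rw [card_filter_vertex Kind.isNode]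
  exact A.card_vertices_aux.2.2

end Tree

/-- The position of the unmarked child of a low ternary node. -/
def TernaryType.free : TernaryType → Dir
  | .lowL => .left
  | .lowM => .mid
  | .lowR => .right
  | .high => .left

theorem TernaryType.marks_iff (s : TernaryType) (e : Dir) :
    s.marks e = true ↔ s ≠ .high ∧ e ≠ s.free := by
  cases s <;> cases e <;> simp [TernaryType.marks, TernaryType.free]

/-! ### Marked vertices, prebushes and bushes. -/

namespace Tree

variable {A : Tree}

theorem isMarked_child_iff {j : A.Vertex} {s : TernaryType} (h : j.kind = .ter s) (e : Dir) :
    (j.child e).IsMarked ↔ s ≠ .high ∧ e ≠ s.free := by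
  have ht : j.kind.isTernary = true := (isTernary_iff _).2 ⟨s, h⟩
  rw [← TernaryType.marks_iff]
  constructor
  · rintro ⟨j', s', e', hj', hm, he'⟩
    rw [child_val_ternary ht] at he'
    obtain ⟨h1, h2⟩ := List.append_inj' he' rfl
    obtain rfl : j = j' := Subtype.ext h1
    obtain rfl : e = e' := by simpa using h2
    rw [h] at hj'
    obtain rfl : s = s' := by simpa using hj'
    exact hm
  · intro hm
    exact ⟨j, s, e, h, hm, child_val_ternary ht e⟩

/-- The recursion follows the unique path from `v` down to the leaf and stops at the first marked
vertex strictly below `v`; the status of `v` itself plays no role. -/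
theorem inPrebush_iff (v : A.Vertex) (ℓ : A.Leaf) :
    InPrebush v ℓ ↔ ℓ.1 ≤ v ∧ ∀ w, ℓ.1 ≤ w → w < v → ¬ w.IsMarked := by
  constructor
  · intro h
    induction h with
    | leaf ℓ => exact ⟨le_rfl, fun w hw hw' => absurd hw hw'.not_ge⟩
    | node j c ℓ hj hc hm _ ih =>
      refine ⟨ih.1.trans (child_lt_of_mem hc).le, fun w hw hwj => ?_⟩
      obtain ⟨c', hc', hwc'⟩ := exists_child_of_lt hwj
      obtain rfl : c = c' := child_unique hc hc' ih.1 (hw.trans hwc')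
      rcases hwc'.lt_or_eq with hlt | rfl
      · exact ih.2 w hw hlt
      · exact hm
  · induction v using vertex_induction with
    | leaf v hv =>
      rintro ⟨hl, -⟩
      have := mem_leavesBelow.2 hl
      rw [leavesBelow_leaf hv, Finset.mem_singleton] at this
      subst this
      exact InPrebush.leaf (⟨v, hv⟩ : A.Leaf)
    | node v hv ih =>
      rintro ⟨hl, hw⟩
      obtain ⟨c, hc, hlc⟩ := (leaf_le_node_iff hv ℓ).1 hl
      exact InPrebush.node v c ℓ hv hc (hw c hlc (child_lt_of_mem hc))
        (ih c hc ⟨hlc, fun w h h' => hw w h (h'.trans (child_lt_of_mem hc))⟩)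

/-- The leaves below the marked children of a vertex. -/
def markedLeaves (j : A.Vertex) : Set A.Leaf := {ℓ | ∃ c ∈ j.children, c.IsMarked ∧ ℓ.1 ≤ c}

/-- A marked vertex met strictly below the marked child puts the leaf among the marked leaves of a
lower node. The bush is therefore a set difference of sets of marked leaves, and stability under the
pairing passes from these sets to the bush. -/
theorem mem_bush_iff (j : A.Vertex) (ℓ : A.Leaf) :
    ℓ ∈ bush j ↔ ℓ ∈ markedLeaves j ∧ ∀ j' < j, ℓ ∉ markedLeaves j' := by
  constructor
  · rintro ⟨c, hc, hm, hp⟩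
    rw [inPrebush_iff] at hp
    refine ⟨⟨c, hc, hm, hp.1⟩, ?_⟩
    rintro j' hj' ⟨c', hc', hm', hl'⟩
    have hlt := child_lt_of_mem hc'
    obtain ⟨c₂, hc₂, hj'c₂⟩ := exists_child_of_lt hj'
    obtain rfl : c = c₂ := child_unique hc hc₂ hp.1 (hl'.trans (hlt.le.trans hj'c₂))
    exact hp.2 c' hl' (hlt.trans_le hj'c₂) hm'
  · rintro ⟨⟨c, hc, hm, hl⟩, H⟩
    refine ⟨c, hc, hm, (inPrebush_iff _ _).2 ⟨hl, ?_⟩⟩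
    rintro w hw hwc ⟨j', s, e, hs, hse, hwe⟩
    have hwm : w.IsMarked := ⟨j', s, e, hs, hse, hwe⟩
    have hwj' : w ∈ j'.children := (mem_children_iff _ _).2 ⟨e, hwe⟩
    have hj'c : j' ≤ c := by
      have h1 : c.1 <+: j'.1 ++ [e] := hwe ▸ hwc.le
      rcases List.prefix_concat_iff.1 h1 with h2 | h2
      · exact absurd (Subtype.ext (h2.trans hwe.symm)) hwc.ne'
      · exact h2
    exact H j' (hj'c.trans_lt (child_lt_of_mem hc)) ⟨w, hwj', hwm, hw⟩

end Tree

/-! ### Leaf sets of a coupling and stability under the pairing. -/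

namespace Coupling

variable (C : Coupling)

theorem leafSign_σ (ℓ : C.Leaf) : C.leafSign (C.σ ℓ) = -C.leafSign ℓ := by
  rcases Int.units_eq_one_or (C.leafSign ℓ) with h | h
  · obtain ⟨ℓ', hℓ', hσ⟩ := C.bijOn.surjOn h
    rw [h, ← hσ, C.involutive ℓ']
    exact hℓ'
  · rw [h, neg_neg]
    exact C.bijOn.mapsTo h

theorem σ_ne (ℓ : C.Leaf) : C.σ ℓ ≠ ℓ := by
  intro h
  have := C.leafSign_σ ℓ
  rw [h] at this
  exact units_ne_neg_self _ this

/-- The pairing reverses signs, so on a stable set it exchanges the positive and the negative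
leaves. -/
theorem isSelfCoupled_of_closed {B : Set C.Leaf} (hB : ∀ ℓ ∈ B, C.σ ℓ ∈ B) :
    C.IsSelfCoupled B := by
  have h : C.σ '' (B ∩ {ℓ | C.leafSign ℓ = 1}) = B ∩ {ℓ | C.leafSign ℓ = -1} := by
    ext ℓ
    constructor
    · rintro ⟨ℓ', ⟨h1, h2⟩, rfl⟩
      exact ⟨hB _ h1, by rw [Set.mem_ofPred_eq, leafSign_σ, h2]⟩
    · rintro ⟨h1, h2⟩
      exact ⟨C.σ ℓ, ⟨hB _ h1, by rw [Set.mem_ofPred_eq, leafSign_σ, h2, neg_neg]⟩, C.involutive ℓ⟩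
  refine ⟨?_, h⟩
  rw [← h, Set.ncard_image_of_injective _ C.involutive.injective]

/-- The leaves of a coupling below a vertex. -/
noncomputable def below (i : Fin 2) (v : (C.part i).tree.Vertex) : Finset C.Leaf :=
  (Tree.leavesBelow v).map ⟨Sigma.mk i, sigma_mk_injective⟩

theorem mem_below {i : Fin 2} {v : (C.part i).tree.Vertex} {ℓ : C.Leaf} :
    ℓ ∈ C.below i v ↔ ∃ ℓ' : (C.part i).tree.Leaf, ℓ'.1 ≤ v ∧ ⟨i, ℓ'⟩ = ℓ := by
  simp [below, Tree.mem_leavesBelow]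

theorem fst_of_mem_below {i : Fin 2} {v : (C.part i).tree.Vertex} {ℓ : C.Leaf}
    (h : ℓ ∈ C.below i v) : ℓ.1 = i := by
  obtain ⟨ℓ', -, rfl⟩ := C.mem_below.1 h
  rfl

theorem below_mono {i : Fin 2} {v w : (C.part i).tree.Vertex} (h : v ≤ w) :
    C.below i v ⊆ C.below i w := by
  intro ℓ hℓ
  obtain ⟨ℓ', h', rfl⟩ := C.mem_below.1 hℓ
  exact C.mem_below.2 ⟨ℓ', h'.trans h, rfl⟩

theorem sum_below {M : Type*} [AddCommMonoid M] (i : Fin 2) (v : (C.part i).tree.Vertex)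
    (f : C.Leaf → M) :
    ∑ ℓ ∈ C.below i v, f ℓ = ∑ ℓ ∈ Tree.leavesBelow v, f ⟨i, ℓ⟩ := by
  simp [below]

theorem card_below (i : Fin 2) (v : (C.part i).tree.Vertex) :
    (C.below i v).card = (Tree.leavesBelow v).card := Finset.card_map _

theorem mem_below_root {i : Fin 2} {ℓ : C.Leaf} :
    ℓ ∈ C.below i (C.part i).tree.root ↔ ℓ.1 = i := by
  refine ⟨C.fst_of_mem_below, ?_⟩
  obtain ⟨i', ℓ'⟩ := ℓ
  rintro rfl
  exact C.mem_below.2 ⟨ℓ', List.nil_prefix, rfl⟩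

/-- The leaves below `v` that are not below its child at position `e`. -/
noncomputable def others (i : Fin 2) (v : (C.part i).tree.Vertex) (e : Dir) : Finset C.Leaf :=
  open Classical in C.below i v \ C.below i (v.child e)

theorem child_mem {A : Tree} {j : A.Vertex} (h : j.kind.isTernary = true) (e : Dir) :
    j.child e ∈ j.children := by
  rw [Tree.children_ternary h]
  simp

theorem mem_others_iff {i : Fin 2} {v : (C.part i).tree.Vertex} (h : v.kind.isTernary = true)
    {e : Dir} {ℓ : C.Leaf} :
    ℓ ∈ C.others i v e ↔ ∃ e', e' ≠ e ∧ ℓ ∈ C.below i (v.child e') := by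
  classical
  rw [others, Finset.mem_sdiff]
  constructor
  · rintro ⟨h1, h2⟩
    obtain ⟨ℓ', hl, rfl⟩ := C.mem_below.1 h1
    obtain ⟨c, hc, hlc⟩ := (Tree.leaf_le_node_iff ((Tree.isNode_iff _).2 (.inr h)) ℓ').1 hl
    rw [Tree.children_ternary h] at hc
    obtain ⟨e', -, rfl⟩ := Finset.mem_image.1 hc
    have h3 := C.mem_below.2 ⟨ℓ', hlc, rfl⟩
    refine ⟨e', ?_, h3⟩
    rintro rfl
    exact h2 h3
  · rintro ⟨e', hne, hl⟩
    refine ⟨C.below_mono (Tree.child_lt_of_mem (child_mem h e')).le hl, fun hl' => hne ?_⟩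
    obtain ⟨ℓ', hle, rfl⟩ := C.mem_below.1 hl
    obtain ⟨ℓ'', hle', heq⟩ := C.mem_below.1 hl'
    obtain rfl := sigma_mk_injective heq
    exact Tree.child_injective h
      (Tree.child_unique (child_mem h e') (child_mem h e) hle hle')

theorem mem_others_iff_markedLeaves {i : Fin 2} {v : (C.part i).tree.Vertex} {s : TernaryType}
    (hs : v.kind = .ter s) (hs' : s ≠ .high) (ℓ : (C.part i).tree.Leaf) :
    (⟨i, ℓ⟩ : C.Leaf) ∈ C.others i v s.free ↔ ℓ ∈ Tree.markedLeaves v := by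
  have ht : v.kind.isTernary = true := (Tree.isTernary_iff _).2 ⟨s, hs⟩
  rw [C.mem_others_iff ht]
  constructor
  · rintro ⟨e, he, hl⟩
    obtain ⟨ℓ', hle, heq⟩ := C.mem_below.1 hl
    obtain rfl := sigma_mk_injective heq
    exact ⟨v.child e, child_mem ht e, (Tree.isMarked_child_iff hs e).2 ⟨hs', he⟩, hle⟩
  · rintro ⟨c, hc, hm, hle⟩
    rw [Tree.children_ternary ht] at hc
    obtain ⟨e, -, rfl⟩ := Finset.mem_image.1 hc
    exact ⟨e, ((Tree.isMarked_child_iff hs e).1 hm).2, C.mem_below.2 ⟨ℓ, hle, rfl⟩⟩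

/-- A set of leaves is closed if it is stable under the coupling. -/
def IsClosed (X : Finset C.Leaf) : Prop := ∀ ℓ ∈ X, C.σ ℓ ∈ X

theorem isLow_iff (k : Kind) : k.isLow = true ↔ ∃ s, k = .ter s ∧ s ≠ .high := by
  rcases k with _ | _ | _ | s
  · simp [Kind.isLow]
  · simp [Kind.isLow]
  · simp [Kind.isLow]
  · cases s <;> simp [Kind.isLow]

/-- If the marked subtrees of all low nodes are coupled among themselves, then so are all bushes. -/
theorem isSelfCoupled_bush
    (H : ∀ (i : Fin 2) (v : (C.part i).tree.Vertex) (s : TernaryType), v.kind = .ter s →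
      s ≠ .high → C.IsClosed (C.others i v s.free))
    (j : C.Node) : C.IsSelfCoupled (C.bush j) := by
  -- No assumption on the kind of `v` is needed: a marked leaf forces a marked child, hence a low
  -- node.
  have key : ∀ (i : Fin 2) (v : (C.part i).tree.Vertex) (ℓ : (C.part i).tree.Leaf),
      ℓ ∈ Tree.markedLeaves v →
      ∃ ℓ' ∈ Tree.markedLeaves v, C.σ ⟨i, ℓ⟩ = ⟨i, ℓ'⟩ := by
    intro i v ℓ hℓ
    obtain ⟨c, hc, hm, -⟩ := id hℓ
    obtain ⟨j', s, e, hs, hse, hce⟩ := hm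
    obtain ⟨e', he'⟩ := (Tree.mem_children_iff _ _).1 hc
    obtain rfl : v = j' := Subtype.ext (List.append_inj' (he'.symm.trans hce) rfl).1
    have hs' := ((TernaryType.marks_iff s e).1 hse).1
    have h1 := H i v s hs hs' _ ((C.mem_others_iff_markedLeaves hs hs' ℓ).2 hℓ)
    have h2 : (C.σ ⟨i, ℓ⟩).1 = i :=
      C.fst_of_mem_below (Finset.mem_sdiff.1 h1).1
    revert h1 h2
    generalize C.σ ⟨i, ℓ⟩ = τ
    obtain ⟨i', ℓ'⟩ := τ
    rintro h1 rfl
    exact ⟨ℓ', (C.mem_others_iff_markedLeaves hs hs' ℓ').1 h1, rfl⟩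
  apply C.isSelfCoupled_of_closed
  rintro _ ⟨ℓ, hℓ, rfl⟩
  rw [Tree.mem_bush_iff] at hℓ
  obtain ⟨ℓ', hℓ', hσ⟩ := key _ _ _ hℓ.1
  rw [hσ]
  -- If the partner were among the marked leaves of a lower node, then by stability and involutivity
  -- so would be the original leaf, which lies in the bush.
  refine ⟨ℓ', (Tree.mem_bush_iff _ _).2 ⟨hℓ', fun j' hj' hm => ?_⟩, rfl⟩
  obtain ⟨ℓ'', hℓ'', hσ'⟩ := key _ _ _ hm
  rw [← hσ, C.involutive] at hσ'
  obtain rfl := sigma_mk_injective hσ'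
  exact hℓ.2 j' hj' hℓ''

/-- Either some low node has marked leaves that are not stable, and that node is selected instead of
the given one, or all bushes are self-coupled, and the given node can only fail to be resonant by
being high or through its signs. -/
theorem nonresonant_cases (hB : ∀ (i : Fin 2) (v : (C.part i).tree.Vertex),
    ¬ v.kind.isBinary = true) (hres : ∃ j : C.Node, ¬ C.IsResonant j) :
    ∃ (i : Fin 2) (j : (C.part i).tree.Vertex) (s : TernaryType), j.kind = .ter s ∧
      ((s ≠ .high ∧ ¬ C.IsClosed (C.others i j s.free)) ∨ s = .high ∨
        (s ≠ .high ∧ C.IsClosed (C.others i j s.free) ∧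
          ((∃ e e', e ≠ e' ∧ e ≠ s.free ∧ e' ≠ s.free ∧
              (C.part i).sign (j.child e) = (C.part i).sign (j.child e')) ∨
            (∃ e e', e ≠ e' ∧ e ≠ s.free ∧ e' ≠ s.free ∧
              (C.part i).sign (j.child e) = -(C.part i).sign (j.child e')) ∧
              (C.part i).sign (j.child s.free) = -(C.part i).sign j))) := by
  by_cases H : ∀ (i : Fin 2) (v : (C.part i).tree.Vertex) (s : TernaryType), v.kind = .ter s →
      s ≠ .high → C.IsClosed (C.others i v s.free)
  · obtain ⟨⟨i, j, hjn⟩, hj⟩ := hres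
    have ht : j.kind.isTernary = true := ((Tree.isNode_iff _).1 hjn).resolve_left (hB i j)
    obtain ⟨s, hs⟩ := (Tree.isTernary_iff _).1 ht
    refine ⟨i, j, s, hs, ?_⟩
    by_cases hh : s = .high
    · exact .inr (.inl hh)
    refine .inr (.inr ⟨hh, H i j s hs hh, ?_⟩)
    by_contra hcon
    rw [not_or] at hcon
    obtain ⟨h1, h2⟩ := hcon
    have hlow : j.kind.isLow = true := (isLow_iff _).2 ⟨s, hs, hh⟩
    have opp : ∀ e e', e ≠ e' → e ≠ s.free → e' ≠ s.free →
        (C.part i).sign (j.child e) = -(C.part i).sign (j.child e') := by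
      intro e e' hne he he'
      by_contra hcon
      refine h1 ⟨e, e', hne, he, he', ?_⟩
      rcases Int.units_eq_one_or ((C.part i).sign (j.child e)) with h | h <;>
      rcases Int.units_eq_one_or ((C.part i).sign (j.child e')) with h' | h' <;>
      rw [h, h'] at hcon ⊢ <;> simp at hcon
    refine hj ⟨hlow, C.isSelfCoupled_bush H _, ?_, ?_⟩
    · intro j₁ hj₁ j₂ hj₂ hm₁ hm₂ hne
      simp only [Tree.children_ternary ht, Finset.mem_image] at hj₁ hj₂
      obtain ⟨e₁, -, rfl⟩ := hj₁
      obtain ⟨e₂, -, rfl⟩ := hj₂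
      exact opp e₁ e₂ (fun h => hne (by rw [h]))
        ((Tree.isMarked_child_iff hs _).1 hm₁).2 ((Tree.isMarked_child_iff hs _).1 hm₂).2
    · intro j₃ hj₃ hm
      simp only [Tree.children_ternary ht, Finset.mem_image] at hj₃
      obtain ⟨e, -, rfl⟩ := hj₃
      rw [Tree.isMarked_child_iff hs] at hm
      obtain rfl : e = s.free := by
        by_contra hne
        exact hm ⟨hh, hne⟩
      by_contra hne
      refine h2 ⟨?_, ?_⟩
      · have : ∃ e e', e ≠ e' ∧ e ≠ s.free ∧ e' ≠ s.free := by
          cases s.free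
          · exact ⟨.mid, .right, by simp⟩
          · exact ⟨.left, .right, by simp⟩
          · exact ⟨.left, .mid, by simp⟩
        obtain ⟨e, e', h, he, he'⟩ := this
        exact ⟨e, e', h, he, he', opp e e' h he he'⟩
      · change ¬ (C.part i).sign (j.child s.free) = (C.part i).sign j at hne
        rcases Int.units_eq_one_or ((C.part i).sign (j.child s.free)) with h | h <;>
        rcases Int.units_eq_one_or ((C.part i).sign j) with h' | h' <;>
        rw [h, h'] at hne ⊢ <;> simp at hne ⊢
  · push Not at H
    obtain ⟨i, j, s, hs, hh, hc⟩ := H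
    exact ⟨i, j, s, hs, .inl ⟨hh, hc⟩⟩

end Coupling

/-! ### Lattice points -/

theorem lattice_add {d : ℕ} {L : ℝ} {x y : E d} (hx : x ∈ lattice d L) (hy : y ∈ lattice d L) :
    x + y ∈ lattice d L := by
  intro i
  obtain ⟨a, ha⟩ := hx i
  obtain ⟨b, hb⟩ := hy i
  exact ⟨a + b, by rw [PiLp.add_apply, ha, hb]; push_cast; ring⟩

theorem lattice_zsmul {d : ℕ} {L : ℝ} {x : E d} (n : ℤ) (hx : x ∈ lattice d L) :
    n • x ∈ lattice d L := by
  intro i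
  obtain ⟨a, ha⟩ := hx i
  exact ⟨n * a, by rw [PiLp.smul_apply, ha]; push_cast; simp; ring⟩

theorem lattice_nsmul {d : ℕ} {L : ℝ} {x : E d} (n : ℕ) (hx : x ∈ lattice d L) :
    n • x ∈ lattice d L := by
  simpa using lattice_zsmul (n : ℤ) hx

/-- The lattice points in a ball. -/
def latticeBall (d : ℕ) (L ρ : ℝ) : Set (E d) := {k | k ∈ lattice d L ∧ ‖k‖ ≤ ρ}

theorem latticeBall_finite_card {d : ℕ} {L ρ : ℝ} (hL : 0 < L) (hρ : 0 ≤ ρ) :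
    (latticeBall d L ρ).Finite ∧ ((latticeBall d L ρ).ncard : ℝ) ≤ (2 * ρ * L + 1) ^ d := by
  classical
  -- Each coordinate is `n / L` with `|n| ≤ ρ L`, so the points lie in a cube with `2 m + 1` values
  -- per coordinate.
  set m : ℤ := ⌊ρ * L⌋ with hm
  have hm0 : 0 ≤ m := Int.floor_nonneg.2 (by positivity)
  set F : Finset (Fin d → ℤ) := Fintype.piFinset fun _ => Finset.Icc (-m) m with hF
  set φ : (Fin d → ℤ) → E d := fun n => WithLp.toLp 2 fun i => (n i : ℝ) / L with hφ
  have hsub : latticeBall d L ρ ⊆ ((F.image φ : Finset (E d)) : Set (E d)) := by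
    rintro k ⟨hk, hkρ⟩
    choose n hn using hk
    simp only [Finset.coe_image, Set.mem_image, Finset.mem_coe]
    refine ⟨n, ?_, ?_⟩
    · rw [hF, Fintype.mem_piFinset]
      intro i
      have h1 : |k i| ≤ ρ := by
        have := PiLp.norm_apply_le k i
        rw [Real.norm_eq_abs] at this
        exact this.trans hkρ
      rw [hn i, abs_div, abs_of_pos hL, div_le_iff₀ hL] at h1
      rw [abs_le] at h1
      rw [Finset.mem_Icc]
      constructor
      · rw [neg_le, hm, Int.le_floor]
        push_cast
        linarith
      · rw [hm, Int.le_floor]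
        exact h1.2
    · ext i
      exact (hn i).symm
  have hfin := (F.image φ).finite_toSet.subset hsub
  refine ⟨hfin, ?_⟩
  have h1 := Set.ncard_le_ncard hsub (F.image φ).finite_toSet
  rw [Set.ncard_coe_finset] at h1
  have h2 : F.card = (2 * m + 1).toNat ^ d := by
    rw [hF, Fintype.card_piFinset]
    simp only [Int.card_Icc, Finset.prod_const, Finset.card_univ, Fintype.card_fin]
    congr 2
    ring
  calc ((latticeBall d L ρ).ncard : ℝ) ≤ (F.card : ℝ) := by
        exact_mod_cast h1.trans Finset.card_image_le
    _ = ((2 * m + 1 : ℤ) : ℝ) ^ d := by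
        rw [h2]
        push_cast
        congr 1
        have : (((2 * m + 1).toNat : ℤ) : ℝ) = ((2 * m + 1 : ℤ) : ℝ) := by
          rw [Int.toNat_of_nonneg (by linarith)]
        push_cast at this
        exact this
    _ ≤ (2 * ρ * L + 1) ^ d := by
        have h3 : (m : ℝ) ≤ ρ * L := Int.floor_le _
        have h4 : (0 : ℝ) ≤ m := by exact_mod_cast hm0
        apply pow_le_pow_left₀
        · push_cast; linarith
        · push_cast; linarith

/-! ### Paired families of lattice vectors -/

section Paired

variable {ι : Type*}

/-- Families of lattice vectors in the ball of radius `ρ`, opposite on paired indices and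
with prescribed sum over `A`. -/
def pairedSet (σ : ι → ι) (A : Finset ι) {d : ℕ} (L : ℝ) (k : E d) (ρ : ℝ) : Set (ι → E d) :=
  {x | (∀ ℓ, x ℓ + x (σ ℓ) = 0) ∧ ∑ ℓ ∈ A, x ℓ = k ∧ ∀ ℓ, x ℓ ∈ latticeBall d L ρ}

/-- The set `N` picks one index from each pair, so the values on `N` determine the family. A pair
crossing the boundary of `A` occurs only once in the prescribed sum and is recovered from the
others, which brings the exponent from `h + 1` down to `h`. -/
theorem pairedSet_finite_card [DecidableEq ι] {σ : ι → ι} (hσ : Function.Involutive σ) {N : Finset ι}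
    (hN : ∀ ℓ, σ ℓ ∈ N ↔ ℓ ∉ N) {h : ℕ} (hcard : N.card = h + 1) {A : Finset ι}
    (hA : ∃ ℓ ∈ A, σ ℓ ∉ A) {d : ℕ} {L ρ : ℝ} (hL : 0 < L) (hρ : 0 ≤ ρ) (k : E d) :
    (pairedSet σ A L k ρ).Finite ∧
      ((pairedSet σ A L k ρ).ncard : ℝ) ≤ ((2 * ρ * L + 1) ^ d) ^ h := by
  obtain ⟨hfin, hB⟩ := latticeBall_finite_card (d := d) hL hρ
  obtain ⟨ℓ', hℓ', hA'⟩ : ∃ ℓ' ∈ N, (ℓ' ∈ A ∧ σ ℓ' ∉ A) ∨ (σ ℓ' ∈ A ∧ ℓ' ∉ A) := by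
    obtain ⟨ℓ, h1, h2⟩ := hA
    by_cases hl : ℓ ∈ N
    · exact ⟨ℓ, hl, .inl ⟨h1, h2⟩⟩
    · exact ⟨σ ℓ, (hN ℓ).2 hl, .inr ⟨by rwa [hσ], h2⟩⟩
  set N' := N.erase ℓ' with hN'
  set P : Finset (N' → E d) := Fintype.piFinset fun _ => hfin.toFinset with hP
  set f : (ι → E d) → (N' → E d) := fun x ℓ => x ℓ.1 with hf
  have hmaps : ∀ x ∈ pairedSet σ A L k ρ, f x ∈ (P : Set (N' → E d)) := by
    intro x hx
    rw [Finset.mem_coe, hP, Fintype.mem_piFinset]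
    intro ℓ
    rw [Set.Finite.mem_toFinset]
    exact hx.2.2 ℓ.1
  have hinj : Set.InjOn f (pairedSet σ A L k ρ) := by
    intro x hx y hy hxy
    have hx' : ∀ ℓ, x (σ ℓ) = - x ℓ := fun ℓ => (neg_eq_of_add_eq_zero_right (hx.1 ℓ)).symm
    have hy' : ∀ ℓ, y (σ ℓ) = - y ℓ := fun ℓ => (neg_eq_of_add_eq_zero_right (hy.1 ℓ)).symm
    have h1 : ∀ ℓ ∈ N, ℓ ≠ ℓ' → x ℓ = y ℓ := fun ℓ hl hne =>
      congrFun hxy ⟨ℓ, Finset.mem_erase.2 ⟨hne, hl⟩⟩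
    have h2 : ∀ ℓ, ℓ ≠ ℓ' → ℓ ≠ σ ℓ' → x ℓ = y ℓ := by
      intro ℓ hne hne'
      by_cases hl : ℓ ∈ N
      · exact h1 ℓ hl hne
      · have := h1 (σ ℓ) ((hN ℓ).2 hl) (fun h => hne' (by rw [← h, hσ]))
        rw [hx', hy'] at this
        exact neg_injective this
    have h3 : ∑ ℓ ∈ A, (x ℓ - y ℓ) = 0 := by
      rw [Finset.sum_sub_distrib, hx.2.1, hy.2.1, sub_self]
    have h4 : x ℓ' = y ℓ' := by
      rcases hA' with ⟨ha, hb⟩ | ⟨ha, hb⟩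
      · rw [Finset.sum_eq_single_of_mem ℓ' ha] at h3
        · exact sub_eq_zero.1 h3
        · intro ℓ hl hne
          rw [h2 ℓ hne (fun h => hb (h ▸ hl)), sub_self]
      · rw [Finset.sum_eq_single_of_mem (σ ℓ') ha, hx', hy'] at h3
        · exact neg_injective (sub_eq_zero.1 h3)
        · intro ℓ hl hne
          rw [h2 ℓ (fun h => hb (h ▸ hl)) hne, sub_self]
    funext ℓ
    by_cases e1 : ℓ = ℓ'
    · rw [e1, h4]
    by_cases e2 : ℓ = σ ℓ'
    · rw [e2, hx', hy', h4]
    exact h2 ℓ e1 e2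
  have hle := Set.ncard_le_ncard_of_injOn f hmaps hinj P.finite_toSet
  refine ⟨Set.Finite.of_injOn hmaps hinj P.finite_toSet, ?_⟩
  rw [Set.ncard_coe_finset, hP, Fintype.card_piFinset] at hle
  simp only [Finset.prod_const, Finset.card_univ, Fintype.card_coe] at hle
  rw [hN', Finset.card_erase_of_mem hℓ', hcard, Nat.add_sub_cancel,
    ← Set.ncard_eq_toFinset_card _ hfin] at hle
  calc ((pairedSet σ A L k ρ).ncard : ℝ) ≤ ((latticeBall d L ρ).ncard : ℝ) ^ h := by
        exact_mod_cast hle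
    _ ≤ _ := pow_le_pow_left₀ (by positivity) hB _

/-- Integer directions along which paired families can be translated. -/
structure IsDirection (σ : ι → ι) (A : Finset ι) (u : ι → ℤ) : Prop where
  pairing : ∀ ℓ, u ℓ + u (σ ℓ) = 0
  sum_eq : ∑ ℓ ∈ A, u ℓ = 0
  abs_le : ∀ ℓ, |u ℓ| ≤ 1

/-- Translation of a family. -/
def shift {d : ℕ} (u : ι → ℤ) (x : ι → E d) (v : E d) : ι → E d := fun ℓ => x ℓ + u ℓ • v

theorem sum_shift {d : ℕ} (u : ι → ℤ) (x : ι → E d) (v : E d) (X : Finset ι) :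
    ∑ ℓ ∈ X, shift u x v ℓ = ∑ ℓ ∈ X, x ℓ + (∑ ℓ ∈ X, u ℓ) • v := by
  simp only [shift]
  rw [Finset.sum_add_distrib, Finset.sum_smul]

theorem shift_mem_pairedSet {σ : ι → ι} {A : Finset ι} {d : ℕ} {L ρ r : ℝ} {k : E d} {u : ι → ℤ}
    (hu : IsDirection σ A u) {x : ι → E d} (hx : x ∈ pairedSet σ A L k ρ) {v : E d}
    (hv : v ∈ lattice d L) (hvr : ‖v‖ ≤ r) : shift u x v ∈ pairedSet σ A L k (ρ + r) := by
  refine ⟨fun ℓ => ?_, ?_, fun ℓ => ⟨lattice_add (hx.2.2 ℓ).1 (lattice_zsmul _ hv), ?_⟩⟩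
  · have : shift u x v ℓ + shift u x v (σ ℓ) = (x ℓ + x (σ ℓ)) + (u ℓ + u (σ ℓ)) • v := by
      simp only [shift, add_smul]
      abel
    rw [this, hx.1, hu.pairing, zero_smul, add_zero]
  · rw [sum_shift, hu.sum_eq, hx.2.1, zero_smul, add_zero]
  · refine (norm_add_le _ _).trans (add_le_add (hx.2.2 ℓ).2 ?_)
    rw [← Int.cast_smul_eq_zsmul ℝ, norm_smul]
    have : ‖((u ℓ : ℤ) : ℝ)‖ ≤ 1 := by
      rw [Real.norm_eq_abs]
      exact_mod_cast hu.abs_le ℓ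
    calc _ ≤ 1 * ‖v‖ := mul_le_mul_of_nonneg_right this (norm_nonneg _)
      _ ≤ r := by rwa [one_mul]

theorem shift_shift {d : ℕ} (u : ι → ℤ) (x : ι → E d) (v w : E d) :
    shift u (shift u x v) w = shift u x (v + w) := by
  funext ℓ
  simp only [shift, smul_add]
  abel

theorem shift_zero {d : ℕ} (u : ι → ℤ) (x : ι → E d) : shift u x 0 = x := by
  funext ℓ
  simp [shift]

/-- A set whose translates by small steps are disjoint has few elements. -/
theorem ncard_le_of_separated {σ : ι → ι} {A : Finset ι} {d : ℕ} {L R s : ℝ} {k : E d} {u : ι → ℤ}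
    (hu : IsDirection σ A u) {S : Set (ι → E d)} (hS : S ⊆ pairedSet σ A L k R)
    (hfin : (pairedSet σ A L k (R + 1)).Finite) (g : (ι → E d) → E d)
    (hg : ∀ x ∈ S, g x ∈ lattice d L ∧ ‖g x‖ ≤ s) (hginv : ∀ x v, g (shift u x v) = g x)
    (hs : 0 < s)
    (hsep : ∀ x ∈ S, ∀ l : ℕ, 1 ≤ l → (l : ℝ) * s ≤ 1 → shift u x (l • g x) ∉ S) :
    (S.ncard : ℝ) ≤ s * (pairedSet σ A L k (R + 1)).ncard := by
  set n : ℕ := ⌊1 / s⌋₊ with hn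
  have hns : ∀ l : ℕ, l ≤ n → (l : ℝ) * s ≤ 1 := by
    intro l hl
    rw [hn, Nat.le_floor_iff (by positivity)] at hl
    rwa [le_div_iff₀ hs] at hl
  -- Injectivity on `S × {0, ..., n}` is the whole argument. Since `g` is invariant under shifts,
  -- the image determines the step; two different multiples would then make one point of `S` a
  -- forbidden translate of another.
  set f : (ι → E d) × ℕ → (ι → E d) := fun p => shift u p.1 (p.2 • g p.1) with hf
  have hmaps : ∀ p ∈ S ×ˢ ((Finset.range (n + 1) : Finset ℕ) : Set ℕ),
      f p ∈ pairedSet σ A L k (R + 1) := by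
    rintro ⟨x, l⟩ ⟨hx, hl⟩
    refine shift_mem_pairedSet hu (hS hx) (lattice_nsmul _ (hg x hx).1) ?_
    have hl' : l ≤ n := by simpa [Nat.lt_succ_iff] using hl
    calc ‖l • g x‖ ≤ l * ‖g x‖ := norm_nsmul_le
      _ ≤ l * s := mul_le_mul_of_nonneg_left (hg x hx).2 (by positivity)
      _ ≤ 1 := hns l hl'
  have key : ∀ x ∈ S, ∀ y ∈ S, ∀ l l' : ℕ, l' ≤ n → l < l' →
      shift u x (l • g x) ≠ shift u y (l' • g y) := by
    intro x hx y hy l l' hl' hll' heq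
    have hgxy : g x = g y := by
      rw [← hginv x (l • g x), heq, hginv]
    refine hsep y hy (l' - l) (by omega)
      (hns _ (by omega)) ?_
    have h1 := congrArg (fun z => shift u z (-(l • g y))) heq
    simp only [shift_shift, hgxy, add_neg_cancel, shift_zero] at h1
    have h2 : l' • g y + -(l • g y) = (l' - l) • g y := by
      rw [← sub_eq_add_neg, sub_eq_iff_eq_add, ← add_smul, Nat.sub_add_cancel hll'.le]
    rw [h2] at h1
    rwa [← h1]
  have hinj : Set.InjOn f (S ×ˢ ((Finset.range (n + 1) : Finset ℕ) : Set ℕ)) := by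
    rintro ⟨x, l⟩ ⟨hx, hl⟩ ⟨y, l'⟩ ⟨hy, hl'⟩ heq
    have h1 : l ≤ n := by simpa [Nat.lt_succ_iff] using hl
    have h2 : l' ≤ n := by simpa [Nat.lt_succ_iff] using hl'
    change shift u x (l • g x) = shift u y (l' • g y) at heq
    rcases lt_trichotomy l l' with h | rfl | h
    · exact absurd heq (key x hx y hy l l' h2 h)
    · have hgxy : g x = g y := by rw [← hginv x (l • g x), heq, hginv]
      have h3 := congrArg (fun z => shift u z (-(l • g y))) heq
      simp only [shift_shift, hgxy, add_neg_cancel, shift_zero] at h3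
      rw [h3]
    · exact absurd heq.symm (key y hy x hx l' l h1 h)
  have hle := Set.ncard_le_ncard_of_injOn f hmaps hinj hfin
  rw [Set.ncard_prod, Set.ncard_coe_finset, Finset.card_range] at hle
  have hle' : (S.ncard : ℝ) * (n + 1) ≤ (pairedSet σ A L k (R + 1)).ncard := by
    exact_mod_cast hle
  -- Counting the multiple `0` as well gives `n + 1 > 1 / s` copies of `S`, which produces exactly
  -- the factor `s`.
  have hlt : 1 / s < n + 1 := Nat.lt_floor_add_one _
  rw [div_lt_iff₀ hs] at hlt
  have h0 : (0 : ℝ) ≤ S.ncard := by positivity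
  nlinarith

/-! ### Existence of directions -/

/-- A fixed-point-free involution splits the set into pairs; summing `1` modulo `2` over the set
expresses this. -/
theorem even_card_of_closed {σ : ι → ι} (hσ : Function.Involutive σ) (hne : ∀ ℓ, σ ℓ ≠ ℓ)
    {X : Finset ι} (hX : ∀ ℓ ∈ X, σ ℓ ∈ X) : Even X.card := by
  rw [← ZMod.natCast_eq_zero_iff_even]
  have : ∑ _ℓ ∈ X, (1 : ZMod 2) = 0 :=
    Finset.sum_involution (fun ℓ _ => σ ℓ) (fun _ _ => by decide) (fun ℓ _ _ => hne ℓ)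
      hX (fun ℓ _ => hσ ℓ)
  simpa using this

theorem exists_not_mem_of_odd {σ : ι → ι} (hσ : Function.Involutive σ) (hne : ∀ ℓ, σ ℓ ≠ ℓ)
    {X : Finset ι} (hX : Odd X.card) : ∃ ℓ ∈ X, σ ℓ ∉ X := by
  by_contra! h
  exact Nat.not_even_iff_odd.2 hX (even_card_of_closed hσ hne h)

/-- The direction carried by one pair. -/
def pairDir [DecidableEq ι] (σ : ι → ι) (ℓ : ι) : ι → ℤ := Pi.single ℓ 1 - Pi.single (σ ℓ) 1

theorem pairDir_apply [DecidableEq ι] (σ : ι → ι) (ℓ ℓ' : ι) :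
    pairDir σ ℓ ℓ' = (if ℓ' = ℓ then 1 else 0) - (if ℓ' = σ ℓ then 1 else 0) := by
  simp [pairDir, Pi.single_apply]

theorem sum_pairDir [DecidableEq ι] (σ : ι → ι) (ℓ : ι) (X : Finset ι) :
    ∑ ℓ' ∈ X, pairDir σ ℓ ℓ' = (if ℓ ∈ X then 1 else 0) - (if σ ℓ ∈ X then 1 else 0) := by
  simp [pairDir_apply, Finset.sum_sub_distrib]

theorem pairDir_pairing [DecidableEq ι] {σ : ι → ι} (hσ : Function.Involutive σ) (ℓ ℓ' : ι) :
    pairDir σ ℓ ℓ' + pairDir σ ℓ (σ ℓ') = 0 := by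
  have h1 : σ ℓ' = ℓ ↔ ℓ' = σ ℓ := ⟨fun h => by rw [← h, hσ], fun h => by rw [h, hσ]⟩
  simp only [pairDir_apply, hσ.injective.eq_iff, h1]
  ring

theorem isDirection_pairDir [DecidableEq ι] {σ : ι → ι} (hσ : Function.Involutive σ) {A : Finset ι} {ℓ : ι}
    (h : ℓ ∈ A ↔ σ ℓ ∈ A) : IsDirection σ A (pairDir σ ℓ) := by
  refine ⟨pairDir_pairing hσ ℓ, ?_, fun ℓ' => ?_⟩
  · rw [sum_pairDir, if_congr h rfl rfl, sub_self]
  · rw [pairDir_apply]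
    split_ifs <;> simp

/-- A pair crossing the boundary of `A` cannot be moved alone without changing the prescribed sum,
but two of them moved in opposite senses can. Distinctness of the pairs keeps the coefficients in
`{-1, 0, 1}`. -/
theorem isDirection_pairDir_sub [DecidableEq ι] {σ : ι → ι} (hσ : Function.Involutive σ) {A : Finset ι} {ℓ ℓ' : ι}
    (hne : ℓ ≠ ℓ') (hne' : ℓ ≠ σ ℓ') (h : ℓ ∈ A ↔ ℓ' ∈ A) (h' : σ ℓ ∈ A ↔ σ ℓ' ∈ A) :
    IsDirection σ A (pairDir σ ℓ - pairDir σ ℓ') := by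
  refine ⟨fun a => ?_, ?_, fun a => ?_⟩
  · have h1 := pairDir_pairing hσ ℓ a
    have h2 := pairDir_pairing hσ ℓ' a
    simp only [Pi.sub_apply]
    linarith
  · simp only [Pi.sub_apply, Finset.sum_sub_distrib, sum_pairDir, if_congr h rfl rfl,
      if_congr h' rfl rfl, sub_self]
  · simp only [Pi.sub_apply, pairDir_apply]
    have h3 : σ ℓ ≠ σ ℓ' := fun h => hne (hσ.injective h)
    have h4 : σ ℓ ≠ ℓ' := fun h => hne' (by rw [← h, hσ])
    by_cases e1 : a = ℓ
    · subst e1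
      rw [if_neg hne, if_neg hne']
      split_ifs <;> simp
    by_cases e2 : a = σ ℓ
    · subst e2
      rw [if_neg h3, if_neg h4, if_neg e1]
      simp
    rw [if_neg e1, if_neg e2]
    split_ifs <;> simp

theorem fin_two_iff {a b c : Fin 2} (h : a ≠ c) (h' : b ≠ c) : a = b := by omega

/-- If a leaf of `X` is paired inside the same tree but outside `X`, its pair will do. Otherwise
every leaf of `X` paired outside `X` is paired with the other tree. The complement of `X` in its
tree is odd, so it too contains a leaf paired with the other tree; moving both pairs in opposite
senses leaves the root momentum fixed and moves the sum over `X`. -/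
theorem exists_direction_linear [Fintype ι] [DecidableEq ι] {σ : ι → ι}
    (hσ : Function.Involutive σ) (hne : ∀ ℓ, σ ℓ ≠ ℓ) (part : ι → Fin 2)
    {i : Fin 2} {X T : Finset ι} (hT : ∀ ℓ, ℓ ∈ T ↔ part ℓ = i)
    (hXT : X ⊆ T) (hX : Even X.card) (hTodd : Odd T.card) (hcl : ¬ ∀ ℓ ∈ X, σ ℓ ∈ X) :
    ∃ u, IsDirection σ (Finset.univ.filter fun ℓ => part ℓ = 0) u ∧ ∑ ℓ ∈ X, u ℓ = 1 := by
  by_cases H : ∃ ℓ ∈ X, σ ℓ ∉ X ∧ σ ℓ ∈ T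
  · obtain ⟨ℓ, h1, h2, h3⟩ := H
    refine ⟨pairDir σ ℓ, isDirection_pairDir hσ ?_, ?_⟩
    · rw [Finset.mem_filter, Finset.mem_filter, (hT _).1 h3, (hT _).1 (hXT h1)]
      simp
    · rw [sum_pairDir, if_pos h1, if_neg h2, sub_zero]
  · push Not at H hcl
    obtain ⟨ℓ, h1, h2⟩ := hcl
    have h3 := H ℓ h1 h2
    have hodd : Odd (T \ X).card := by
      rw [Finset.card_sdiff_of_subset hXT]
      exact Nat.Odd.sub_even (Finset.card_le_card hXT) hTodd hX
    obtain ⟨ℓ', h4, h5⟩ := exists_not_mem_of_odd hσ hne hodd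
    rw [Finset.mem_sdiff] at h4
    have h6 : σ ℓ' ∉ T := by
      intro h
      have : σ ℓ' ∈ X := by
        by_contra hx
        exact h5 (Finset.mem_sdiff.2 ⟨h, hx⟩)
      exact H (σ ℓ') this (by rw [hσ]; exact h4.2) (by rw [hσ]; exact h4.1)
    have hi : part ℓ = part ℓ' := by rw [(hT _).1 (hXT h1), (hT _).1 h4.1]
    have hi' : part (σ ℓ) = part (σ ℓ') :=
      fin_two_iff (fun h => h3 ((hT _).2 h)) (fun h => h6 ((hT _).2 h))
    refine ⟨pairDir σ ℓ - pairDir σ ℓ', isDirection_pairDir_sub hσ ?_ ?_ ?_ ?_, ?_⟩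
    · rintro rfl
      exact h4.2 h1
    · intro h
      exact h6 (h ▸ hXT h1)
    · simp [hi]
    · simp [hi']
    · have h7 : σ ℓ' ∉ X := fun h => h6 (hXT h)
      simp only [Pi.sub_apply, Finset.sum_sub_distrib, sum_pairDir]
      simp [h1, h2, h4.2, h7]

/-- Two disjoint odd sets with closed union can be moved in opposite directions. -/
theorem exists_direction_opposite [Fintype ι] [DecidableEq ι] {σ : ι → ι}
    (hσ : Function.Involutive σ) (hne : ∀ ℓ, σ ℓ ≠ ℓ) (part : ι → Fin 2)
    {i : Fin 2} {Y : Dir → Finset ι}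
    (hY : ∀ e, ∀ ℓ ∈ Y e, part ℓ = i) (hdisj : ∀ e e', e ≠ e' → ∀ ℓ ∈ Y e, ℓ ∉ Y e')
    (hodd : ∀ e, Odd (Y e).card) {a b : Dir}
    (hcl : ∀ ℓ ∈ Y a, σ ℓ ∉ Y a → σ ℓ ∈ Y b) :
    ∃ u, IsDirection σ (Finset.univ.filter fun ℓ => part ℓ = 0) u ∧
      ∀ e, ∑ ℓ ∈ Y e, u ℓ = (if e = a then 1 else 0) - (if e = b then 1 else 0) := by
  obtain ⟨ℓ, h1, h2⟩ := exists_not_mem_of_odd hσ hne (hodd a)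
  have h3 := hcl ℓ h1 h2
  refine ⟨pairDir σ ℓ, isDirection_pairDir hσ ?_, fun e => ?_⟩
  · rw [Finset.mem_filter, Finset.mem_filter, hY _ _ h1, hY _ _ h3]
    simp
  · have e1 : ℓ ∈ Y e ↔ e = a := ⟨fun h => by_contra fun hc => hdisj e a hc ℓ h h1, fun h => h ▸ h1⟩
    have e2 : σ ℓ ∈ Y e ↔ e = b :=
      ⟨fun h => by_contra fun hc => hdisj e b hc _ h h3, fun h => h ▸ h3⟩
    rw [sum_pairDir, if_congr e1 rfl rfl, if_congr e2 rfl rfl]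

/-- Among three disjoint odd sets, one can move either two of them in opposite directions, or
a single one. -/
theorem exists_direction_oscillating [Fintype ι] [DecidableEq ι] {σ : ι → ι}
    (hσ : Function.Involutive σ) (hne : ∀ ℓ, σ ℓ ≠ ℓ) (part : ι → Fin 2)
    {i : Fin 2} {Y : Dir → Finset ι}
    (hY : ∀ e, ∀ ℓ ∈ Y e, part ℓ = i) (hdisj : ∀ e e', e ≠ e' → ∀ ℓ ∈ Y e, ℓ ∉ Y e')
    (hodd : ∀ e, Odd (Y e).card) :
    ∃ u, IsDirection σ (Finset.univ.filter fun ℓ => part ℓ = 0) u ∧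
      ((∃ a b, a ≠ b ∧
        ∀ e, ∑ ℓ ∈ Y e, u ℓ = (if e = a then 1 else 0) - (if e = b then 1 else 0)) ∨
      (∃ a, ∀ e, ∑ ℓ ∈ Y e, u ℓ = if e = a then 1 else 0)) := by
  have iff1 : ∀ {a e ℓ}, ℓ ∈ Y a → (ℓ ∈ Y e ↔ e = a) := fun {a e ℓ} h1 =>
    ⟨fun h => by_contra fun hc => hdisj e a hc ℓ h h1, fun h => h ▸ h1⟩
  by_cases H : ∃ a b ℓ, a ≠ b ∧ ℓ ∈ Y a ∧ σ ℓ ∈ Y b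
  · obtain ⟨a, b, ℓ, hab, h1, h2⟩ := H
    refine ⟨pairDir σ ℓ, isDirection_pairDir hσ ?_, .inl ⟨a, b, hab, fun e => ?_⟩⟩
    · rw [Finset.mem_filter, Finset.mem_filter, hY _ _ h1, hY _ _ h2]
      simp
    · rw [sum_pairDir, if_congr (iff1 h1) rfl rfl, if_congr (iff1 h2) rfl rfl]
  · push Not at H
    -- By oddness each of the three sets has a leaf paired outside it, and no pair joins two of
    -- them, so the partner avoids all three. If a partner stays in the same tree, that pair moves a
    -- single set.
    have hex : ∀ a, ∃ ℓ ∈ Y a, ∀ e, σ ℓ ∉ Y e := by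
      intro a
      obtain ⟨ℓ, h1, h2⟩ := exists_not_mem_of_odd hσ hne (hodd a)
      refine ⟨ℓ, h1, fun e => ?_⟩
      by_cases hae : a = e
      · rwa [← hae]
      · exact H a e ℓ hae h1
    choose q hq hq' using hex
    by_cases H' : ∃ a, part (σ (q a)) = i
    · obtain ⟨a, ha⟩ := H'
      refine ⟨pairDir σ (q a), isDirection_pairDir hσ ?_, .inr ⟨a, fun e => ?_⟩⟩
      · rw [Finset.mem_filter, Finset.mem_filter, hY _ _ (hq a), ha]
        simp
      · rw [sum_pairDir, if_congr (iff1 (hq a)) rfl rfl, if_neg (hq' a e), sub_zero]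
    · push Not at H'
      -- All partners now lie in the other tree, so any two of these pairs have opposite effects on
      -- the root when moved in opposite senses; left and middle are an arbitrary choice.
      have hp : part (σ (q .left)) = part (σ (q .mid)) := fin_two_iff (H' _) (H' _)
      have hp' : part (q .left) = part (q .mid) := by rw [hY _ _ (hq _), hY _ _ (hq _)]
      refine ⟨pairDir σ (q .left) - pairDir σ (q .mid),
        isDirection_pairDir_sub hσ ?_ ?_ ?_ ?_, .inl ⟨.left, .mid, by simp, fun e => ?_⟩⟩
      · intro h
        exact hdisj .left .mid (by simp) _ (hq .left) (h ▸ hq .mid)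
      · intro h
        exact H' .mid (by rw [← h, hY _ _ (hq .left)])
      · simp [hp']
      · simp [hp]
      · simp only [Pi.sub_apply, Finset.sum_sub_distrib, sum_pairDir, if_neg (hq' _ e), sub_zero,
          if_congr (iff1 (hq _)) rfl rfl]

end Paired

/-! ### The Japanese bracket -/

namespace System

variable {d : ℕ} (S : System d)

theorem bracket_sq (k : E d) : S.bracket k ^ 2 = S.m + ‖k‖ ^ 2 :=
  Real.sq_sqrt (by have := S.m_pos; positivity)

theorem sqrt_m_pos : 0 < √S.m := Real.sqrt_pos.2 S.m_pos

theorem sqrt_m_le_bracket (k : E d) : √S.m ≤ S.bracket k :=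
  Real.sqrt_le_sqrt (by nlinarith [sq_nonneg ‖k‖])

theorem bracket_pos (k : E d) : 0 < S.bracket k := S.sqrt_m_pos.trans_le (S.sqrt_m_le_bracket k)

theorem bracket_neg (k : E d) : S.bracket (-k) = S.bracket k := by
  simp [bracket]

theorem bracket_le (k : E d) : S.bracket k ≤ √S.m + ‖k‖ := by
  rw [bracket, Real.sqrt_le_left (by positivity)]
  nlinarith [Real.sq_sqrt S.m_pos.le, S.sqrt_m_pos, norm_nonneg k]

/-- This is Cauchy-Schwarz for the vectors `(√m, ‖x‖)` and `(√m, ‖y‖)`. The strict gap `m` is the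
source of every non-degeneracy bound on phases and denominators. -/
theorem m_add_norm_mul_le (x y : E d) : S.m + ‖x‖ * ‖y‖ ≤ S.bracket x * S.bracket y := by
  have hm := S.m_pos
  rw [bracket, bracket, ← Real.sqrt_mul (by positivity)]
  apply Real.le_sqrt_of_sq_le
  nlinarith [mul_nonneg hm.le (sq_nonneg (‖x‖ - ‖y‖))]

theorem m_add_inner_le (x y : E d) : S.m + inner ℝ x y ≤ S.bracket x * S.bracket y :=
  (add_le_add_right (real_inner_le_norm x y) _).trans (S.m_add_norm_mul_le x y)

theorem m_sub_inner_le (x y : E d) : S.m - inner ℝ x y ≤ S.bracket x * S.bracket y := by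
  have := S.m_add_inner_le x (-y)
  rwa [inner_neg_right, bracket_neg, ← sub_eq_add_neg] at this

theorem m_le_bracket_add (x y : E d) :
    S.m ≤ (S.bracket x + S.bracket y) ^ 2 - S.bracket (x + y) ^ 2 := by
  have h1 := S.m_add_inner_le x y
  have h2 := norm_add_sq_real x y
  rw [add_sq, S.bracket_sq, S.bracket_sq, S.bracket_sq, h2]
  linarith [S.m_pos]

theorem abs_bracket_sub_le (x y : E d) : |S.bracket x - S.bracket y| ≤ ‖x - y‖ := by
  apply abs_le_of_sq_le_sq _ (norm_nonneg _)
  rw [sub_sq, S.bracket_sq, S.bracket_sq, norm_sub_sq_real]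
  nlinarith [S.m_add_inner_le x y, S.m_pos]

end System

/-! ### Quantitative convexity of the bracket. -/

/-- For `f t = √(B + (t + p)²)` one has `f'' = B / f³ ≥ m / J³`. Two applications of the mean value
inequality, first to `f'` over a step `b`, then to `t ↦ f (t + b) - f t` over a step `a`, give the
mixed second difference. -/
theorem sqrt_second_difference {m B p J a b : ℝ} (hm : 0 < m) (hB : m ≤ B) (ha : 0 ≤ a)
    (hb : 0 ≤ b) (hJ : ∀ t ∈ Set.Icc 0 (a + b), √(B + (t + p) ^ 2) ≤ J) :
    m / J ^ 3 * (a * b) ≤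
      √(B + (a + b + p) ^ 2) - √(B + (a + p) ^ 2) - √(B + (b + p) ^ 2) + √(B + (0 + p) ^ 2) := by
  set f : ℝ → ℝ := fun t => √(B + (t + p) ^ 2) with hf
  set f' : ℝ → ℝ := fun t => (t + p) / f t with hf'
  have hpos : ∀ t, 0 < B + (t + p) ^ 2 := fun t =>
    add_pos_of_pos_of_nonneg (hm.trans_le hB) (sq_nonneg _)
  have hfpos : ∀ t, 0 < f t := fun t => Real.sqrt_pos.2 (hpos t)
  have hsq : ∀ t, f t ^ 2 = B + (t + p) ^ 2 := fun t => Real.sq_sqrt (hpos t).le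
  have hder : ∀ t, HasDerivAt f (f' t) t := by
    intro t
    have h1 : HasDerivAt (fun t : ℝ => B + (t + p) ^ 2) (2 * (t + p)) t := by
      have := (((hasDerivAt_id t).add_const p).pow 2).const_add B
      simpa using this
    have h2 := h1.sqrt (hpos t).ne'
    convert h2 using 1
    rw [hf', hf]
    field_simp
  have hder' : ∀ t, HasDerivAt f' (B / f t ^ 3) t := by
    intro t
    have h1 := ((hasDerivAt_id t).add_const p).div (hder t) (hfpos t).ne'
    refine HasDerivAt.congr_deriv h1 ?_
    have h2 := (hfpos t).ne'
    have h3 : f' t * f t = t + p := by rw [hf']; field_simp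
    simp only [id]
    rw [div_eq_div_iff (pow_ne_zero _ h2) (pow_ne_zero _ h2)]
    have : (1 * f t - (t + p) * f' t) * f t = B := by
      calc (1 * f t - (t + p) * f' t) * f t = f t ^ 2 - (t + p) * (f' t * f t) := by ring
        _ = B := by rw [h3, hsq]; ring
    rw [← this]
    ring
  have hJpos : 0 < J := (hfpos 0).trans_le (hJ 0 ⟨le_rfl, by positivity⟩)
  have hf'diff : ∀ t ∈ Set.Icc 0 a, m / J ^ 3 * b ≤ f' (t + b) - f' t := by
    intro t ht
    have := Convex.mul_sub_le_image_sub_of_le_deriv (D := Set.Icc 0 (a + b)) (convex_Icc _ _)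
      (f := f') (fun x _ => (hder' x).continuousAt.continuousWithinAt)
      (fun x _ => (hder' x).differentiableAt.differentiableWithinAt) (C := m / J ^ 3)
      (fun x hx => by
        rw [interior_Icc] at hx
        rw [(hder' x).deriv]
        exact div_le_div₀ (hm.le.trans hB) hB (pow_pos (hfpos x) 3)
          (pow_le_pow_left₀ (hfpos x).le (hJ x ⟨hx.1.le, hx.2.le⟩) 3))
      t ⟨ht.1, by linarith [ht.2]⟩ (t + b) ⟨by linarith [ht.1], by linarith [ht.2]⟩ (by linarith)
    rwa [add_sub_cancel_left] at this
  have hF : ∀ t, HasDerivAt (fun t => f (t + b) - f t) (f' (t + b) - f' t) t := fun t =>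
    ((hder (t + b)).comp_add_const t b).sub (hder t)
  have := Convex.mul_sub_le_image_sub_of_le_deriv (D := Set.Icc 0 a) (convex_Icc _ _)
      (f := fun t => f (t + b) - f t) (fun x _ => (hF x).continuousAt.continuousWithinAt)
      (fun x _ => (hF x).differentiableAt.differentiableWithinAt) (C := m / J ^ 3 * b)
      (fun x hx => by
        rw [interior_Icc] at hx
        rw [(hF x).deriv]
        exact hf'diff x ⟨hx.1.le, hx.2.le⟩)
      0 ⟨le_rfl, ha⟩ a ⟨ha, le_rfl⟩ ha
  simp only [hf, zero_add, sub_zero] at this ⊢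
  linarith

namespace System

variable {d : ℕ} (S : System d)

theorem bracket_line (x e : E d) (he : ‖e‖ = 1) (t : ℝ) :
    S.bracket (x + t • e) = √(S.m + ‖x‖ ^ 2 - inner ℝ x e ^ 2 + (t + inner ℝ x e) ^ 2) := by
  rw [bracket, norm_add_sq_real, inner_smul_right, norm_smul, he, mul_one, Real.norm_eq_abs, sq_abs]
  congr 1
  ring

/-- Quantitative convexity of the bracket along a line. -/
theorem bracket_second_difference {x e : E d} (he : ‖e‖ = 1) {a b J : ℝ} (ha : 0 ≤ a) (hb : 0 ≤ b)
    (h₀ : √S.m + ‖x‖ + a + b ≤ J) :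
    S.m / J ^ 3 * (a * b) ≤ S.bracket (x + (a + b) • e) - S.bracket (x + a • e)
      - S.bracket (x + b • e) + S.bracket x := by
  have h1 : S.bracket x = S.bracket (x + (0 : ℝ) • e) := by rw [zero_smul, add_zero]
  rw [h1, S.bracket_line x e he, S.bracket_line x e he, S.bracket_line x e he,
    S.bracket_line x e he]
  have hin : inner ℝ x e ^ 2 ≤ ‖x‖ ^ 2 := by
    have := abs_real_inner_le_norm x e
    rw [he, mul_one] at this
    rw [← sq_abs]
    exact pow_le_pow_left₀ (abs_nonneg _) this 2
  refine sqrt_second_difference S.m_pos (by linarith) ha hb fun t ht => ?_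
  rw [← S.bracket_line x e he]
  refine (S.bracket_le _).trans (le_trans ?_ h₀)
  have h2 : ‖x + t • e‖ ≤ ‖x‖ + t := by
    refine (norm_add_le _ _).trans ?_
    rw [norm_smul, he, mul_one, Real.norm_eq_abs, abs_of_nonneg ht.1]
  linarith [ht.2]

/-- Convexity of the bracket: second differences with equal steps. -/
theorem bracket_second_difference_self {x g : E d} {J : ℝ} (h₀ : √S.m + ‖x‖ + 2 * ‖g‖ ≤ J) :
    S.m / J ^ 3 * ‖g‖ ^ 2 ≤ S.bracket (x + g + g) - S.bracket (x + g) - S.bracket (x + g)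
      + S.bracket x := by
  by_cases hg : g = 0
  · subst hg; simp
  have hg' : ‖g‖ ≠ 0 := norm_ne_zero_iff.2 hg
  have he : ‖(‖g‖⁻¹ • g)‖ = 1 := by
    rw [norm_smul, norm_inv, norm_norm, inv_mul_cancel₀ hg']
  have h := S.bracket_second_difference (x := x) he (norm_nonneg g) (norm_nonneg g)
    (J := J) (by linarith)
  rw [add_smul, smul_inv_smul₀ hg', ← add_assoc] at h
  rwa [sq]

/-- The difference of brackets at two points with difference `w` is monotone in direction `w`. -/
theorem bracket_difference_shift {q w g : E d} {s c J : ℝ} {l : ℕ} (hw : w ≠ 0) (hs : 0 ≤ s)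
    (hg : ‖g - s • (‖w‖⁻¹ • w)‖ ≤ c)
    (h₀ : √S.m + ‖q‖ + ‖w‖ + l * s ≤ J) :
    l * (S.m / J ^ 3 * ‖w‖ * s - 2 * c) ≤
      (S.bracket (q + w + l • g) - S.bracket (q + l • g)) - (S.bracket (q + w) - S.bracket q) := by
  have hw' : ‖w‖ ≠ 0 := norm_ne_zero_iff.2 hw
  obtain ⟨e, hedef⟩ : ∃ e, e = ‖w‖⁻¹ • w := ⟨_, rfl⟩
  rw [← hedef] at hg
  have he : ‖e‖ = 1 := by
    rw [hedef, norm_smul, norm_inv, norm_norm, inv_mul_cancel₀ hw']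
  have hls : (0 : ℝ) ≤ l * s := by positivity
  have h := S.bracket_second_difference (x := q) he (norm_nonneg w) hls h₀
  rw [add_smul, ← add_assoc, show ‖w‖ • e = w by rw [hedef, smul_inv_smul₀ hw']] at h
  -- The lattice step `g` only approximates the ideal step `s • e`. The bracket is 1-Lipschitz, so
  -- each of the two differences compared costs at most `l * c`.
  have hlip : ∀ z : E d, |S.bracket (z + l • g) - S.bracket (z + ((l : ℝ) * s) • e)| ≤ l * c := by
    intro z
    refine (S.abs_bracket_sub_le _ _).trans ?_
    have : z + l • g - (z + ((l : ℝ) * s) • e) = (l : ℝ) • (g - s • e) := by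
      rw [smul_sub, smul_smul, Nat.cast_smul_eq_nsmul]
      abel
    rw [this, norm_smul, Real.norm_eq_abs, abs_of_nonneg (Nat.cast_nonneg l)]
    exact mul_le_mul_of_nonneg_left hg (Nat.cast_nonneg l)
  have h1 := abs_le.1 (hlip (q + w))
  have h2 := abs_le.1 (hlip q)
  nlinarith [h1.1, h2.2]

/-! ### Bounds on the multipliers -/

theorem exists_Q_bound : ∃ B : ℝ, 0 ≤ B ∧ ∀ η ξ ζ, ‖S.Q η ξ ζ‖ ≤ B := by
  obtain ⟨B₀, h₀⟩ := S.Q_bounded 0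
  obtain ⟨B₁, h₁⟩ := S.Q_bounded 1
  have h0 : 0 ≤ B₀ := (norm_nonneg _).trans (h₀ (0, 0)).1
  have h1 : 0 ≤ B₁ := (norm_nonneg _).trans (h₁ (0, 0)).1
  refine ⟨B₀ + B₁, by positivity, fun η ξ ζ => ?_⟩
  fin_cases η
  · have := (h₀ (ξ, ζ)).1
    simp only at this
    exact this.trans (by linarith)
  · have := (h₁ (ξ, ζ)).1
    simp only at this
    exact this.trans (by linarith)

theorem norm_q2_le {B : ℝ} (hB : ∀ η ξ ζ, ‖S.Q η ξ ζ‖ ≤ B) (η : Fin 2) (k₁ k₂ : E d) :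
    ‖S.q2 η k₁ k₂‖ ≤ B / (S.bracket k₁ * S.bracket k₂) := by
  have h1 := S.bracket_pos k₁
  have h2 := S.bracket_pos k₂
  have hpi : 1 ≤ (2 * Real.pi) ^ ((d : ℝ) / 2) :=
    Real.one_le_rpow (by linarith [Real.pi_gt_three]) (by positivity)
  rw [q2, norm_div, Complex.norm_real, Real.norm_eq_abs, abs_of_pos (by positivity)]
  refine div_le_div₀ ((norm_nonneg _).trans (hB η k₁ k₂)) (hB _ _ _) (by positivity) ?_
  have : S.bracket k₁ * S.bracket k₂ * 1
      ≤ S.bracket k₁ * S.bracket k₂ * (4 * (2 * Real.pi) ^ ((d : ℝ) / 2)) :=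
    mul_le_mul_of_nonneg_left (by linarith) (by positivity)
  linarith

theorem q2_eq_zero (η : Fin 2) {k₁ k₂ : E d} (h : k₁ + k₂ = 0) : S.q2 η k₁ k₂ = 0 := by
  obtain rfl := (neg_eq_of_add_eq_zero_right h).symm
  rw [q2, S.Q_opposite, zero_div]

theorem sgn_eq (ι : ℤˣ) : sgn ι = 1 ∨ sgn ι = -1 := by
  rcases Int.units_eq_one_or ι with rfl | rfl <;> simp [sgn]

theorem le_phase_mul {a b c r D : ℝ} (hr : 0 < r) (hb : r ≤ b) (hc : r ≤ c) (h1 : 0 ≤ D)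
    (ha : a ≤ b + c) (hD : r ^ 2 ≤ D * (a + b + c)) : r ^ 3 / 4 ≤ D * (b * c) := by
  have h3 : r ^ 2 ≤ D * (2 * (b + c)) := hD.trans (mul_le_mul_of_nonneg_left (by linarith) h1)
  have h4 : r * (b + c) ≤ 2 * (b * c) := by nlinarith
  have h5 : D * (r * (b + c)) ≤ D * (2 * (b * c)) := mul_le_mul_of_nonneg_left h4 h1
  nlinarith

/-- The phase of a binary node does not degenerate. -/
theorem le_abs_phase_mul (ι₀ ι₁ ι₂ : ℤˣ) {k k₁ k₂ : E d} (hk : k = k₁ + k₂) :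
    √S.m ^ 3 / 4 ≤ |sgn ι₀ * S.bracket k - (sgn ι₁ * S.bracket k₁ + sgn ι₂ * S.bracket k₂)|
      * (S.bracket k₁ * S.bracket k₂) := by
  have hr := S.sqrt_m_pos
  have hr2 : √S.m ^ 2 = S.m := Real.sq_sqrt S.m_pos.le
  -- The triangle `k = k₁ + k₂` is used in its three orientations. Each bounds one factor `y + z -
  -- x` of the brackets, times `a + b + c`, below by `m`, which covers all eight sign patterns.
  have e0 := S.m_le_bracket_add k₁ k₂
  have e1 := S.m_le_bracket_add k (-k₂)
  have e2 := S.m_le_bracket_add k (-k₁)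
  rw [show k + -k₂ = k₁ by rw [hk]; abel, bracket_neg] at e1
  rw [show k + -k₁ = k₂ by rw [hk]; abel, bracket_neg] at e2
  rw [← hk] at e0
  have pa := S.bracket_pos k
  have hb := S.sqrt_m_le_bracket k₁
  have hc := S.sqrt_m_le_bracket k₂
  set a := S.bracket k
  set b := S.bracket k₁
  set c := S.bracket k₂
  rw [← hr2] at e0 e1 e2
  have ha : a ≤ b + c := by nlinarith
  refine le_phase_mul hr hb hc (abs_nonneg _) ha ?_
  rw [← abs_of_pos (show 0 < a + b + c by linarith), ← abs_mul]
  rcases sgn_eq ι₀ with h0 | h0 <;> rcases sgn_eq ι₁ with h1 | h1 <;>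
    rcases sgn_eq ι₂ with h2 | h2 <;> rw [h0, h1, h2, le_abs]
  · right; linarith
  · left; nlinarith
  · left; nlinarith
  · left; nlinarith
  · right; nlinarith
  · right; nlinarith
  · right; nlinarith
  · left; nlinarith

/-- The denominator has modulus at least `m` for both signs, and the growing numerator `⟨k₁ + k₃⟩`
cancels against the bracket in the second quadratic multiplier. -/
theorem norm_q3_le {B : ℝ} (hB0 : 0 ≤ B) (hB : ∀ η ξ ζ, ‖S.Q η ξ ζ‖ ≤ B) (η : Fin 2) (ι : ℤˣ)
    (k₁ k₂ k₃ : E d) : ‖S.q3 η ι k₁ k₂ k₃‖ ≤ 4 * B ^ 2 / (S.m * √S.m ^ 3) := by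
  have hm := S.m_pos
  have hr := S.sqrt_m_pos
  have h1 := S.bracket_pos k₁
  have h2 := S.bracket_pos k₂
  have h3 := S.bracket_pos k₃
  have h13 := S.bracket_pos (k₁ + k₃)
  have hden : S.m ≤ |S.m + 2 * (inner ℝ (k₁ + k₂ + k₃) k₂
        - sgn ι * S.bracket (k₁ + k₂ + k₃) * S.bracket k₂)| := by
    have e1 := S.m_add_inner_le (k₁ + k₂ + k₃) k₂
    have e2 := S.m_sub_inner_le (k₁ + k₂ + k₃) k₂
    rw [le_abs]
    rcases sgn_eq ι with h | h <;> rw [h]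
    · right; linarith
    · left; linarith
  rw [q3, norm_mul, norm_mul, Complex.norm_real, Real.norm_eq_abs, abs_div, abs_of_pos (by positivity)]
  calc _ ≤ 4 * S.bracket (k₁ + k₃) / S.m * (B / (S.bracket k₁ * S.bracket k₃)) *
        (B / (S.bracket (k₁ + k₃) * S.bracket k₂)) := by
        gcongr
        · exact S.norm_q2_le hB _ _ _
        · exact S.norm_q2_le hB _ _ _
    _ = 4 * B ^ 2 / (S.m * (S.bracket k₁ * S.bracket k₂ * S.bracket k₃)) := by
        field_simp
    _ ≤ _ := by
        have : √S.m ^ 3 ≤ S.bracket k₁ * S.bracket k₂ * S.bracket k₃ := by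
          rw [pow_succ, sq]
          gcongr <;> exact S.sqrt_m_le_bracket _
        gcongr

end System

/-! ### Oscillating time integrals -/

/-- Up to a null set a bounded order-connected set is an interval, on which the exponential has an
explicit primitive of modulus `1 / |w|`. -/
theorem norm_setIntegral_exp_le {s : Set ℝ} (hs : s.OrdConnected) {a b : ℝ}
    (hab : s ⊆ Set.Icc a b) {w : ℝ} (hw : w ≠ 0) :
    ‖∫ τ in s, Complex.exp (Complex.I * ((w * τ : ℝ) : ℂ))‖ ≤ 2 / |w| := by
  have hw' : 0 < |w| := abs_pos.2 hw
  rcases s.eq_empty_or_nonempty with rfl | hne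
  · simp only [Measure.restrict_empty, integral_zero_measure, norm_zero]
    positivity
  have hbb : BddBelow s := ⟨a, fun x hx => (hab hx).1⟩
  have hba : BddAbove s := ⟨b, fun x hx => (hab hx).2⟩
  have h1 : Set.Ioo (sInf s) (sSup s) ⊆ s :=
    IsConnected.Ioo_csInf_csSup_subset ⟨hne, hs.isPreconnected⟩ hbb hba
  have h2 : s ⊆ Set.Icc (sInf s) (sSup s) := subset_Icc_csInf_csSup hbb hba
  have h3 : s =ᵐ[volume] Set.Ioc (sInf s) (sSup s) := by
    refine Filter.EventuallyLE.antisymm ?_ ?_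
    · exact h2.eventuallyLE.trans Ioc_ae_eq_Icc.symm.le
    · exact (Ioo_ae_eq_Ioc (μ := volume)).symm.le.trans h1.eventuallyLE
  have hle : sInf s ≤ sSup s := csInf_le_csSup hne hbb hba
  rw [setIntegral_congr_set h3, ← intervalIntegral.integral_of_le hle]
  have hc : Complex.I * (w : ℂ) ≠ 0 := by simp [hw]
  have h4 : ∀ τ : ℝ, Complex.I * ((w * τ : ℝ) : ℂ) = Complex.I * (w : ℂ) * τ := by
    intro τ; push_cast; ring
  simp only [h4]
  rw [integral_exp_mul_complex hc, norm_div]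
  have h5 : ∀ τ : ℝ, ‖Complex.exp (Complex.I * (w : ℂ) * τ)‖ = 1 := by
    intro τ
    rw [← h4, mul_comm, Complex.norm_exp_ofReal_mul_I]
  have h6 : ‖Complex.I * (w : ℂ)‖ = |w| := by simp
  rw [h6]
  gcongr
  exact (norm_sub_le _ _).trans (by rw [h5, h5]; norm_num)

section

variable {J : Type*} [Fintype J]

theorem norm_prod_exp (w s : J → ℝ) :
    ‖∏ j, Complex.exp (Complex.I * ((w j * s j : ℝ) : ℂ))‖ = 1 := by
  rw [norm_prod]
  refine Finset.prod_eq_one fun j _ => ?_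
  rw [mul_comm, Complex.norm_exp_ofReal_mul_I]

theorem volume_box {t : ℝ} (ht : 0 ≤ t) :
    (volume : Measure (J → ℝ)).real (Set.Icc 0 fun _ => t) = t ^ Fintype.card J := by
  rw [Measure.real, Real.volume_Icc_pi_toReal (show (0 : J → ℝ) ≤ fun _ => t from fun _ => ht)]
  simp

theorem norm_setIntegral_prod_exp_le {D : Set (J → ℝ)} {t : ℝ} (ht : 0 ≤ t)
    (hD : D ⊆ Set.Icc 0 fun _ => t) (w : J → ℝ) :
    ‖∫ s in D, ∏ j, Complex.exp (Complex.I * ((w j * s j : ℝ) : ℂ))‖ ≤ t ^ Fintype.card J := by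
  have hfin : volume (Set.Icc (0 : J → ℝ) fun _ => t) < ⊤ := isCompact_Icc.measure_lt_top
  refine (norm_setIntegral_le_of_norm_le_const ((measure_mono hD).trans_lt hfin) (C := 1)
    fun s _ => (norm_prod_exp w s).le).trans ?_
  rw [one_mul, ← volume_box ht]
  exact measureReal_mono hD hfin.ne

/-- One oscillating factor gains the inverse of its frequency. -/
theorem norm_setIntegral_prod_exp_le_of_ne_zero [DecidableEq J] {D : Set (J → ℝ)} {t : ℝ}
    (ht : 0 ≤ t) (hD : D ⊆ Set.Icc 0 fun _ => t) (hDm : MeasurableSet D) (j₀ : J)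
    (hsec : ∀ s : J → ℝ, Set.OrdConnected {τ | Function.update s j₀ τ ∈ D})
    (w : J → ℝ) (hw : w j₀ ≠ 0) :
    ‖∫ s in D, ∏ j, Complex.exp (Complex.I * ((w j * s j : ℝ) : ℂ))‖
      ≤ t ^ (Fintype.card J - 1) * (2 / |w j₀|) := by
  classical
  set f : (J → ℝ) → ℂ := fun s => ∏ j, Complex.exp (Complex.I * ((w j * s j : ℝ) : ℂ)) with hf
  have hfc : Continuous f := by
    rw [hf]
    fun_prop
  have hfin : volume (Set.Icc (0 : J → ℝ) fun _ => t) < ⊤ := isCompact_Icc.measure_lt_top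
  have hint : Integrable (D.indicator f) := by
    rw [integrable_indicator_iff hDm]
    exact (hfc.continuousOn.integrableOn_compact isCompact_Icc).mono_set hD
  obtain ⟨p, hp⟩ : ∃ p : J → Prop, ∀ j, p j ↔ j = j₀ := ⟨fun j => j = j₀, fun _ => Iff.rfl⟩
  set e := MeasurableEquiv.piEquivPiSubtypeProd (fun _ : J => ℝ) p with he
  have hmp : MeasurePreserving e volume volume :=
    volume_preserving_piEquivPiSubtypeProd (fun _ : J => ℝ) p
  rw [← integral_indicator hDm, ← hmp.symm.integral_comp']
  have hint' : Integrable (fun x => D.indicator f (e.symm x)) volume :=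
    hmp.symm.integrable_comp_of_integrable hint
  rw [Measure.volume_eq_prod] at hint' ⊢
  rw [integral_prod_symm _ hint']
  let hU : Unique {j : J // p j} := ⟨⟨⟨j₀, (hp j₀).2 rfl⟩⟩, fun x => Subtype.ext ((hp _).1 x.2)⟩
  have hmpU : MeasurePreserving (MeasurableEquiv.funUnique {j : J // p j} ℝ) volume volume := by
    convert volume_preserving_funUnique {j : J // p j} ℝ
  set g : ({j : J // ¬ p j} → ℝ) → (J → ℝ) :=
    fun b j => if h : p j then 0 else b ⟨j, h⟩ with hg
  have hesymm : ∀ (b : {j : J // ¬ p j} → ℝ) (τ : ℝ),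
      e.symm ((MeasurableEquiv.funUnique {j : J // p j} ℝ).symm τ, b)
        = Function.update (g b) j₀ τ := by
    intro b τ
    funext j
    by_cases hj : p j
    · obtain rfl : j = j₀ := (hp j).1 hj
      have : e.symm ((MeasurableEquiv.funUnique {j' : J // p j'} ℝ).symm τ, b) j = τ := by
        change (if h : p j then _ else _) = τ
        rw [dif_pos hj]
        rfl
      rw [this, Function.update_self]
    · have : e.symm ((MeasurableEquiv.funUnique {j' : J // p j'} ℝ).symm τ, b) j = b ⟨j, hj⟩ := by
        change (if h : p j then _ else _) = _
        rw [dif_neg hj]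
      rw [this, Function.update_of_ne (fun h => hj ((hp j).2 h)), hg]
      simp only
      rw [dif_neg hj]
  -- Fubini with the coordinate `j₀` innermost: the other exponentials are constants of modulus one,
  -- the section is order-connected, and it is empty when the remaining times leave the box.
  -- Integrating this bound over that box gives the remaining power of `t`.
  have hinner : ∀ b : {j : J // ¬ p j} → ℝ,
      ‖∫ a : {j : J // p j} → ℝ, D.indicator f (e.symm (a, b))‖
        ≤ (Set.Icc (0 : {j : J // ¬ p j} → ℝ) fun _ => t).indicator (fun _ => 2 / |w j₀|) b := by
    intro b
    rw [← hmpU.symm.integral_comp']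
    simp only [hesymm]
    set T : Set ℝ := {τ | Function.update (g b) j₀ τ ∈ D} with hT
    by_cases hb : b ∈ Set.Icc (0 : {j : J // ¬ p j} → ℝ) fun _ => t
    · rw [Set.indicator_of_mem hb]
      have h1 : ∀ τ, D.indicator f (Function.update (g b) j₀ τ)
          = (∏ j ∈ Finset.univ.erase j₀, Complex.exp (Complex.I * ((w j * g b j : ℝ) : ℂ)))
            * T.indicator (fun τ => Complex.exp (Complex.I * ((w j₀ * τ : ℝ) : ℂ))) τ := by
        intro τ
        by_cases hτ : Function.update (g b) j₀ τ ∈ D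
        · have hτ' : τ ∈ T := hτ
          rw [Set.indicator_of_mem hτ, Set.indicator_of_mem hτ', hf]
          simp only
          rw [← Finset.mul_prod_erase Finset.univ _ (Finset.mem_univ j₀), mul_comm,
            Function.update_self]
          congr 1
          refine Finset.prod_congr rfl fun j hj => ?_
          rw [Function.update_of_ne (Finset.ne_of_mem_erase hj)]
        · have hτ' : τ ∉ T := hτ
          rw [Set.indicator_of_notMem hτ, Set.indicator_of_notMem hτ', mul_zero]
      have hTm : MeasurableSet T := (hsec (g b)).measurableSet
      have hTt : T ⊆ Set.Icc 0 t := by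
        intro τ hτ
        have h2 := hD hτ
        have h3 := h2.1 j₀
        have h4 := h2.2 j₀
        rw [Function.update_self] at h3 h4
        exact ⟨h3, h4⟩
      simp only [h1]
      rw [integral_const_mul, integral_indicator hTm, norm_mul, norm_prod,
        Finset.prod_eq_one, one_mul]
      · exact norm_setIntegral_exp_le (hsec (g b)) hTt hw
      · intro j _
        rw [mul_comm, Complex.norm_exp_ofReal_mul_I]
    · rw [Set.indicator_of_notMem hb]
      have h1 : ∀ τ, D.indicator f (Function.update (g b) j₀ τ) = 0 := by
        intro τ
        refine Set.indicator_of_notMem (fun hτ => hb ?_) _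
        have h2 := hD hτ
        have h3 : ∀ j : {j : J // ¬ p j}, Function.update (g b) j₀ τ j.1 = b j := by
          intro j
          rw [Function.update_of_ne (fun h => j.2 ((hp _).2 h)), hg]
          simp only
          rw [dif_neg j.2]
        exact ⟨fun j => by rw [← h3]; exact h2.1 j.1, fun j => by rw [← h3]; exact h2.2 j.1⟩
      simp [h1]
  have hcard : Fintype.card {j : J // ¬ p j} = Fintype.card J - 1 := by
    rw [Fintype.card_subtype_compl, Fintype.card_unique (α := {j : J // p j})]
  have hfin' : volume (Set.Icc (0 : {j : J // ¬ p j} → ℝ) fun _ => t) < ⊤ :=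
    isCompact_Icc.measure_lt_top
  refine (norm_integral_le_of_norm_le ?_ (Filter.Eventually.of_forall hinner)).trans ?_
  · rw [integrable_indicator_iff measurableSet_Icc]
    exact integrableOn_const hfin'.ne
  · rw [integral_indicator measurableSet_Icc, setIntegral_const, volume_box ht, hcard, smul_eq_mul]

end

theorem timeDomain_subset (A : Tree) (t : ℝ) : A.timeDomain t ⊆ Set.Icc 0 fun _ => t :=
  fun _ hs => ⟨fun j => (hs.1 j).1, fun j => (hs.1 j).2⟩

theorem measurableSet_timeDomain (A : Tree) (t : ℝ) : MeasurableSet (A.timeDomain t) := by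
  have : A.timeDomain t = (⋂ j : A.TNode, {s | s j ∈ Set.Icc 0 t}) ∩
      ⋂ (j : A.TNode) (j' : A.TNode) (_ : j.1 ≤ j'.1), {s | s j ≤ s j'} := by
    ext s
    simp [Tree.timeDomain]
  rw [this]
  refine (MeasurableSet.iInter fun j => ?_).inter
    (MeasurableSet.iInter fun j => MeasurableSet.iInter fun j' => MeasurableSet.iInter fun _ => ?_)
  · exact measurableSet_Icc.preimage (measurable_pi_apply j)
  · exact measurableSet_le (measurable_pi_apply j) (measurable_pi_apply j')

/-- With the other times frozen, the ordering constraints on `t_{j₀}` are only lower and upper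
bounds. -/
theorem ordConnected_timeDomain_section (A : Tree) (t : ℝ) (j₀ : A.TNode) (s : A.TNode → ℝ) :
    Set.OrdConnected {τ | Function.update s j₀ τ ∈ A.timeDomain t} := by
  refine ⟨fun a ha b hb c hc => ⟨fun j => ?_, fun j j' hjj' => ?_⟩⟩
  · have h1 := ha.1 j
    have h2 := hb.1 j
    by_cases hj : j = j₀
    · subst hj
      rw [Function.update_self] at h1 h2 ⊢
      exact ⟨h1.1.trans hc.1, hc.2.trans h2.2⟩
    · rwa [Function.update_of_ne hj] at h1 ⊢
  · have h1 := ha.2 j j' hjj'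
    have h2 := hb.2 j j' hjj'
    by_cases hj : j = j₀ <;> by_cases hj' : j' = j₀
    · rw [hj, hj']
    · subst hj
      rw [Function.update_self, Function.update_of_ne hj'] at h2 ⊢
      exact hc.2.trans h2
    · subst hj'
      rw [Function.update_self, Function.update_of_ne hj] at h1 ⊢
      exact h1.trans hc.1
    · rwa [Function.update_of_ne hj, Function.update_of_ne hj'] at h1 ⊢

theorem timeIntegral_eq_prod (A : Fin 2 → Tree) (t : ℝ) (w : ∀ i, (A i).TNode → ℝ) :
    ∫ s in Set.pi Set.univ (fun i => (A i).timeDomain t),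
      ∏ i, ∏ j : (A i).TNode, Complex.exp (Complex.I * ((w i j * s i j : ℝ) : ℂ))
    = ∏ i, ∫ s in (A i).timeDomain t,
        ∏ j : (A i).TNode, Complex.exp (Complex.I * ((w i j * s j : ℝ) : ℂ)) := by
  rw [volume_pi, Measure.restrict_pi_pi]
  exact integral_fintype_prod_eq_prod
    (fun i (s : (A i).TNode → ℝ) =>
      ∏ j : (A i).TNode, Complex.exp (Complex.I * ((w i j * s j : ℝ) : ℂ)))

theorem norm_timeIntegral_le (A : Fin 2 → Tree) {t : ℝ} (ht : 0 ≤ t)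
    (w : ∀ i, (A i).TNode → ℝ) :
    ‖∫ s in Set.pi Set.univ (fun i => (A i).timeDomain t),
      ∏ i, ∏ j : (A i).TNode, Complex.exp (Complex.I * ((w i j * s i j : ℝ) : ℂ))‖
    ≤ t ^ ∑ i, Fintype.card (A i).TNode := by
  rw [timeIntegral_eq_prod, norm_prod, ← Finset.prod_pow_eq_pow_sum]
  exact Finset.prod_le_prod (fun _ _ => norm_nonneg _) fun i _ =>
    norm_setIntegral_prod_exp_le ht (timeDomain_subset _ _) _

theorem norm_timeIntegral_le_of_ne_zero (A : Fin 2 → Tree) {t : ℝ} (ht : 0 ≤ t)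
    (w : ∀ i, (A i).TNode → ℝ) (i₀ : Fin 2) (j₀ : (A i₀).TNode) (hw : w i₀ j₀ ≠ 0) :
    ‖∫ s in Set.pi Set.univ (fun i => (A i).timeDomain t),
      ∏ i, ∏ j : (A i).TNode, Complex.exp (Complex.I * ((w i j * s i j : ℝ) : ℂ))‖
    ≤ t ^ (∑ i, Fintype.card (A i).TNode - 1) * (2 / |w i₀ j₀|) := by
  rw [timeIntegral_eq_prod, norm_prod, ← Finset.mul_prod_erase _ _ (Finset.mem_univ i₀)]
  have h1 := norm_setIntegral_prod_exp_le_of_ne_zero ht (timeDomain_subset (A i₀) t)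
    (measurableSet_timeDomain _ _) j₀ (ordConnected_timeDomain_section _ _ _) (w i₀) hw
  have h2 : ∏ i ∈ Finset.univ.erase i₀, ‖∫ s in (A i).timeDomain t,
        ∏ j : (A i).TNode, Complex.exp (Complex.I * ((w i j * s j : ℝ) : ℂ))‖
      ≤ ∏ i ∈ Finset.univ.erase i₀, t ^ Fintype.card (A i).TNode :=
    Finset.prod_le_prod (fun _ _ => norm_nonneg _) fun i _ =>
      norm_setIntegral_prod_exp_le ht (timeDomain_subset _ _) _
  have hc : 1 ≤ Fintype.card (A i₀).TNode := Fintype.card_pos_iff.2 ⟨j₀⟩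
  refine (mul_le_mul h1 h2 (Finset.prod_nonneg fun _ _ => norm_nonneg _) (by positivity)).trans
    (le_of_eq ?_)
  rw [Finset.prod_pow_eq_pow_sum, mul_right_comm, ← pow_add,
    ← Finset.add_sum_erase _ _ (Finset.mem_univ i₀)]
  congr 2
  omega

/-! ### Gains in the number of lattice points -/

theorem single_mem_lattice {d : ℕ} {L : ℝ} (i : Fin d) (n : ℤ) :
    EuclideanSpace.single i ((n : ℝ) / L) ∈ lattice d L := by
  intro j
  by_cases h : j = i
  · subst h
    exact ⟨n, by simp⟩
  · exact ⟨0, by simp [h]⟩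

theorem norm_nsmul_eq {d : ℕ} (l : ℕ) (g : E d) : ‖l • g‖ = l * ‖g‖ := by
  rw [← Nat.cast_smul_eq_nsmul ℝ, norm_smul, Real.norm_eq_abs, Nat.abs_cast]

theorem exists_lattice_norm_gt {d : ℕ} (hd : 1 ≤ d) {L r : ℝ} (hL : 0 < L) (hr : 0 ≤ r) :
    ∃ g ∈ lattice d L, r < ‖g‖ ∧ ‖g‖ ≤ r + 1 / L := by
  have h0 : 0 ≤ ⌊r * L⌋ := Int.floor_nonneg.2 (by positivity)
  have h0' : (0 : ℝ) ≤ ⌊r * L⌋ := by exact_mod_cast h0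
  refine ⟨_, single_mem_lattice (L := L) ⟨0, hd⟩ (⌊r * L⌋ + 1), ?_, ?_⟩
  · rw [PiLp.norm_single, Real.norm_eq_abs, abs_div, abs_of_pos hL]
    push_cast
    rw [abs_of_nonneg (by linarith), lt_div_iff₀ hL]
    exact Int.lt_floor_add_one _
  · rw [PiLp.norm_single, Real.norm_eq_abs, abs_div, abs_of_pos hL]
    push_cast
    rw [abs_of_nonneg (by linarith), div_le_iff₀ hL, add_mul, one_div, inv_mul_cancel₀ hL.ne']
    linarith [Int.floor_le (r * L)]

theorem exists_lattice_near {d : ℕ} {L : ℝ} (hL : 0 < L) (v : E d) :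
    ∃ g ∈ lattice d L, ‖g - v‖ ≤ d / L := by
  refine ⟨WithLp.toLp 2 fun i => (⌊v i * L⌋ : ℝ) / L, fun i => ⟨_, rfl⟩, ?_⟩
  refine abs_le_of_sq_le_sq' ?_ (by positivity) |>.2
  rw [EuclideanSpace.norm_sq_eq]
  have h : ∀ i ∈ (Finset.univ : Finset (Fin d)),
      ‖((WithLp.toLp 2 fun i => (⌊v i * L⌋ : ℝ) / L : E d) - v) i‖ ^ 2 ≤ (1 / L) ^ 2 := by
    intro i _
    apply pow_le_pow_left₀ (norm_nonneg _)
    rw [PiLp.sub_apply, Real.norm_eq_abs, abs_sub_comm]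
    have h1 := Int.floor_le (v i * L)
    have h2 := Int.lt_floor_add_one (v i * L)
    have h3 : v i - (⌊v i * L⌋ : ℝ) / L = (v i * L - ⌊v i * L⌋) / L := by
      field_simp
    change |v i - (⌊v i * L⌋ : ℝ) / L| ≤ 1 / L
    rw [h3, abs_of_nonneg (div_nonneg (by linarith) hL.le)]
    gcongr
    linarith
  refine (Finset.sum_le_sum h).trans ?_
  rw [Finset.sum_const, Finset.card_univ, Fintype.card_fin, nsmul_eq_mul, div_pow, div_pow, one_pow,
    mul_one_div]
  gcongr
  have : (d : ℝ) ≤ (d : ℝ) * d := by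
    rcases Nat.eq_zero_or_pos d with rfl | hd
    · simp
    · have : (1 : ℝ) ≤ d := by exact_mod_cast hd
      nlinarith
  nlinarith

/-- Sequences with second differences bounded below. -/
theorem le_difference_of_convex {h : ℕ → ℝ} {a : ℝ} {l : ℕ}
    (hh : ∀ i < l, a ≤ h (i + 2) - h (i + 1) - h (i + 1) + h i) {i j : ℕ} (hij : i ≤ j)
    (hj : j ≤ l) : h (i + 1) - h i + (j - i : ℝ) * a ≤ h (j + 1) - h j := by
  induction j, hij using Nat.le_induction with
  | base => simp
  | succ j hij ih =>
    have h1 := ih (by omega)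
    have h2 := hh j (by omega)
    push_cast
    linarith

theorem le_of_difference {h : ℕ → ℝ} {θ : ℝ} {l : ℕ} (hh : ∀ i < l, θ ≤ h (i + 1) - h i) :
    l * θ ≤ h l - h 0 := by
  induction l with
  | zero => simp
  | succ l ih =>
    have h1 := ih fun i hi => hh i (by omega)
    have h2 := hh l (by omega)
    push_cast
    linarith

section

variable {ι : Type*} {σ : ι → ι} {A : Finset ι} {d : ℕ} {L R : ℝ} {k : E d} {u : ι → ℤ}

theorem pairedSet_mono {ρ : ℝ} (h : R ≤ ρ) : pairedSet σ A L k R ⊆ pairedSet σ A L k ρ :=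
  fun _ hx => ⟨hx.1, hx.2.1, fun ℓ => ⟨(hx.2.2 ℓ).1, (hx.2.2 ℓ).2.trans h⟩⟩

/-- Gain from the smallness of a nontrivial linear form. -/
theorem ncard_le_of_linear (hd : 1 ≤ d) (hL : 0 < L) (hu : IsDirection σ A u)
    (hfin : (pairedSet σ A L k (R + 1)).Finite) {X : Finset ι} (hX : ∑ ℓ ∈ X, u ℓ = 1)
    {S : Set (ι → E d)} (hS : S ⊆ pairedSet σ A L k R) {r : ℝ} (hr : 0 ≤ r)
    (hSr : ∀ x ∈ S, ‖∑ ℓ ∈ X, x ℓ‖ ≤ r) :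
    (S.ncard : ℝ) ≤ (2 * r + 1 / L) * (pairedSet σ A L k (R + 1)).ncard := by
  -- Two points of the ball of radius `r` are at distance at most `2 r`, so any longer step expels
  -- the moving sum; the lattice permits one no longer than `2 r + 1 / L`.
  obtain ⟨g, hg, hg1, hg2⟩ := exists_lattice_norm_gt hd hL (r := 2 * r) (by positivity)
  refine ncard_le_of_separated hu hS hfin (fun _ => g) (fun x _ => ⟨hg, hg2⟩) (fun _ _ => rfl)
    (by positivity) fun x hx l hl _ hmem => ?_
  have h1 := hSr _ hmem
  rw [sum_shift, hX, one_smul] at h1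
  have h2 := hSr _ hx
  have h3 : (l : ℝ) * ‖g‖ ≤ r + r := by
    rw [← norm_nsmul_eq]
    have : l • g = (∑ ℓ ∈ X, x ℓ + l • g) - ∑ ℓ ∈ X, x ℓ := by abel
    rw [this]
    exact (norm_sub_le _ _).trans (add_le_add h1 h2)
  have h4 : (1 : ℝ) ≤ l := by exact_mod_cast hl
  nlinarith [norm_nonneg g]

variable (S₀ : System d)

/-- Gain from the smallness of a convex function of the moving vectors. -/
theorem ncard_le_of_convex (hd : 1 ≤ d) (hL : 0 < L) (hu : IsDirection σ A u)
    (hfin : (pairedSet σ A L k (R + 1)).Finite) {S : Set (ι → E d)}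
    (hS : S ⊆ pairedSet σ A L k R) {p q : (ι → E d) → E d} {c : (ι → E d) → ℝ} {τ : ℝ}
    (hp : ∀ x v, p (shift u x v) = p x + v) (hq : ∀ x v, q (shift u x v) = q x + v)
    (hc : ∀ x v, c (shift u x v) = c x) (hτ : τ = 1 ∨ τ = -1) {B η s : ℝ}
    (hpB : ∀ x ∈ S, ‖p x‖ ≤ B) (hqB : ∀ x ∈ S, ‖q x‖ ≤ B) (hη : 0 < η)
    (hSη : ∀ x ∈ S, |c x + τ * S₀.bracket (p x) + τ * S₀.bracket (q x)| ≤ η)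
    (hs : 0 < s) (hsL : 2 / L ≤ s) (hsη : 24 * η ≤ S₀.m / (√S₀.m + 3 * B + 3) ^ 3 * s ^ 2) :
    (S.ncard : ℝ) ≤ 3 * s * (pairedSet σ A L k (R + 1)).ncard := by
  have hSP : S ⊆ pairedSet σ A L k (R + 1) := hS.trans (pairedSet_mono (by linarith))
  rcases S.eq_empty_or_nonempty with rfl | ⟨x₀, hx₀⟩
  · simp only [Set.ncard_empty, Nat.cast_zero]
    positivity
  have hB : 0 ≤ B := (norm_nonneg _).trans (hpB x₀ hx₀)
  rcases lt_or_ge 1 s with hs1 | hs1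
  · have : (S.ncard : ℝ) ≤ (pairedSet σ A L k (R + 1)).ncard := by
      exact_mod_cast Set.ncard_le_ncard hSP hfin
    have h0 : (0 : ℝ) ≤ (pairedSet σ A L k (R + 1)).ncard := by positivity
    nlinarith
  have hL' : 1 / L ≤ s / 2 := by
    have : 2 / L = 2 * (1 / L) := by ring
    linarith
  have hL0 : 0 < 1 / L := by positivity
  -- The length of `g` lies between `s / 2` and `s`. The lower bound turns the hypothesis `24 * η`
  -- into second differences of size at least `6 * η`.
  obtain ⟨g, hg, hg1, hg2⟩ := exists_lattice_norm_gt hd hL (r := s - 1 / L) (by linarith)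
  rw [sub_add_cancel] at hg2
  have hgs : s / 2 ≤ ‖g‖ := by linarith
  set J := √S₀.m + 3 * B + 3 with hJ
  have hJ0 : 0 < J := by have := S₀.sqrt_m_pos; positivity
  set a := S₀.m / J ^ 3 * ‖g‖ ^ 2 with ha
  have hcc : 0 < S₀.m / J ^ 3 := div_pos S₀.m_pos (by positivity)
  have ha0 : 6 * η ≤ a := by
    have h1 : (s / 2) ^ 2 ≤ ‖g‖ ^ 2 := pow_le_pow_left₀ (by linarith) hgs 2
    have h2 := mul_le_mul_of_nonneg_left h1 hcc.le
    rw [ha]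
    nlinarith
  set H : (ι → E d) → ℝ := fun x => S₀.bracket (p x) + S₀.bracket (q x) with hH
  set h : (ι → E d) → ℕ → ℝ := fun x i => H (shift u x (i • g)) with hh
  have hconv : ∀ x ∈ S, ∀ l : ℕ, (l : ℝ) * s ≤ 1 → ∀ i < l,
      a ≤ h x (i + 2) - h x (i + 1) - h x (i + 1) + h x i := by
    intro x hx l hl i hil
    have key : ∀ y : E d, ‖y‖ ≤ B →
        a ≤ S₀.bracket (y + (i + 2) • g) - S₀.bracket (y + (i + 1) • g)
          - S₀.bracket (y + (i + 1) • g) + S₀.bracket (y + i • g) := by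
      intro y hy
      have hil' : (i : ℝ) ≤ l := by exact_mod_cast hil.le
      have h1 : ‖y + i • g‖ ≤ B + 1 := by
        refine (norm_add_le _ _).trans (add_le_add hy ?_)
        rw [norm_nsmul_eq]
        calc (i : ℝ) * ‖g‖ ≤ l * s := by gcongr
          _ ≤ 1 := hl
      have h2 := S₀.bracket_second_difference_self (x := y + i • g) (g := g) (J := J)
        (by rw [hJ]; linarith)
      have e1 : y + i • g + g = y + (i + 1) • g := by rw [add_assoc, ← succ_nsmul]
      have e2 : y + i • g + g + g = y + (i + 2) • g := by
        rw [e1, add_assoc, ← succ_nsmul]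
      rw [e2, e1] at h2
      exact h2
    have k1 := key (p x) (hpB x hx)
    have k2 := key (q x) (hqB x hx)
    simp only [hh, hH, hp, hq]
    linarith
  have hHS : ∀ x ∈ S, ∀ l : ℕ, shift u x (l • g) ∈ S → |h x l - h x 0| ≤ 2 * η := by
    intro x hx l hl
    have h1 := hSη _ hl
    have h2 := hSη _ hx
    rw [hc] at h1
    have e0 : h x 0 = H x := by simp only [hh, zero_smul, shift_zero]
    have e1 : h x l = H (shift u x (l • g)) := rfl
    rw [e0, e1]
    simp only [hH]
    rw [abs_le] at h1 h2 ⊢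
    rcases hτ with rfl | rfl <;> constructor <;> linarith [h1.1, h1.2, h2.1, h2.2]
  -- Two points of `S` on one line have values of `h` within `2 * η`. A convex sequence can still
  -- return near its initial value, but not with the same regime of first difference: hence the
  -- splitting into increasing, decreasing and nearly flat, which costs the factor `3`.
  set S₁ := {x ∈ S | 3 * η ≤ h x 1 - h x 0} with hS₁
  set S₂ := {x ∈ S | h x 1 - h x 0 ≤ -(3 * η)} with hS₂
  set S₃ := {x ∈ S | |h x 1 - h x 0| < 3 * η} with hS₃
  have hstep : ∀ (x : ι → E d) (l i : ℕ), h (shift u x (l • g)) i = h x (l + i) := by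
    intro x l i
    simp only [hh, shift_shift, ← add_smul]
  have b₁ : (S₁.ncard : ℝ) ≤ s * (pairedSet σ A L k (R + 1)).ncard := by
    refine ncard_le_of_separated hu (fun x hx => hS hx.1) hfin (fun _ => g) (fun x _ => ⟨hg, hg2⟩)
      (fun _ _ => rfl) hs fun x hx l hl hls hmem => ?_
    have h1 : ∀ i < l, 3 * η ≤ h x (i + 1) - h x i := by
      intro i hi
      have h2 := le_difference_of_convex (hconv x hx.1 l hls) (Nat.zero_le i) hi.le
      have h3 : 3 * η ≤ h x 1 - h x 0 := hx.2
      have h4 : (0 : ℝ) ≤ (i - (0 : ℕ) : ℝ) * a := by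
        rw [Nat.cast_zero, sub_zero]; positivity
      simp only [zero_add] at h2
      linarith
    have h2 := le_of_difference h1
    have h3 := (abs_le.1 (hHS x hx.1 l hmem.1)).2
    have h4 : (1 : ℝ) ≤ l := by exact_mod_cast hl
    nlinarith
  have b₂ : (S₂.ncard : ℝ) ≤ s * (pairedSet σ A L k (R + 1)).ncard := by
    refine ncard_le_of_separated hu (fun x hx => hS hx.1) hfin (fun _ => g) (fun x _ => ⟨hg, hg2⟩)
      (fun _ _ => rfl) hs fun x hx l hl hls hmem => ?_
    have h1 : ∀ i < l, 3 * η ≤ -h x (i + 1) - -h x i := by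
      -- Here convexity is used backwards: the slope at the translate is at most `-3 * η`, so all
      -- earlier slopes are too.
      intro i hi
      have h2 := le_difference_of_convex (hconv x hx.1 l hls) hi.le le_rfl
      have h3 : h (shift u x (l • g)) 1 - h (shift u x (l • g)) 0 ≤ -(3 * η) := hmem.2
      rw [hstep, hstep, add_zero] at h3
      have h4 : (0 : ℝ) ≤ (l - i : ℝ) * a := by
        have : (i : ℝ) ≤ l := by exact_mod_cast hi.le
        exact mul_nonneg (by linarith) (by linarith)
      linarith
    have h2 := le_of_difference (h := fun i => -h x i) h1
    have h3 := (abs_le.1 (hHS x hx.1 l hmem.1)).1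
    have h4 : (1 : ℝ) ≤ l := by exact_mod_cast hl
    nlinarith
  have b₃ : (S₃.ncard : ℝ) ≤ s * (pairedSet σ A L k (R + 1)).ncard := by
    refine ncard_le_of_separated hu (fun x hx => hS hx.1) hfin (fun _ => g) (fun x _ => ⟨hg, hg2⟩)
      (fun _ _ => rfl) hs fun x hx l hl hls hmem => ?_
    -- Over `l ≥ 1` steps the slope grows by at least `6 * η`, so it cannot lie strictly between `-3
    -- * η` and `3 * η` at both ends.
    have h2 := le_difference_of_convex (hconv x hx.1 l hls) (Nat.zero_le l) le_rfl
    have h3 : |h (shift u x (l • g)) 1 - h (shift u x (l • g)) 0| < 3 * η := hmem.2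
    have h5 : |h x 1 - h x 0| < 3 * η := hx.2
    rw [hstep, hstep, add_zero] at h3
    have h4 : (1 : ℝ) ≤ l := by exact_mod_cast hl
    simp only [zero_add, Nat.cast_zero, sub_zero] at h2
    nlinarith [(abs_lt.1 h3).2, (abs_lt.1 h5).1]
  have hun : S ⊆ S₁ ∪ S₂ ∪ S₃ := by
    intro x hx
    rcases le_or_gt (3 * η) (h x 1 - h x 0) with h1 | h1
    · exact .inl (.inl ⟨hx, h1⟩)
    rcases le_or_gt (h x 1 - h x 0) (-(3 * η)) with h2 | h2
    · exact .inl (.inr ⟨hx, h2⟩)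
    · exact .inr ⟨hx, abs_lt.2 ⟨h2, h1⟩⟩
  have hfS := hfin.subset hSP
  have hcard : S.ncard ≤ S₁.ncard + S₂.ncard + S₃.ncard :=
    (Set.ncard_le_ncard hun (((hfS.subset fun _ h => h.1).union (hfS.subset fun _ h => h.1)).union
      (hfS.subset fun _ h => h.1))).trans ((Set.ncard_union_le _ _).trans
        (Nat.add_le_add_right (Set.ncard_union_le _ _) _))
  have : (S.ncard : ℝ) ≤ S₁.ncard + S₂.ncard + S₃.ncard := by exact_mod_cast hcard
  linarith

/-- Gain from the smallness of a difference of brackets of moving vectors. -/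
theorem ncard_le_of_difference (hL : 0 < L) (hu : IsDirection σ A u)
    (hfin : (pairedSet σ A L k (R + 1)).Finite) {S : Set (ι → E d)}
    (hS : S ⊆ pairedSet σ A L k R) {p q : (ι → E d) → E d} {c : (ι → E d) → ℝ} {τ : ℝ}
    (hp : ∀ x v, p (shift u x v) = p x + v) (hq : ∀ x v, q (shift u x v) = q x + v)
    (hc : ∀ x v, c (shift u x v) = c x) (hτ : τ = 1 ∨ τ = -1) {B η s r : ℝ}
    (hpB : ∀ x ∈ S, ‖p x‖ ≤ B) (hqB : ∀ x ∈ S, ‖q x‖ ≤ B)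
    (hSη : ∀ x ∈ S, |c x + τ * S₀.bracket (p x) + -τ * S₀.bracket (q x)| ≤ η)
    (hr : 0 < r) (hSr : ∀ x ∈ S, r ≤ ‖p x - q x‖)
    (hs : 0 < s) (hsL : 2 * d / L ≤ s) (hη : 0 ≤ η)
    (hsη : 2 * η + 2 * (d / L) < S₀.m / (√S₀.m + 3 * B + 3) ^ 3 * r * (s / 2)) :
    (S.ncard : ℝ) ≤ s * (pairedSet σ A L k (R + 1)).ncard := by
  choose G hG hG' using fun v : E d => exists_lattice_near hL v
  set w : (ι → E d) → E d := fun x => p x - q x with hw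
  have hwinv : ∀ x v, w (shift u x v) = w x := by
    intro x v
    simp only [hw, hp, hq, add_sub_add_right_eq_sub]
  have hdL : (d : ℝ) / L ≤ s / 2 := by
    have : 2 * (d : ℝ) / L = 2 * (d / L) := by ring
    linarith
  have hw0 : ∀ x ∈ S, w x ≠ 0 := fun x hx h => by
    have := hSr x hx
    change r ≤ ‖w x‖ at this
    rw [h, norm_zero] at this
    linarith
  -- The step depends on the point: it is the lattice approximation of length about `s / 2` in the
  -- direction of `p x - q x`. This difference is unchanged by shifts, as the separation lemma
  -- requires of the step.
  refine ncard_le_of_separated hu hS hfin (fun x => G ((s / 2) • (‖w x‖⁻¹ • w x)))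
    (fun x hx => ⟨hG _, ?_⟩) (fun x v => by simp only [hwinv]) hs fun x hx l hl hls hmem => ?_
  · have h1 := hG' ((s / 2) • (‖w x‖⁻¹ • w x))
    have h2 : ‖(s / 2) • (‖w x‖⁻¹ • w x)‖ = s / 2 := by
      rw [norm_smul, norm_smul, norm_inv, norm_norm, inv_mul_cancel₀ (norm_ne_zero_iff.2 (hw0 x hx)),
        mul_one, Real.norm_eq_abs, abs_of_pos (by positivity)]
    have h3 := norm_sub_norm_le (G ((s / 2) • (‖w x‖⁻¹ • w x))) ((s / 2) • (‖w x‖⁻¹ • w x))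
    linarith
  · set g := G ((s / 2) • (‖w x‖⁻¹ • w x)) with hg
    set J := √S₀.m + 3 * B + 3 with hJ
    have hB : 0 ≤ B := (norm_nonneg _).trans (hpB x hx)
    have hJ0 : 0 < J := by have := S₀.sqrt_m_pos; positivity
    have hcc : 0 < S₀.m / J ^ 3 := div_pos S₀.m_pos (by positivity)
    have hwB : ‖w x‖ ≤ 2 * B :=
      (norm_sub_le _ _).trans (by linarith [hpB x hx, hqB x hx])
    have h1 := S₀.bracket_difference_shift (q := q x) (w := w x) (g := g) (s := s / 2)
      (c := d / L) (J := J) (l := l) (hw0 x hx) (by positivity) (hG' _)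
      (by rw [hJ]; nlinarith [hqB x hx])
    have e1 : q x + w x = p x := by simp only [hw]; abel
    rw [e1] at h1
    have h2 := hSη _ hmem
    have h3 := hSη _ hx
    rw [hc, hp, hq] at h2
    have h4 : S₀.m / J ^ 3 * r * (s / 2) ≤ S₀.m / J ^ 3 * ‖w x‖ * (s / 2) := by
      have := hSr x hx
      gcongr
    have h5 : (1 : ℝ) ≤ l := by exact_mod_cast hl
    -- The bracket difference increases by more than `2 * η`, whereas two points of `S` allow a
    -- variation of at most `2 * η`.
    have h6 : 2 * η < l * (S₀.m / J ^ 3 * ‖w x‖ * (s / 2) - 2 * (d / L)) := by nlinarith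
    rw [abs_le] at h2 h3
    rcases hτ with rfl | rfl <;> linarith [h2.1, h2.2, h3.1, h3.2]

end

/-! ### The cut-off functions -/

namespace Cutoff

variable {d : ℕ} (K : Cutoff)

theorem abs_chi_le {ε : ℝ} (hε : 0 ≤ ε) (k₁ k₂ k₃ : E d) (s : TernaryType) :
    |K.chi ε k₁ k₂ k₃ s| ≤ 2 := by
  have h : ∀ k : E d, K.χ (ε ^ (-K.γ) * ‖k‖) ∈ Set.Icc (0 : ℝ) 1 := fun k =>
    K.χ_mem _ (mul_nonneg (Real.rpow_nonneg hε _) (norm_nonneg _))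
  have key : ∀ a b c : ℝ, a ∈ Set.Icc (0 : ℝ) 1 → b ∈ Set.Icc (0 : ℝ) 1 → c ∈ Set.Icc (0 : ℝ) 1 →
      a * (1 - b) * (1 - c) ∈ Set.Icc (0 : ℝ) 1 := by
    rintro a b c ⟨ha, ha'⟩ ⟨hb, hb'⟩ ⟨hc, hc'⟩
    have h1 : 0 ≤ a * (1 - b) := mul_nonneg ha (by linarith)
    have h2 : a * (1 - b) ≤ 1 := by nlinarith
    exact ⟨mul_nonneg h1 (by linarith), by nlinarith⟩
  have hl := key _ _ _ (h (k₂ + k₃)) (h (k₂ + k₁)) (h (k₃ + k₁))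
  have hm := key _ _ _ (h (k₃ + k₁)) (h (k₃ + k₂)) (h (k₁ + k₂))
  have hr := key _ _ _ (h (k₁ + k₂)) (h (k₁ + k₃)) (h (k₂ + k₃))
  rw [abs_le]
  cases s
  · exact ⟨le_trans (by norm_num) hl.1, hl.2.trans (by norm_num)⟩
  · exact ⟨le_trans (by norm_num) hm.1, hm.2.trans (by norm_num)⟩
  · exact ⟨le_trans (by norm_num) hr.1, hr.2.trans (by norm_num)⟩
  · rw [show K.chi ε k₁ k₂ k₃ .high = 1 - _ - _ - _ from rfl]
    constructor <;> linarith [hl.1, hl.2, hm.1, hm.2, hr.1, hr.2]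

theorem norm_le_of_χ_ne_zero {ε : ℝ} (hε : 0 < ε) {k : E d} (h : K.χ (ε ^ (-K.γ) * ‖k‖) ≠ 0) :
    ‖k‖ ≤ 2 * ε ^ K.γ := by
  by_contra! hlt
  refine h (K.χ_zero _ ?_)
  have h1 : ε ^ (-K.γ) * ε ^ K.γ = 1 := by
    rw [← Real.rpow_add hε, neg_add_cancel, Real.rpow_zero]
  have h2 : 0 < ε ^ (-K.γ) := Real.rpow_pos_of_pos hε _
  nlinarith

theorem norm_le_of_low {ε : ℝ} (hε : 0 < ε) {k : Dir → E d} {s : TernaryType} (hs : s ≠ .high)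
    (h : K.chi ε (k .left) (k .mid) (k .right) s ≠ 0) :
    ‖∑ e, k e - k s.free‖ ≤ 2 * ε ^ K.γ := by
  rw [Tree.sum_dir]
  cases s
  · rw [show k .left + k .mid + k .right - k TernaryType.lowL.free = k .mid + k .right by
      simp only [TernaryType.free]; abel]
    exact K.norm_le_of_χ_ne_zero hε (left_ne_zero_of_mul (left_ne_zero_of_mul h))
  · rw [show k .left + k .mid + k .right - k TernaryType.lowM.free = k .right + k .left by
      simp only [TernaryType.free]; abel]
    exact K.norm_le_of_χ_ne_zero hε (left_ne_zero_of_mul (left_ne_zero_of_mul h))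
  · rw [show k .left + k .mid + k .right - k TernaryType.lowR.free = k .left + k .mid by
      simp only [TernaryType.free]; abel]
    exact K.norm_le_of_χ_ne_zero hε (left_ne_zero_of_mul (left_ne_zero_of_mul h))
  · exact absurd rfl hs

/-- On the support of `χ_high`, if two of the momenta cancel, another pair is small. -/
theorem exists_norm_le_of_high {ε : ℝ} (hε : 0 < ε) {k : Dir → E d}
    (h : K.chi ε (k .left) (k .mid) (k .right) .high ≠ 0) {e : Dir} (he : ∑ e', k e' - k e = 0) :
    ∃ e', e' ≠ e ∧ ‖∑ e', k e' - k e'‖ ≤ 2 * ε ^ K.γ := by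
  set a : E d → ℝ := fun k => K.χ (ε ^ (-K.γ) * ‖k‖) with ha
  have ha0 : a 0 = 1 := by
    simp only [ha, norm_zero, mul_zero]
    exact K.χ_one _ le_rfl zero_le_one
  rw [Tree.sum_dir] at he ⊢
  have e1 : k .left + k .mid + k .right - k .left = k .mid + k .right := by abel
  have e2 : k .left + k .mid + k .right - k .mid = k .right + k .left := by abel
  have e3 : k .left + k .mid + k .right - k .right = k .left + k .mid := by abel
  have hchi : K.chi ε (k .left) (k .mid) (k .right) .high
      = 1 - a (k .mid + k .right) * (1 - a (k .left + k .mid)) * (1 - a (k .right + k .left))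
        - a (k .right + k .left) * (1 - a (k .mid + k .right)) * (1 - a (k .left + k .mid))
        - a (k .left + k .mid) * (1 - a (k .right + k .left)) * (1 - a (k .mid + k .right)) := by
    rw [add_comm (k .left) (k .mid)]
    simp only [Cutoff.chi, ha, add_comm (k .right) (k .mid), add_comm (k .left) (k .right),
      add_comm (k .left) (k .mid)]
  rw [hchi] at h
  by_contra! hcon
  -- The vanishing pair has cut-off value `1`. If the other two cut-off values were `0`, one low
  -- cut-off would equal `1` and `χ_high` would vanish.
  have hz : ∀ e', e' ≠ e → a (k .left + k .mid + k .right - k e') = 0 := by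
    intro e' he'
    by_contra hne
    exact absurd (K.norm_le_of_χ_ne_zero hε hne) (not_le.2 (hcon e' he'))
  cases e
  · have h2 := hz .mid (by simp)
    have h3 := hz .right (by simp)
    rw [e1] at he
    rw [e2] at h2
    rw [e3] at h3
    rw [he, ha0, h2, h3] at h
    norm_num at h
  · have h2 := hz .left (by simp)
    have h3 := hz .right (by simp)
    rw [e2] at he
    rw [e1] at h2
    rw [e3] at h3
    rw [he, ha0, h2, h3] at h
    norm_num at h
  · have h2 := hz .left (by simp)
    have h3 := hz .mid (by simp)
    rw [e3] at he
    rw [e1] at h2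
    rw [e2] at h3
    rw [he, ha0, h2, h3] at h
    norm_num at h

end Cutoff

/-! ### Node factors -/

namespace SCTree

variable {d : ℕ} (S : System d) (K : Cutoff) (T : SCTree)

theorem kind_cases_node {k : Kind} (hk : k.isNode = true) :
    k = .binIn ∨ k = .binSt ∨ ∃ s, k = .ter s := by
  cases k <;> simp [Kind.isNode] at hk ⊢

theorem phase_binary {κ : T.tree.Vertex → E d} {j : T.tree.Vertex} (hj : j.kind.isBinary = true) :
    T.phase S κ j = sgn (T.sign j) * S.bracket (κ j) -
      (sgn (T.sign (j.child .left)) * S.bracket (κ (j.child .left))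
        + sgn (T.sign (j.child .right)) * S.bracket (κ (j.child .right))) := by
  rw [phase, Tree.sum_children_binary hj]

theorem decoration_binary {κ : T.tree.Vertex → E d} (hκ : Tree.IsDecoration κ)
    {j : T.tree.Vertex} (hj : j.kind.isBinary = true) :
    κ j = κ (j.child .left) + κ (j.child .right) := by
  rw [hκ j ((Tree.isNode_iff _).2 (.inl hj)), Tree.sum_children_binary hj]

theorem decoration_ternary {κ : T.tree.Vertex → E d} (hκ : Tree.IsDecoration κ)
    {j : T.tree.Vertex} (hj : j.kind.isTernary = true) :
    κ j = ∑ e, κ (j.child e) := by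
  rw [hκ j ((Tree.isNode_iff _).2 (.inr hj)), Tree.sum_children_ternary hj]

/-- Node factors vanish at zero total momentum. -/
theorem q_eq_zero {ε : ℝ} {κ : T.tree.Vertex → E d} (hκ : Tree.IsDecoration κ)
    {j : T.tree.Vertex} (hj : j.kind.isNode = true) (h0 : κ j = 0) : T.q S K ε κ j = 0 := by
  unfold q
  rcases kind_cases_node hj with h | h | ⟨s, h⟩
  · have hb : j.kind.isBinary = true := by rw [h]; rfl
    rw [h]
    simp only
    rw [S.q2_eq_zero _ ((T.decoration_binary hκ hb).symm.trans h0), zero_div, mul_zero]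
  · have hb : j.kind.isBinary = true := by rw [h]; rfl
    rw [h]
    simp only
    rw [S.q2_eq_zero _ ((T.decoration_binary hκ hb).symm.trans h0), zero_div, mul_zero]
  · have ht : j.kind.isTernary = true := by rw [h]; rfl
    have h1 := (T.decoration_ternary hκ ht).symm.trans h0
    rw [Tree.sum_dir] at h1
    rw [h]
    simp only
    rw [System.q3, S.q2_eq_zero (T.colour j) (k₁ := κ (j.child .left) + κ (j.child .right))
      (k₂ := κ (j.child .mid)) (by rw [← h1]; abel), mul_zero, mul_zero]

theorem norm_sgn (ι : ℤˣ) : ‖((sgn ι : ℝ) : ℂ)‖ = 1 := by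
  rcases System.sgn_eq ι with h | h <;> simp [h]

/-- Node factors are bounded. -/
theorem exists_q_bound : ∃ B : ℝ, 1 ≤ B ∧ ∀ (T : SCTree) (ε : ℝ), 0 ≤ ε →
    ∀ κ : T.tree.Vertex → E d, Tree.IsDecoration κ →
      ∀ j : T.tree.Vertex, j.kind.isNode = true → ‖T.q S K ε κ j‖ ≤ B := by
  obtain ⟨B, hB0, hB⟩ := S.exists_Q_bound
  have hr := S.sqrt_m_pos
  have hm := S.m_pos
  refine ⟨1 + B * 4 / √S.m ^ 3 + 2 * (4 * B ^ 2 / (S.m * √S.m ^ 3)), ?_, ?_⟩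
  · have : 0 ≤ B * 4 / √S.m ^ 3 := by positivity
    have : 0 ≤ 2 * (4 * B ^ 2 / (S.m * √S.m ^ 3)) := by positivity
    linarith
  intro T ε hε κ hκ j hj
  have hbin : j.kind.isBinary = true →
      ‖S.q2 (T.colour j) (κ (j.child .left)) (κ (j.child .right)) / ((T.phase S κ j : ℝ) : ℂ)‖
        ≤ B * 4 / √S.m ^ 3 := by
    intro hb
    have h1 := S.le_abs_phase_mul (T.sign j) (T.sign (j.child .left)) (T.sign (j.child .right))
      (T.decoration_binary hκ hb)
    rw [← T.phase_binary S hb] at h1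
    have h2 := S.bracket_pos (κ (j.child .left))
    have h3 := S.bracket_pos (κ (j.child .right))
    rw [norm_div, Complex.norm_real, Real.norm_eq_abs]
    have h4 : 0 < |T.phase S κ j| := by
      by_contra! hle
      have : |T.phase S κ j| * (S.bracket (κ (j.child .left)) * S.bracket (κ (j.child .right))) ≤ 0 :=
        mul_nonpos_of_nonpos_of_nonneg hle (by positivity)
      have h5 : 0 < √S.m ^ 3 / 4 := by positivity
      linarith
    rw [div_le_iff₀ h4]
    refine (S.norm_q2_le hB _ _ _).trans ?_
    rw [div_le_iff₀ (by positivity)]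
    calc B = B * 4 / √S.m ^ 3 * (√S.m ^ 3 / 4) := by field_simp
      _ ≤ B * 4 / √S.m ^ 3 * (|T.phase S κ j| *
          (S.bracket (κ (j.child .left)) * S.bracket (κ (j.child .right)))) := by gcongr
      _ = _ := by ring
  have p1 : 0 ≤ B * 4 / √S.m ^ 3 := by positivity
  have p2 : 0 ≤ 2 * (4 * B ^ 2 / (S.m * √S.m ^ 3)) := by positivity
  unfold q
  rcases kind_cases_node hj with h | h | ⟨s, h⟩
  · have := hbin (by rw [h]; rfl)
    rw [h]
    simp only
    rw [norm_mul, norm_neg, norm_sgn, one_mul]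
    linarith
  · have := hbin (by rw [h]; rfl)
    have hdel : T.delta S κ j = T.phase S κ j := by
      rw [delta, if_neg]
      rw [h]
      simp
    rw [h]
    simp only
    rw [norm_mul, norm_sgn, one_mul, hdel]
    linarith
  · rw [h]
    simp only
    rw [norm_mul, norm_mul, norm_sgn, one_mul, Complex.norm_real, Real.norm_eq_abs]
    have h1 := mul_le_mul (K.abs_chi_le hε (κ (j.child .left)) (κ (j.child .mid))
      (κ (j.child .right)) s) (S.norm_q3_le hB0 hB (T.colour j) (T.sign j * T.sign (j.child .mid))
        (κ (j.child .left)) (κ (j.child .mid)) (κ (j.child .right))) (norm_nonneg _) (by norm_num)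
    linarith

theorem chi_ne_zero_of_q_ne_zero {ε : ℝ} {κ : T.tree.Vertex → E d} {j : T.tree.Vertex}
    {s : TernaryType} (hs : j.kind = .ter s) (h : T.q S K ε κ j ≠ 0) :
    K.chi ε (κ (j.child .left)) (κ (j.child .mid)) (κ (j.child .right)) s ≠ 0 := by
  intro h0
  apply h
  unfold q
  rw [hs]
  simp only
  rw [h0, Complex.ofReal_zero, mul_zero, zero_mul]

end SCTree

namespace System

variable {d : ℕ} (S : System d)

/-- The constant in the oscillatory gains. -/
noncomputable def gainConst : ℝ :=
  (32 + 4 * d) * ((√S.m + 3 * S.R + 3) ^ 3 / S.m) + (2 + 2 * d)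

theorem gainConst_pos : 0 < S.gainConst := by
  have := S.m_pos
  have := S.R_pos
  unfold gainConst
  positivity

end System

section

variable {ι : Type*} {σ : ι → ι} {A : Finset ι} {d : ℕ} {L : ℝ} {k : E d} {u : ι → ℤ}

/-- Gain from the smallness of a combination of the brackets of two moving vectors. -/
theorem ncard_le_of_oscillation (S₀ : System d) (hd : 1 ≤ d) (hL : 0 < L)
    (hu : IsDirection σ A u) (hfin : (pairedSet σ A L k (S₀.R + 1)).Finite) {S : Set (ι → E d)}
    (hS : S ⊆ pairedSet σ A L k S₀.R) {p q : (ι → E d) → E d} {c : (ι → E d) → ℝ} {τ τ' : ℝ}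
    (hp : ∀ x v, p (shift u x v) = p x + v) (hq : ∀ x v, q (shift u x v) = q x + v)
    (hc : ∀ x v, c (shift u x v) = c x) (hτ : τ = 1 ∨ τ = -1) (hτ' : τ' = 1 ∨ τ' = -1)
    {N ε : ℝ} (hN : 1 ≤ N) (hε : 0 < ε) (hε1 : ε ≤ 1) (hLε : 1 / L ≤ ε)
    (hpB : ∀ x ∈ S, ‖p x‖ ≤ N * S₀.R) (hqB : ∀ x ∈ S, ‖q x‖ ≤ N * S₀.R)
    (hSη : ∀ x ∈ S, |c x + τ * S₀.bracket (p x) + τ' * S₀.bracket (q x)| ≤ ε ^ (1 / 2 : ℝ))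
    (hττ : τ = τ' ∨ ∀ x ∈ S, ε ^ (1 / 4 : ℝ) ≤ ‖p x - q x‖) :
    (S.ncard : ℝ) ≤ 3 * (S₀.gainConst * N ^ 3 * ε ^ (1 / 4 : ℝ))
      * (pairedSet σ A L k (S₀.R + 1)).ncard := by
  have hm := S₀.m_pos
  have hR := S₀.R_pos
  have hC := S₀.gainConst_pos
  have hsq := S₀.sqrt_m_pos
  set C := S₀.gainConst with hCdef
  set J₀ := √S₀.m + 3 * S₀.R + 3 with hJ₀
  have hJ₀pos : 0 < J₀ := by positivity
  set D := J₀ ^ 3 / S₀.m with hD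
  have hDpos : 0 < D := by positivity
  set δ := ε ^ (1 / 4 : ℝ) with hδ
  have hδpos : 0 < δ := Real.rpow_pos_of_pos hε _
  have hδ1 : δ ≤ 1 := Real.rpow_le_one hε.le hε1 (by norm_num)
  have hδ2 : ε ^ (1 / 2 : ℝ) = δ ^ 2 := by
    rw [hδ, ← Real.rpow_natCast, ← Real.rpow_mul hε.le]
    norm_num
  have hδ4 : ε = δ ^ 4 := by
    rw [hδ, ← Real.rpow_natCast, ← Real.rpow_mul hε.le]
    norm_num
  have hεδ2 : ε ≤ δ ^ 2 := by
    rw [hδ4]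
    exact pow_le_pow_of_le_one hδpos.le hδ1 (by norm_num)
  have hεδ : ε ≤ δ := by
    rw [hδ4]
    exact (pow_le_pow_of_le_one hδpos.le hδ1 (by norm_num : 1 ≤ 4)).trans (by rw [pow_one])
  have hN3 : 1 ≤ N ^ 3 := one_le_pow₀ hN
  -- With `δ = ε ^ (1/4)`, the admissible phase is `δ²`, the minimal separation of the arguments is
  -- `δ`, and the lattice error `1 / L` is at most `δ⁴`. Both hypotheses then balance at a step
  -- proportional to `δ`; `N ^ 3` compensates the cube of the momentum bound.
  set s := C * N ^ 3 * δ with hs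
  have hspos : 0 < s := by positivity
  have hC1 : (2 + 2 * d : ℝ) ≤ C := by
    rw [hCdef, System.gainConst]
    have : 0 ≤ (32 + 4 * (d : ℝ)) * (J₀ ^ 3 / S₀.m) := by positivity
    linarith
  have hC2 : (32 + 4 * d : ℝ) * D ≤ C := by
    rw [hCdef, System.gainConst]
    have : 0 ≤ (d : ℝ) := by positivity
    linarith
  have hCs : C * δ ≤ s := by
    rw [hs]
    have : C * 1 ≤ C * N ^ 3 := mul_le_mul_of_nonneg_left hN3 hC.le
    nlinarith
  have hd0 : (0 : ℝ) ≤ d := by positivity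
  have hLδ : (2 + 2 * (d : ℝ)) * (1 / L) ≤ s := by
    calc (2 + 2 * (d : ℝ)) * (1 / L) ≤ C * δ :=
          mul_le_mul hC1 (hLε.trans hεδ) (by positivity) hC.le
      _ ≤ s := hCs
  have hL0 : 0 < 1 / L := by positivity
  have hcc : 1 / (D * N ^ 3) ≤ S₀.m / (√S₀.m + 3 * (N * S₀.R) + 3) ^ 3 := by
    have h1 : √S₀.m + 3 * (N * S₀.R) + 3 ≤ J₀ * N := by
      rw [hJ₀]
      nlinarith
    have h2 : (√S₀.m + 3 * (N * S₀.R) + 3) ^ 3 ≤ (J₀ * N) ^ 3 :=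
      pow_le_pow_left₀ (by positivity) h1 3
    calc 1 / (D * N ^ 3) = S₀.m / (J₀ * N) ^ 3 := by
          rw [hD]
          field_simp
      _ ≤ _ := div_le_div_of_nonneg_left hm.le (by positivity) h2
  have hDs : (32 + 4 * (d : ℝ)) * δ ≤ 1 / (D * N ^ 3) * s := by
    have : 1 / (D * N ^ 3) * s = C / D * δ := by
      rw [hs]
      field_simp
    rw [this]
    have : (32 + 4 * (d : ℝ)) ≤ C / D := by
      rw [le_div_iff₀ hDpos]
      exact hC2
    gcongr
  have hP : (0 : ℝ) ≤ (pairedSet σ A L k (S₀.R + 1)).ncard := by positivity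
  by_cases hτeq : τ = τ'
  · subst hτeq
    refine ncard_le_of_convex S₀ hd hL hu hfin hS hp hq hc hτ (B := N * S₀.R)
      (η := ε ^ (1 / 2 : ℝ)) hpB hqB (Real.rpow_pos_of_pos hε _) hSη hspos ?_ ?_
    · have : 2 / L = 2 * (1 / L) := by ring
      nlinarith
    · rw [hδ2]
      have h1 : (2 : ℝ) * δ ≤ s := by nlinarith
      have h2 : δ * δ ≤ δ * s := mul_le_mul_of_nonneg_left (by linarith) hδpos.le
      have h3 : 0 ≤ (d : ℝ) * (δ * s) := by positivity
      calc 24 * δ ^ 2 ≤ (32 + 4 * (d : ℝ)) * δ * s := by linarith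
        _ ≤ 1 / (D * N ^ 3) * s * s := by gcongr
        _ = 1 / (D * N ^ 3) * s ^ 2 := by ring
        _ ≤ _ := by gcongr
  · have hττ' := hττ.resolve_left hτeq
    have hneg : τ' = -τ := by
      rcases hτ with rfl | rfl <;> rcases hτ' with rfl | rfl <;> simp at hτeq ⊢
    subst hneg
    have := ncard_le_of_difference S₀ hL hu hfin hS hp hq hc hτ (B := N * S₀.R)
      (η := ε ^ (1 / 2 : ℝ)) (r := δ) (s := s) hpB hqB hSη hδpos hττ' hspos ?_
      (Real.rpow_nonneg hε.le _) ?_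
    · refine this.trans (mul_le_mul_of_nonneg_right (by linarith) hP)
    · have : 2 * (d : ℝ) / L = 2 * d * (1 / L) := by ring
      nlinarith
    · rw [hδ2]
      calc 2 * δ ^ 2 + 2 * ((d : ℝ) / L) = 2 * δ ^ 2 + 2 * d * (1 / L) := by ring
        _ ≤ 2 * δ ^ 2 + 2 * d * δ ^ 2 := by
            have := mul_le_mul_of_nonneg_left (hLε.trans hεδ2) (mul_nonneg zero_le_two hd0)
            linarith
        _ < (32 + 4 * (d : ℝ)) * δ * (δ / 2) := by
            have h1 : (32 + 4 * (d : ℝ)) * δ * (δ / 2) = 16 * δ ^ 2 + 2 * d * δ ^ 2 := by ring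
            have h2 : 0 < δ ^ 2 := by positivity
            linarith
        _ ≤ 1 / (D * N ^ 3) * s * (δ / 2) := by gcongr
        _ = 1 / (D * N ^ 3) * δ * (s / 2) := by ring
        _ ≤ _ := by gcongr

end

/-! ### Few decorations at a non-resonant node. -/

namespace Coupling

variable (C : Coupling) {d : ℕ}

/-- The vertex values of the decoration with given leaf values. -/
noncomputable def val (x : C.Leaf → E d) (i : Fin 2) (v : (C.part i).tree.Vertex) : E d :=
  ∑ ℓ ∈ C.below i v, x ℓ

theorem val_shift (u : C.Leaf → ℤ) (x : C.Leaf → E d) (w : E d) (i : Fin 2)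
    (v : (C.part i).tree.Vertex) :
    C.val (shift u x w) i v = C.val x i v + (∑ ℓ ∈ C.below i v, u ℓ) • w :=
  sum_shift _ _ _ _

theorem sum_below_ternary {M : Type*} [AddCommMonoid M] {i : Fin 2} {j : (C.part i).tree.Vertex}
    (hj : j.kind.isTernary = true) (f : C.Leaf → M) :
    ∑ ℓ ∈ C.below i j, f ℓ = ∑ e, ∑ ℓ ∈ C.below i (j.child e), f ℓ := by
  simp only [sum_below]
  rw [Tree.sum_leavesBelow_node ((Tree.isNode_iff _).2 (.inr hj)), Tree.sum_children_ternary hj]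

theorem child_le {i : Fin 2} {j : (C.part i).tree.Vertex} (hj : j.kind.isTernary = true)
    (e : Dir) : j.child e ≤ j := (Tree.child_lt_of_mem (child_mem hj e)).le

theorem sum_others {i : Fin 2} {j : (C.part i).tree.Vertex} (hj : j.kind.isTernary = true)
    (e : Dir) (x : C.Leaf → E d) :
    ∑ ℓ ∈ C.others i j e, x ℓ = C.val x i j - C.val x i (j.child e) := by
  classical
  rw [others, eq_sub_iff_add_eq]
  exact Finset.sum_sdiff (C.below_mono (C.child_le hj e))

theorem card_leaf : Fintype.card C.Leaf = C.n + 2 := by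
  rw [Fintype.card_sigma, n, Fin.sum_univ_two, Fin.sum_univ_two, Tree.card_leaf, Tree.card_leaf]
  ring

/-- The leaves of the first tree. -/
noncomputable def firstLeaves : Finset C.Leaf :=
  Finset.univ.filter fun ℓ => ℓ.1 = 0

/-- The admissible leaf values in a ball. -/
def leafSet (L : ℝ) (k : E d) (ρ : ℝ) : Set (C.Leaf → E d) :=
  pairedSet C.σ C.firstLeaves L k ρ

theorem norm_val_le {L : ℝ} {k : E d} {ρ : ℝ} (hρ : 0 ≤ ρ) {x : C.Leaf → E d}
    (hx : x ∈ C.leafSet L k ρ) (i : Fin 2) (v : (C.part i).tree.Vertex) :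
    ‖C.val x i v‖ ≤ ((C.n + 2 : ℕ) : ℝ) * ρ := by
  refine (norm_sum_le_of_le _ fun ℓ _ => (hx.2.2 ℓ).2).trans ?_
  rw [Finset.sum_const, nsmul_eq_mul, ← C.card_leaf]
  gcongr
  exact Finset.card_le_univ _

/-- The phase of a ternary node in terms of the leaf values. -/
noncomputable def ternaryPhase (S : System d) (i : Fin 2) (j : (C.part i).tree.Vertex)
    (x : C.Leaf → E d) : ℝ :=
  sgn ((C.part i).sign j) * S.bracket (C.val x i j)
    - ∑ e, sgn ((C.part i).sign (j.child e)) * S.bracket (C.val x i (j.child e))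

theorem odd_card_below (hB : ∀ (i : Fin 2) (v : (C.part i).tree.Vertex), ¬ v.kind.isBinary = true)
    (i : Fin 2) (v : (C.part i).tree.Vertex) : Odd (C.below i v).card := by
  rw [card_below]
  exact Tree.odd_card_leavesBelow (hB i) v

/-- Removing the odd set below one child from the odd set below the node leaves an even set, inside
the odd set of all leaves of the tree: this is the parity that `exists_direction_linear` requires.
-/
theorem exists_direction_of_not_closed
    (hB : ∀ (i : Fin 2) (v : (C.part i).tree.Vertex), ¬ v.kind.isBinary = true)
    {i : Fin 2} {j : (C.part i).tree.Vertex} (hj : j.kind.isTernary = true) {e : Dir}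
    (h : ¬ C.IsClosed (C.others i j e)) :
    ∃ u, IsDirection C.σ C.firstLeaves u ∧ ∑ ℓ ∈ C.others i j e, u ℓ = 1 := by
  classical
  refine exists_direction_linear C.involutive C.σ_ne (fun ℓ => ℓ.1) (i := i)
    (T := C.below i (C.part i).tree.root) (fun ℓ => C.mem_below_root) ?_ ?_
    (C.odd_card_below hB _ _) h
  · exact Finset.sdiff_subset.trans (C.below_mono List.nil_prefix)
  · rw [others, Finset.card_sdiff_of_subset (C.below_mono (C.child_le hj e))]
    exact Nat.Odd.sub_odd (C.odd_card_below hB _ _) (C.odd_card_below hB _ _)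

theorem ncard_le_of_not_closed
    (hB : ∀ (i : Fin 2) (v : (C.part i).tree.Vertex), ¬ v.kind.isBinary = true)
    (hd : 1 ≤ d) {L : ℝ} (hL : 0 < L) {k : E d} {R : ℝ}
    (hfin : (C.leafSet L k (R + 1)).Finite)
    {i : Fin 2} {j : (C.part i).tree.Vertex} (hj : j.kind.isTernary = true) {e : Dir}
    (h : ¬ C.IsClosed (C.others i j e)) {X : Set (C.Leaf → E d)} (hX : X ⊆ C.leafSet L k R)
    {r : ℝ} (hr : 0 ≤ r) (hXr : ∀ x ∈ X, ‖C.val x i j - C.val x i (j.child e)‖ ≤ r) :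
    (X.ncard : ℝ) ≤ (2 * r + 1 / L) * (C.leafSet L k (R + 1)).ncard := by
  obtain ⟨u, hu, hu1⟩ := C.exists_direction_of_not_closed hB hj h
  exact ncard_le_of_linear hd hL hu hfin hu1 hX hr fun x hx => by
    rw [C.sum_others hj]; exact hXr x hx

theorem below_child_disjoint {i : Fin 2} {j : (C.part i).tree.Vertex}
    (hj : j.kind.isTernary = true) (e e' : Dir) (hne : e ≠ e') :
    ∀ ℓ ∈ C.below i (j.child e), ℓ ∉ C.below i (j.child e') := by
  intro ℓ h h'
  obtain ⟨ℓ', hle, rfl⟩ := C.mem_below.1 h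
  obtain ⟨ℓ'', hle', heq⟩ := C.mem_below.1 h'
  obtain rfl := sigma_mk_injective heq
  exact hne (Tree.child_injective hj
    (Tree.child_unique (child_mem hj e) (child_mem hj e') hle hle'))

theorem sgn_cases (ι : ℤˣ) : -sgn ι = 1 ∨ -sgn ι = -1 := by
  rcases System.sgn_eq ι with h | h <;> simp [h]

theorem sum_dir_eq {a b : Dir} (hab : a ≠ b) : ∃ c, c ≠ a ∧ c ≠ b ∧
    ∀ {M : Type} [AddCommMonoid M] (f : Dir → M), ∑ e, f e = f a + f b + f c := by
  cases a <;> cases b <;> first | exact absurd rfl hab | skip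
  · exact ⟨.right, by simp, by simp, fun f => by rw [Tree.sum_dir]⟩
  · exact ⟨.mid, by simp, by simp, fun f => by rw [Tree.sum_dir]; abel⟩
  · exact ⟨.right, by simp, by simp, fun f => by rw [Tree.sum_dir]; abel⟩
  · exact ⟨.left, by simp, by simp, fun f => by rw [Tree.sum_dir]; abel⟩
  · exact ⟨.mid, by simp, by simp, fun f => by rw [Tree.sum_dir]; abel⟩
  · exact ⟨.left, by simp, by simp, fun f => by rw [Tree.sum_dir]; abel⟩

/-- Gain when two children of a ternary node move in opposite directions. -/
theorem ncard_le_of_children (S : System d) (hd : 1 ≤ d) {L ε : ℝ} (hL : 0 < L) (hε : 0 < ε)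
    (hε1 : ε ≤ 1) (hLε : 1 / L ≤ ε) {k : E d} (hfin : (C.leafSet L k (S.R + 1)).Finite)
    {i : Fin 2} {j : (C.part i).tree.Vertex} (hj : j.kind.isTernary = true)
    {u : C.Leaf → ℤ} (hu : IsDirection C.σ C.firstLeaves u) {a b : Dir} (hab : a ≠ b)
    (huY : ∀ e, ∑ ℓ ∈ C.below i (j.child e), u ℓ = (if e = a then 1 else 0) - (if e = b then 1 else 0))
    {X : Set (C.Leaf → E d)} (hX : X ⊆ C.leafSet L k S.R)
    (hXη : ∀ x ∈ X, |C.ternaryPhase S i j x| ≤ ε ^ (1 / 2 : ℝ))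
    (h : (C.part i).sign (j.child a) = (C.part i).sign (j.child b) ∨
      ∀ x ∈ X, ∀ e, ε ^ (1 / 4 : ℝ) ≤ ‖C.val x i j - C.val x i (j.child e)‖) :
    (X.ncard : ℝ) ≤ 3 * (S.gainConst * ((C.n + 2 : ℕ) : ℝ) ^ 3 * ε ^ (1 / 4 : ℝ))
      * (C.leafSet L k (S.R + 1)).ncard := by
  obtain ⟨c, hca, hcb, hsum⟩ := sum_dir_eq hab
  have hval : ∀ x : C.Leaf → E d, C.val x i j = ∑ e, C.val x i (j.child e) := fun x =>
    C.sum_below_ternary hj x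
  have huj : ∑ ℓ ∈ C.below i j, u ℓ = 0 := by
    rw [C.sum_below_ternary hj, hsum, huY, huY, huY]
    simp [hab, hab.symm, hca, hcb]
  -- The momentum of `b` is negated, which the even bracket does not see, so that both arguments
  -- move by the same vector. The node and its third child do not move, and `p - q` is the node
  -- momentum minus that of the third child.
  refine ncard_le_of_oscillation S hd hL hu hfin hX
    (p := fun x => C.val x i (j.child a)) (q := fun x => -C.val x i (j.child b))
    (c := fun x => sgn ((C.part i).sign j) * S.bracket (C.val x i j)
      - sgn ((C.part i).sign (j.child c)) * S.bracket (C.val x i (j.child c)))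
    (τ := -sgn ((C.part i).sign (j.child a))) (τ' := -sgn ((C.part i).sign (j.child b)))
    ?_ ?_ ?_ (sgn_cases _) (sgn_cases _) (N := ((C.n + 2 : ℕ) : ℝ)) ?_ hε hε1 hLε ?_ ?_ ?_ ?_
  · intro x v
    simp only [C.val_shift, huY]
    simp [hab]
  · intro x v
    simp only [C.val_shift, huY]
    simp [hab.symm]
    abel
  · intro x v
    simp only [C.val_shift, huY, huj]
    simp [hca, hcb]
  · push_cast
    linarith [Nat.cast_nonneg (α := ℝ) C.n]
  · exact fun x hx => C.norm_val_le S.R_pos.le (hX hx) i _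
  · exact fun x hx => (norm_neg _).trans_le (C.norm_val_le S.R_pos.le (hX hx) i _)
  · intro x hx
    have h1 := hXη x hx
    rw [ternaryPhase, hsum] at h1
    simp only [S.bracket_neg]
    convert h1 using 2
    ring
  · rcases h with h | h
    · exact .inl (by rw [h])
    · refine .inr fun x hx => ?_
      have h1 := h x hx c
      rw [hval x, hsum] at h1
      convert h1 using 2
      abel

/-- Gain when a ternary node and one of its children move together. -/
theorem ncard_le_of_child (S : System d) (hd : 1 ≤ d) {L ε : ℝ} (hL : 0 < L) (hε : 0 < ε)
    (hε1 : ε ≤ 1) (hLε : 1 / L ≤ ε) {k : E d} (hfin : (C.leafSet L k (S.R + 1)).Finite)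
    {i : Fin 2} {j : (C.part i).tree.Vertex} (hj : j.kind.isTernary = true)
    {u : C.Leaf → ℤ} (hu : IsDirection C.σ C.firstLeaves u) {a : Dir}
    (huY : ∀ e, ∑ ℓ ∈ C.below i (j.child e), u ℓ = if e = a then 1 else 0)
    {X : Set (C.Leaf → E d)} (hX : X ⊆ C.leafSet L k S.R)
    (hXη : ∀ x ∈ X, |C.ternaryPhase S i j x| ≤ ε ^ (1 / 2 : ℝ))
    (h : ∀ x ∈ X, ∀ e, ε ^ (1 / 4 : ℝ) ≤ ‖C.val x i j - C.val x i (j.child e)‖) :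
    (X.ncard : ℝ) ≤ 3 * (S.gainConst * ((C.n + 2 : ℕ) : ℝ) ^ 3 * ε ^ (1 / 4 : ℝ))
      * (C.leafSet L k (S.R + 1)).ncard := by
  have huj : ∑ ℓ ∈ C.below i j, u ℓ = 1 := by
    rw [C.sum_below_ternary hj]
    simp only [huY]
    simp
  refine ncard_le_of_oscillation S hd hL hu hfin hX
    (p := fun x => C.val x i j) (q := fun x => C.val x i (j.child a))
    (c := fun x => - ∑ e ∈ Finset.univ.erase a,
      sgn ((C.part i).sign (j.child e)) * S.bracket (C.val x i (j.child e)))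
    (τ := sgn ((C.part i).sign j)) (τ' := -sgn ((C.part i).sign (j.child a)))
    ?_ ?_ ?_ (System.sgn_eq _) (sgn_cases _) (N := ((C.n + 2 : ℕ) : ℝ)) ?_ hε hε1 hLε ?_ ?_ ?_ ?_
  · intro x v
    simp only [C.val_shift, huj, one_smul]
  · intro x v
    simp only [C.val_shift, huY, if_true, one_smul]
  · intro x v
    refine neg_inj.2 (Finset.sum_congr rfl fun e he => ?_)
    rw [C.val_shift, huY, if_neg (Finset.ne_of_mem_erase he), zero_smul, add_zero]
  · push_cast
    linarith [Nat.cast_nonneg (α := ℝ) C.n]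
  · exact fun x hx => C.norm_val_le S.R_pos.le (hX hx) i _
  · exact fun x hx => C.norm_val_le S.R_pos.le (hX hx) i _
  · intro x hx
    have h1 := hXη x hx
    rw [ternaryPhase, ← Finset.add_sum_erase _ _ (Finset.mem_univ a)] at h1
    convert h1 using 2
    ring
  · exact .inr fun x hx => h x hx a

end Coupling

namespace Coupling

variable (C : Coupling) {d : ℕ}

theorem sum_eq_zero_of_closed {L : ℝ} {k : E d} {ρ : ℝ} {x : C.Leaf → E d}
    (hx : x ∈ C.leafSet L k ρ) {X : Finset C.Leaf} (hX : C.IsClosed X) : ∑ ℓ ∈ X, x ℓ = 0 :=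
  Finset.sum_involution (fun ℓ _ => C.σ ℓ) (fun ℓ _ => hx.1 ℓ) (fun ℓ _ _ => C.σ_ne ℓ) hX
    (fun ℓ _ => C.involutive ℓ)

theorem dir_eq_of_ne {a b c e : Dir} (hab : a ≠ b) (hca : c ≠ a) (hcb : c ≠ b) (h₁ : e ≠ c)
    (h₂ : e ≠ a) : e = b := by
  cases a <;> cases b <;> cases c <;> cases e <;> simp_all

theorem mem_below_child_of_others {i : Fin 2} {j : (C.part i).tree.Vertex}
    (hj : j.kind.isTernary = true) {a b c : Dir} (hab : a ≠ b) (hca : c ≠ a) (hcb : c ≠ b)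
    {ℓ : C.Leaf} (h : ℓ ∈ C.others i j c) (h' : ℓ ∉ C.below i (j.child a)) :
    ℓ ∈ C.below i (j.child b) := by
  obtain ⟨e, he, hl⟩ := (C.mem_others_iff hj).1 h
  obtain rfl := dir_eq_of_ne hab hca hcb he (fun h => h' (h ▸ hl))
  exact hl

/-- At most one pair of children of a ternary node is coupled in itself. -/
theorem not_closed_of_closed
    (hB : ∀ (i : Fin 2) (v : (C.part i).tree.Vertex), ¬ v.kind.isBinary = true)
    {i : Fin 2} {j : (C.part i).tree.Vertex} (hj : j.kind.isTernary = true) {e e' : Dir}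
    (hne : e' ≠ e) (h : C.IsClosed (C.others i j e)) : ¬ C.IsClosed (C.others i j e') := by
  intro h'
  obtain ⟨c, hce, hce', -⟩ := sum_dir_eq hne.symm
  -- The third child `c` has an odd number of leaves, so one of them is paired outside `c`.
  -- Stability of both pairs of children would put its partner below `e'` and below `e` at once.
  obtain ⟨ℓ, h1, h2⟩ := exists_not_mem_of_odd C.involutive C.σ_ne
    (C.odd_card_below hB i (j.child c))
  have h3 := h ℓ ((C.mem_others_iff hj).2 ⟨c, hce, h1⟩)
  have h4 := h' ℓ ((C.mem_others_iff hj).2 ⟨c, hce', h1⟩)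
  have h5 := C.mem_below_child_of_others hj hce' hce.symm hne.symm h3 h2
  have h6 := C.mem_below_child_of_others hj hce hce'.symm hne h4 h2
  exact C.below_child_disjoint hj e' e hne _ h5 h6

theorem ncard_le_four {X : Type*} {S : Set X} (hS : S.Finite) (Y : Dir → Set X) (Z : Set X)
    (hY : ∀ e, Y e ⊆ S) (hZ : Z ⊆ S) (h : ∀ x ∈ S, (∃ e, x ∈ Y e) ∨ x ∈ Z) :
    (S.ncard : ℝ) ≤ (Y .left).ncard + (Y .mid).ncard + (Y .right).ncard + Z.ncard := by
  have hun : S ⊆ Y .left ∪ Y .mid ∪ Y .right ∪ Z := by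
    intro x hx
    rcases h x hx with ⟨e, he⟩ | hz
    · cases e
      · exact .inl (.inl (.inl he))
      · exact .inl (.inl (.inr he))
      · exact .inl (.inr he)
    · exact .inr hz
  have hfin : (Y .left ∪ Y .mid ∪ Y .right ∪ Z).Finite :=
    (((hS.subset (hY _)).union (hS.subset (hY _))).union (hS.subset (hY _))).union (hS.subset hZ)
  have h1 := Set.ncard_le_ncard hun hfin
  have h2 := Set.ncard_union_le (Y .left ∪ Y .mid ∪ Y .right) Z
  have h3 := Set.ncard_union_le (Y .left ∪ Y .mid) (Y .right)
  have h4 := Set.ncard_union_le (Y .left) (Y .mid)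
  have : S.ncard ≤ (Y .left).ncard + (Y .mid).ncard + (Y .right).ncard + Z.ncard := by omega
  exact_mod_cast this

/-- A coupling without binary nodes and with a nonresonant node has a ternary node at which the
decorations satisfying the cut-off and near-resonance conditions are few. -/
theorem exists_gain (hB : ∀ (i : Fin 2) (v : (C.part i).tree.Vertex), ¬ v.kind.isBinary = true)
    (hres : ∃ j : C.Node, ¬ C.IsResonant j) (S : System d) (K : Cutoff) (hd : 1 ≤ d) :
    ∃ (i : Fin 2) (j : (C.part i).tree.Vertex) (s : TernaryType), j.kind = .ter s ∧
      ∀ (L ε : ℝ) (k : E d), 0 < L → 0 < ε → ε ≤ 1 → 1 / L ≤ ε →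
        (C.leafSet L k (S.R + 1)).Finite →
        ∀ X ⊆ C.leafSet L k S.R,
          (∀ x ∈ X, K.chi ε (C.val x i (j.child .left)) (C.val x i (j.child .mid))
            (C.val x i (j.child .right)) s ≠ 0) →
          (∀ x ∈ X, |C.ternaryPhase S i j x| ≤ ε ^ (1 / 2 : ℝ)) →
          (X.ncard : ℝ) ≤ (3 * S.gainConst + 15 + 1 / √S.m) * ((C.n + 2 : ℕ) : ℝ) ^ 3
            * ε ^ (min K.γ (1 / 4)) * (C.leafSet L k (S.R + 1)).ncard := by
  obtain ⟨i, j, s, hs, hcases⟩ := C.nonresonant_cases hB hres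
  have hj : j.kind.isTernary = true := (Tree.isTernary_iff _).2 ⟨s, hs⟩
  refine ⟨i, j, s, hs, fun L ε k hL hε hε1 hLε hfin X hX hchi hphase => ?_⟩
  set P : ℝ := ((C.leafSet L k (S.R + 1)).ncard : ℝ) with hP
  have hP0 : 0 ≤ P := by positivity
  set N : ℝ := ((C.n + 2 : ℕ) : ℝ) with hN
  have hN1 : 1 ≤ N ^ 3 := by
    apply one_le_pow₀
    rw [hN]
    push_cast
    linarith [Nat.cast_nonneg (α := ℝ) C.n]
  set α := min K.γ (1 / 4) with hα
  have hα0 : 0 < ε ^ α := Real.rpow_pos_of_pos hε _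
  have hmono : ∀ y : ℝ, α ≤ y → ε ^ y ≤ ε ^ α := fun y hy =>
    Real.rpow_le_rpow_of_exponent_ge hε hε1 hy
  have hγ : ε ^ K.γ ≤ ε ^ α := hmono _ (min_le_left _ _)
  have h14 : ε ^ (1 / 4 : ℝ) ≤ ε ^ α := hmono _ (min_le_right _ _)
  have h12 : ε ^ (1 / 2 : ℝ) ≤ ε ^ α := hmono _ ((min_le_right _ _).trans (by norm_num))
  have h1 : ε ≤ ε ^ α := by
    have := hmono 1 ((min_le_right _ _).trans (by norm_num))
    rwa [Real.rpow_one] at this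
  have hC := S.gainConst_pos
  have hm : 0 < 1 / √S.m := one_div_pos.2 S.sqrt_m_pos
  have hosc : 3 * (S.gainConst * N ^ 3 * ε ^ (1 / 4 : ℝ)) * P
      ≤ 3 * S.gainConst * N ^ 3 * ε ^ α * P := by
    have : 3 * (S.gainConst * N ^ 3 * ε ^ (1 / 4 : ℝ)) * P
        = (3 * S.gainConst * N ^ 3 * P) * ε ^ (1 / 4 : ℝ) := by ring
    rw [this]
    have := mul_le_mul_of_nonneg_left h14 (show 0 ≤ 3 * S.gainConst * N ^ 3 * P by positivity)
    linarith
  -- The largest numerical cost is `15 = 3 * 5`: at most three linear counts, each with factor `5`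
  -- from `2 * (2 ε ^ γ) + 1 / L`. The term `1 / √m` serves the case where the phase is bounded
  -- below.
  have hfinish : ∀ c : ℝ, c ≤ 15 + 1 / √S.m → 0 ≤ c →
      3 * S.gainConst * N ^ 3 * ε ^ α * P + c * ε ^ α * P ≤
      (3 * S.gainConst + 15 + 1 / √S.m) * N ^ 3 * ε ^ α * P := by
    intro c hc hc0
    have h2 : c ≤ (15 + 1 / √S.m) * N ^ 3 := by nlinarith
    have h3 : 0 ≤ ε ^ α * P := by positivity
    nlinarith
  have hval : ∀ x : C.Leaf → E d, ∑ e, C.val x i (j.child e) = C.val x i j := fun x =>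
    (C.sum_below_ternary hj x).symm
  have hosc0 : 0 ≤ 3 * S.gainConst * N ^ 3 * ε ^ α * P := by positivity
  have hXfin : X.Finite :=
    hfin.subset (hX.trans (pairedSet_mono (by linarith)))
  have hlin : ∀ e, ¬ C.IsClosed (C.others i j e) → ∀ Y ⊆ X,
      (∀ x ∈ Y, ‖C.val x i j - C.val x i (j.child e)‖ ≤ 2 * ε ^ K.γ) →
      (Y.ncard : ℝ) ≤ 5 * ε ^ α * P := by
    intro e he Y hY hYr
    refine (C.ncard_le_of_not_closed hB hd hL hfin hj he (hY.trans hX) (by positivity) hYr).trans ?_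
    exact mul_le_mul_of_nonneg_right (by linarith) hP0
  have hpart : ∀ e, ∀ ℓ ∈ C.below i (j.child e), ℓ.1 = i := fun e ℓ h => C.fst_of_mem_below h
  rcases hcases with ⟨hsh, hnc⟩ | hsh | ⟨hsh, hcl, hsign⟩
  · have h2 := hlin _ hnc X subset_rfl fun x hx => by
      have := K.norm_le_of_low hε (k := fun e => C.val x i (j.child e)) hsh (hchi x hx)
      rwa [hval] at this
    have h3 := hfinish 5 (by linarith) (by norm_num)
    linarith
  · subst hsh
    -- A stable pair of children has zero total momentum, and the high cut-off then forces another
    -- pair to be small; that pair is not stable, so the linear gain applies. Without a stable pair,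
    -- either one of the three sums is below `ε ^ (1/4)` and the linear gain applies, or all are
    -- separated and the oscillatory gain applies.
    by_cases hex : ∃ e, C.IsClosed (C.others i j e)
    · obtain ⟨e, he⟩ := hex
      have key := ncard_le_four hXfin
        (fun e' => {x ∈ X | e' ≠ e ∧ ‖C.val x i j - C.val x i (j.child e')‖ ≤ 2 * ε ^ K.γ}) ∅
        (fun e' x hx => hx.1) (Set.empty_subset _) fun x hx => by
          have h0 : ∑ e', C.val x i (j.child e') - C.val x i (j.child e) = 0 := by
            rw [hval, ← C.sum_others hj]
            exact C.sum_eq_zero_of_closed (hX hx) he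
          obtain ⟨e', he', hle⟩ := K.exists_norm_le_of_high hε
            (k := fun e => C.val x i (j.child e)) (hchi x hx) h0
          rw [hval] at hle
          exact .inl ⟨e', hx, he', hle⟩
      have hb : ∀ e', (({x ∈ X | e' ≠ e ∧ ‖C.val x i j - C.val x i (j.child e')‖
          ≤ 2 * ε ^ K.γ} : Set _).ncard : ℝ) ≤ 5 * ε ^ α * P := by
        intro e'
        by_cases hee : e' = e
        · simp only [hee, ne_eq, not_true_eq_false, false_and, and_false]
          rw [Set.ofPred_false, Set.ncard_empty, Nat.cast_zero]
          positivity
        · exact hlin e' (C.not_closed_of_closed hB hj hee he) _ (fun x hx => hx.1)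
            fun x hx => hx.2.2
      rw [Set.ncard_empty, Nat.cast_zero, add_zero] at key
      have h2 := hb .left
      have h3 := hb .mid
      have h4 := hb .right
      have h5 := hfinish 15 (by linarith) (by norm_num)
      linarith
    · push Not at hex
      have key := ncard_le_four hXfin
        (fun e => {x ∈ X | ‖C.val x i j - C.val x i (j.child e)‖ ≤ ε ^ (1 / 4 : ℝ)})
        {x ∈ X | ∀ e, ε ^ (1 / 4 : ℝ) ≤ ‖C.val x i j - C.val x i (j.child e)‖}
        (fun e x hx => hx.1) (fun x hx => hx.1) fun x hx => by
          by_cases h : ∃ e, ‖C.val x i j - C.val x i (j.child e)‖ ≤ ε ^ (1 / 4 : ℝ)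
          · obtain ⟨e, he⟩ := h
            exact .inl ⟨e, hx, he⟩
          · push Not at h
            exact .inr ⟨hx, fun e => (h e).le⟩
      have hb : ∀ e, (({x ∈ X | ‖C.val x i j - C.val x i (j.child e)‖
          ≤ ε ^ (1 / 4 : ℝ)} : Set _).ncard : ℝ) ≤ 3 * ε ^ α * P := by
        intro e
        refine (C.ncard_le_of_not_closed hB hd hL hfin hj (hex e) (fun x hx => hX hx.1)
          (Real.rpow_nonneg hε.le _) fun x hx => hx.2).trans ?_
        exact mul_le_mul_of_nonneg_right (by linarith) hP0
      obtain ⟨u, hu, huY⟩ := exists_direction_oscillating C.involutive C.σ_ne (fun ℓ => ℓ.1)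
        (Y := fun e => C.below i (j.child e)) hpart
        (fun e e' hne => C.below_child_disjoint hj e e' hne) (fun e => C.odd_card_below hB i _)
      have hz : (({x ∈ X | ∀ e, ε ^ (1 / 4 : ℝ)
          ≤ ‖C.val x i j - C.val x i (j.child e)‖} : Set _).ncard : ℝ)
          ≤ 3 * (S.gainConst * N ^ 3 * ε ^ (1 / 4 : ℝ)) * P := by
        rcases huY with ⟨a, b, hab, huY⟩ | ⟨a, huY⟩
        · exact C.ncard_le_of_children S hd hL hε hε1 hLε hfin hj hu hab huY
            (fun x hx => hX hx.1) (fun x hx => hphase x hx.1) (.inr fun x hx => hx.2)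
        · exact C.ncard_le_of_child S hd hL hε hε1 hLε hfin hj hu huY
            (fun x hx => hX hx.1) (fun x hx => hphase x hx.1) fun x hx => hx.2
      have h2 := hb .left
      have h3 := hb .mid
      have h4 := hb .right
      have h5 := hfinish 9 (by linarith) (by norm_num)
      linarith
  · rcases hsign with ⟨a, b, hab, haf, hbf, hsg⟩ | ⟨⟨a, b, hab, haf, hbf, hsg⟩, hsf⟩
    -- Equal signs of the two marked children give a sum of brackets, so convexity works without any
    -- separation of momenta.
    · obtain ⟨u, hu, huY⟩ := exists_direction_opposite C.involutive C.σ_ne (fun ℓ => ℓ.1)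
        (Y := fun e => C.below i (j.child e)) hpart
        (fun e e' hne => C.below_child_disjoint hj e e' hne) (fun e => C.odd_card_below hB i _)
        (a := a) (b := b) fun ℓ hl hl' => C.mem_below_child_of_others hj hab haf.symm hbf.symm
          (hcl ℓ ((C.mem_others_iff hj).2 ⟨a, haf, hl⟩)) hl'
      have h2 := C.ncard_le_of_children S hd hL hε hε1 hLε hfin hj hu hab huY hX hphase (.inl hsg)
      have h3 := hfinish 0 (by linarith) le_rfl
      linarith
    · rcases X.eq_empty_or_nonempty with rfl | ⟨x, hx⟩
      · rw [Set.ncard_empty, Nat.cast_zero]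
        positivity
      have h0 := C.sum_eq_zero_of_closed (hX hx) hcl
      rw [C.sum_others hj, sub_eq_zero] at h0
      obtain ⟨c, hca, hcb, hsum⟩ := sum_dir_eq hab
      obtain rfl : s.free = c := dir_eq_of_ne hca.symm hab.symm hcb.symm hbf.symm haf.symm
      have h2 := hval x
      rw [hsum, h0] at h2
      have h3 : C.val x i (j.child b) = -C.val x i (j.child a) := by
        rw [eq_neg_iff_add_eq_zero, add_comm]
        simpa using h2
      have h4 := hphase x hx
      rw [ternaryPhase, hsum, h3, S.bracket_neg, hsg, hsf, ← h0] at h4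
      have h5 : ∀ ι : ℤˣ, sgn (-ι) = -sgn ι := fun ι => by simp [sgn]
      -- The marked momenta are opposite with opposite signs, so their brackets cancel. The free
      -- child has the momentum of the node and the opposite sign, so the phase is `±2 ⟨κ(j)⟩`. A
      -- nonempty `X` thus bounds `ε` below and the trivial count suffices.
      have h6 : 2 * √S.m ≤ ε ^ (1 / 2 : ℝ) := by
        have h7 := S.sqrt_m_le_bracket (C.val x i j)
        rw [h5, h5] at h4
        rw [abs_le] at h4
        rcases System.sgn_eq ((C.part i).sign j) with h | h <;> rw [h] at h4 <;>
          linarith [h4.1, h4.2]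
      have h7 : (X.ncard : ℝ) ≤ P := by
        rw [hP]
        exact_mod_cast Set.ncard_le_ncard (hX.trans (pairedSet_mono (by linarith))) hfin
      have h8 : 1 ≤ 1 / √S.m * ε ^ α := by
        rw [one_div, ← div_eq_inv_mul, le_div_iff₀ S.sqrt_m_pos]
        linarith [S.sqrt_m_pos]
      have h9 := hfinish (1 / √S.m) (by linarith) hm.le
      have h10 := mul_le_mul_of_nonneg_right h8 hP0
      linarith

end Coupling

/-! ### Bounds on correlations and on finitely supported sums. -/

theorem norm_signPow (z : ℂ) (ι : ℤˣ) : ‖signPow z ι‖ = ‖z‖ := by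
  unfold signPow
  split_ifs <;> simp

theorem System.exists_M_bound {d : ℕ} (S : System d) :
    ∃ B : ℝ, 1 ≤ B ∧ ∀ η η' ξ, ‖S.M η η' ξ‖ ≤ B := by
  have h : ∀ η η', ∃ B : ℝ, 0 ≤ B ∧ ∀ ξ, ‖S.M η η' ξ‖ ≤ B := by
    intro η η'
    obtain ⟨B, hB⟩ := (isCompact_closedBall (0 : E d) S.R).exists_bound_of_continuousOn
      (S.M_continuous η η').continuousOn
    refine ⟨|B|, abs_nonneg _, fun ξ => ?_⟩
    by_cases hξ : S.M η η' ξ = 0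
    · rw [hξ, norm_zero]
      exact abs_nonneg _
    · exact (hB ξ (S.M_support η η' hξ)).trans (le_abs_self _)
  choose B hB0 hB using h
  refine ⟨1 + ∑ η, ∑ η', B η η', ?_, fun η η' ξ => ?_⟩
  · have : 0 ≤ ∑ η, ∑ η', B η η' :=
      Finset.sum_nonneg fun η _ => Finset.sum_nonneg fun η' _ => hB0 η η'
    linarith
  · have h1 : B η η' ≤ ∑ η', B η η' :=
      Finset.single_le_sum (fun η' _ => hB0 η η') (Finset.mem_univ η')
    have h2 : ∑ η', B η η' ≤ ∑ η, ∑ η', B η η' :=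
      Finset.single_le_sum (f := fun η => ∑ η', B η η')
        (fun η _ => Finset.sum_nonneg fun η' _ => hB0 η η') (Finset.mem_univ η)
    linarith [hB η η' ξ]

/-- Bound of a sum by the size of its support, with a better bound outside a small set. -/
theorem norm_tsum_le_of_support {ι X : Type*} {f : ι → ℂ} {φ : ι → X}
    (hφ : Function.Injective φ) {P Q : Set X} (hP : P.Finite) (hQP : Q ⊆ P)
    (hf : ∀ i, f i ≠ 0 → φ i ∈ P) {a b : ℝ} (ha : 0 ≤ a) (hb : 0 ≤ b)
    (hfa : ∀ i, ‖f i‖ ≤ a) (hfb : ∀ i, φ i ∉ Q → ‖f i‖ ≤ b) :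
    ‖∑' i, f i‖ ≤ a * Q.ncard + b * P.ncard := by
  classical
  have hPf : (φ ⁻¹' P).Finite := hP.preimage hφ.injOn
  have hQf : (φ ⁻¹' Q).Finite := (hP.subset hQP).preimage hφ.injOn
  have hcard : ∀ {Y : Set X} (hY : (φ ⁻¹' Y).Finite), Y.Finite →
      (hY.toFinset.card : ℝ) ≤ Y.ncard := by
    intro Y hY hYf
    rw [← Set.ncard_eq_toFinset_card _ hY]
    exact_mod_cast Set.ncard_le_ncard_of_injOn φ (fun x hx => hx) hφ.injOn hYf
  rw [tsum_eq_sum (s := hPf.toFinset)]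
  · have h1 : ∀ i ∈ hPf.toFinset, ‖f i‖ ≤ (if i ∈ hQf.toFinset then a else 0) + b := by
      intro i _
      by_cases hi : φ i ∈ Q
      · rw [if_pos (by simpa using hi)]
        linarith [hfa i]
      · rw [if_neg (by simpa using hi), zero_add]
        exact hfb i hi
    refine (norm_sum_le_of_le _ h1).trans ?_
    rw [Finset.sum_add_distrib, Finset.sum_const, nsmul_eq_mul, Finset.sum_ite_mem,
      Finset.sum_const, nsmul_eq_mul]
    have h2 : ((hPf.toFinset ∩ hQf.toFinset).card : ℝ) ≤ hQf.toFinset.card := by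
      exact_mod_cast Finset.card_le_card Finset.inter_subset_right
    have h3 := h2.trans (hcard hQf (hP.subset hQP))
    have h4 := hcard hPf hP
    nlinarith
  · intro i hi
    by_contra hne
    exact hi (by simpa using hf i hne)

/-! ### Decorations as families of leaf values, and the size of one term. -/

namespace Coupling

variable (C : Coupling) {d : ℕ}

/-- The leaf values of a decoration. -/
def leafValues (κ : ∀ i, (C.part i).tree.Vertex → E d) : C.Leaf → E d := fun ℓ => κ ℓ.1 ℓ.2.1

theorem eq_val {κ : ∀ i, (C.part i).tree.Vertex → E d} (h : ∀ i, Tree.IsDecoration (κ i))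
    (i : Fin 2) (v : (C.part i).tree.Vertex) : κ i v = C.val (C.leafValues κ) i v := by
  rw [(Tree.isDecoration_iff (κ i)).1 (h i) v, val, sum_below]
  rfl

theorem firstLeaves_eq : C.firstLeaves = C.below 0 (C.part 0).tree.root := by
  ext ℓ
  rw [mem_below_root]
  simp [firstLeaves]

theorem sum_firstLeaves {κ : ∀ i, (C.part i).tree.Vertex → E d}
    (h : ∀ i, Tree.IsDecoration (κ i)) :
    ∑ ℓ ∈ C.firstLeaves, C.leafValues κ ℓ = κ 0 (C.part 0).tree.root := by
  rw [firstLeaves_eq, C.eq_val h, val]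

theorem leafValues_injective {L : ℝ} {k : E d} :
    Function.Injective fun κ : {κ : ∀ i, (C.part i).tree.Vertex → E d // C.IsKDecoration L k κ} =>
      C.leafValues κ.1 := by
  intro κ κ' h
  apply Subtype.ext
  funext i v
  rw [C.eq_val κ.2.decoration, C.eq_val κ'.2.decoration]
  exact congrArg (fun x => C.val x i v) h

/-- The correlations only constrain the negative leaves; paired leaves have opposite momenta, so the
bound passes to the positive ones. -/
theorem leafValues_mem {L : ℝ} {k : E d} {κ : ∀ i, (C.part i).tree.Vertex → E d}
    (h : C.IsKDecoration L k κ) {ρ : ℝ}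
    (hρ : ∀ ℓ : C.Leaf, C.leafSign ℓ = -1 → ‖C.leafValues κ ℓ‖ ≤ ρ) :
    C.leafValues κ ∈ C.leafSet L k ρ := by
  refine ⟨h.pairing, ?_, fun ℓ => ⟨h.leaf_mem ℓ, ?_⟩⟩
  · rw [C.sum_firstLeaves h.decoration, h.root_eq]
  · rcases Int.units_eq_one_or (C.leafSign ℓ) with hs | hs
    · have h1 := hρ (C.σ ℓ) (by rw [leafSign_σ, hs])
      have h2 : C.leafValues κ (C.σ ℓ) = -C.leafValues κ ℓ :=
        (neg_eq_of_add_eq_zero_right (h.pairing ℓ)).symm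
      rwa [h2, norm_neg] at h1
    · exact hρ ℓ hs

/-- The negative leaves. -/
noncomputable def negLeaves : Finset C.Leaf := Finset.univ.filter fun ℓ => C.leafSign ℓ = -1

theorem mem_negLeaves {ℓ : C.Leaf} : ℓ ∈ C.negLeaves ↔ C.leafSign ℓ = -1 := by
  simp [negLeaves]

theorem σ_mem_negLeaves (ℓ : C.Leaf) : C.σ ℓ ∈ C.negLeaves ↔ ℓ ∉ C.negLeaves := by
  rw [mem_negLeaves, mem_negLeaves, leafSign_σ]
  rcases Int.units_eq_one_or (C.leafSign ℓ) with h | h <;> rw [h] <;> decide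

theorem two_mul_card_negLeaves : 2 * C.negLeaves.card = C.n + 2 := by
  classical
  rw [← C.card_leaf, ← Finset.card_add_card_compl C.negLeaves, two_mul]
  congr 1
  refine Finset.card_bij (fun ℓ _ => C.σ ℓ) (fun ℓ hℓ => ?_) (fun ℓ _ ℓ' _ h => C.involutive.injective h)
    (fun ℓ hℓ => ⟨C.σ ℓ, ?_, C.involutive ℓ⟩)
  · rw [Finset.mem_compl, C.σ_mem_negLeaves, not_not]
    exact hℓ
  · rw [C.σ_mem_negLeaves]
    exact Finset.mem_compl.1 hℓ

theorem leafSet_finite_card (hcross : ∃ ℓ ∈ C.firstLeaves, C.σ ℓ ∉ C.firstLeaves) {L ρ : ℝ}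
    (hL : 0 < L) (hρ : 0 ≤ ρ) (k : E d) :
    (C.leafSet L k ρ).Finite ∧ ((C.leafSet L k ρ).ncard : ℝ) ≤ ((2 * ρ * L + 1) ^ d) ^ (C.n / 2) := by
  have := C.two_mul_card_negLeaves
  exact pairedSet_finite_card C.involutive C.σ_mem_negLeaves (by omega) hcross hL hρ k

theorem n_eq : C.n = C.nB + 2 * C.nT := by
  rw [n, nB, nT, Finset.mul_sum, ← Finset.sum_add_distrib]
  exact Finset.sum_congr rfl fun i _ => Tree.size_eq _

theorem even_n : 2 * (C.n / 2) = C.n := by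
  have := C.two_mul_card_negLeaves
  omega

theorem card_node_le : ∑ i, Fintype.card (C.part i).tree.Node ≤ C.n :=
  Finset.sum_le_sum fun _ _ => Tree.card_node_le _

/-- A one-leaf first tree would have its only leaf paired with the second tree, the pairing having
no fixed point. -/
theorem isNode_root (hcross : ¬ ∃ ℓ ∈ C.firstLeaves, C.σ ℓ ∉ C.firstLeaves) :
    (C.part 0).tree.root.kind.isNode = true := by
  rw [Tree.isNode_iff_not_isLeaf]
  intro h
  push Not at hcross
  rw [firstLeaves_eq, below, Tree.leavesBelow_leaf h] at hcross
  have := hcross ⟨0, ⟨_, h⟩⟩ (by simp)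
  simp only [Finset.map_singleton, Finset.mem_singleton] at this
  exact C.σ_ne _ this

/-- The product of the node factors. -/
noncomputable def nodeProd (S : System d) (K : Cutoff) (ε : ℝ)
    (κ : ∀ i, (C.part i).tree.Vertex → E d) : ℂ :=
  ∏ i, ∏ j : (C.part i).tree.Node, (C.part i).q S K ε (κ i) j.1

theorem nodeProd_eq_zero (S : System d) (K : Cutoff) (ε : ℝ)
    {κ : ∀ i, (C.part i).tree.Vertex → E d} (h : ∀ i, Tree.IsDecoration (κ i)) {i : Fin 2}
    {j : (C.part i).tree.Vertex} (hj : j.kind.isNode = true) (h0 : κ i j = 0) :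
    C.nodeProd S K ε κ = 0 := by
  refine Finset.prod_eq_zero (Finset.mem_univ i) ?_
  exact Finset.prod_eq_zero (Finset.mem_univ (⟨j, hj⟩ : (C.part i).tree.Node))
    ((C.part i).q_eq_zero S K (h i) hj h0)

/-- The product of the correlations of the leaves. -/
noncomputable def leafProd (S : System d) (κ : ∀ i, (C.part i).tree.Vertex → E d) : ℂ :=
  ∏ ℓ ∈ Finset.univ.filter (fun ℓ : C.Leaf => C.leafSign ℓ = -1),
    signPow (S.M (C.leafColour ℓ) (C.leafColour (C.σ ℓ))
      (sgn (C.leafSign ℓ) • κ ℓ.1 ℓ.2.1)) (C.leafSign ℓ)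

theorem norm_leafValues_le_of_leafProd_ne_zero (S : System d)
    {κ : ∀ i, (C.part i).tree.Vertex → E d} (h : C.leafProd S κ ≠ 0) {ℓ : C.Leaf}
    (hℓ : C.leafSign ℓ = -1) : ‖C.leafValues κ ℓ‖ ≤ S.R := by
  have h1 := Finset.prod_ne_zero_iff.1 h ℓ (Finset.mem_filter.2 ⟨Finset.mem_univ _, hℓ⟩)
  rw [← norm_ne_zero_iff, norm_signPow, norm_ne_zero_iff] at h1
  have h2 := S.M_support _ _ h1
  rw [mem_closedBall_zero_iff, norm_smul, Real.norm_eq_abs] at h2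
  change ‖κ ℓ.1 ℓ.2.1‖ ≤ S.R
  rcases System.sgn_eq (C.leafSign ℓ) with h3 | h3 <;> rw [h3] at h2 <;> simpa using h2

theorem norm_leafProd_le (S : System d) {B : ℝ} (hB1 : 1 ≤ B)
    (hB : ∀ η η' ξ, ‖S.M η η' ξ‖ ≤ B) (κ : ∀ i, (C.part i).tree.Vertex → E d) :
    ‖C.leafProd S κ‖ ≤ B ^ (C.n + 2) := by
  rw [leafProd, norm_prod]
  refine (Finset.prod_le_prod (fun _ _ => norm_nonneg _) fun ℓ _ =>
    (norm_signPow _ _).trans_le (hB _ _ _)).trans ?_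
  rw [Finset.prod_const]
  refine pow_le_pow_right₀ hB1 ?_
  rw [← C.card_leaf]
  exact Finset.card_le_univ _

theorem norm_nodeProd_le (S : System d) (K : Cutoff) {B ε : ℝ} (hB1 : 1 ≤ B)
    {κ : ∀ i, (C.part i).tree.Vertex → E d}
    (hB : ∀ i, ∀ j : (C.part i).tree.Vertex, j.kind.isNode = true →
      ‖(C.part i).q S K ε (κ i) j‖ ≤ B) :
    ‖C.nodeProd S K ε κ‖ ≤ B ^ C.n := by
  rw [nodeProd, norm_prod]
  have h1 : ∀ i, ‖∏ j : (C.part i).tree.Node, (C.part i).q S K ε (κ i) j.1‖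
      ≤ B ^ Fintype.card (C.part i).tree.Node := by
    intro i
    rw [norm_prod]
    refine (Finset.prod_le_prod (fun _ _ => norm_nonneg _) fun j _ => hB i j.1 j.2).trans ?_
    rw [Finset.prod_const, Finset.card_univ]
  refine (Finset.prod_le_prod (fun _ _ => norm_nonneg _) fun i _ => h1 i).trans ?_
  rw [Finset.prod_pow_eq_pow_sum]
  exact pow_le_pow_right₀ hB1 C.card_node_le

/-- When all branching nodes are ternary, each is its own least ternary ancestor, so the sum has a
single term. -/
theorem omega_eq (hB : ∀ (i : Fin 2) (v : (C.part i).tree.Vertex), ¬ v.kind.isBinary = true)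
    (S : System d) {κ : ∀ i, (C.part i).tree.Vertex → E d} (h : ∀ i, Tree.IsDecoration (κ i))
    {i : Fin 2} (j : (C.part i).tree.TNode) :
    (C.part i).omega S (κ i) j = C.ternaryPhase S i j.1 (C.leafValues κ) := by
  classical
  have hjn : j.1.kind.isNode = true := (Tree.isNode_iff _).2 (.inr j.2)
  rw [SCTree.omega, Finset.sum_eq_single (⟨j.1, hjn⟩ : (C.part i).tree.Node)]
  · rw [if_pos ⟨⟨j.2, le_rfl⟩, fun v hv => hv.2⟩, SCTree.delta, if_neg, SCTree.phase,
      Tree.sum_children_ternary j.2, ternaryPhase]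
    · simp only [C.eq_val h]
    · intro hk
      exact hB i j.1 (by rw [hk]; rfl)
  · intro j' _ hne
    refine if_neg fun hl => hne ?_
    have ht : j'.1.kind.isTernary = true := ((Tree.isNode_iff _).1 j'.2).resolve_left (hB i _)
    exact Subtype.ext (le_antisymm hl.1.2 (hl.2 ⟨ht, le_rfl⟩))
  · intro h
    exact absurd (Finset.mem_univ _) h

/-- The time integral of a decoration. -/
noncomputable def timeIntegral (S : System d) (ε t : ℝ)
    (κ : ∀ i, (C.part i).tree.Vertex → E d) : ℂ :=
  ∫ s in Set.pi Set.univ (fun i => (C.part i).tree.timeDomain t),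
    ∏ i, ∏ j : (C.part i).tree.TNode,
      Complex.exp (Complex.I * (((C.part i).omega S (κ i) j * ε ^ (-2 : ℤ) * s i j : ℝ) : ℂ))

theorem norm_timeIntegral_le_pow (S : System d) {ε t δ : ℝ} (ht : t ∈ Set.Icc 0 δ)
    (κ : ∀ i, (C.part i).tree.Vertex → E d) : ‖C.timeIntegral S ε t κ‖ ≤ δ ^ C.nT :=
  (norm_timeIntegral_le _ ht.1 _).trans (pow_le_pow_left₀ ht.1 ht.2 _)

/-- Integrating the oscillation replaces one factor `δ` by `2 ε² / |Ω_j| ≤ 2 ε ^ (3/2)`. Since `ε ≤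
δ`, this is at most `δ * 2 ε ^ (1/2)`, so the lost power of `δ` is restored. -/
theorem norm_timeIntegral_le_of_lt (S : System d) {ε t δ : ℝ} (hε : 0 < ε) (hεδ : ε ≤ δ)
    (ht : t ∈ Set.Icc 0 δ) {κ : ∀ i, (C.part i).tree.Vertex → E d} {i : Fin 2}
    (j : (C.part i).tree.TNode) (hj : ε ^ (1 / 2 : ℝ) < |(C.part i).omega S (κ i) j|) :
    ‖C.timeIntegral S ε t κ‖ ≤ δ ^ C.nT * (2 * ε ^ (1 / 2 : ℝ)) := by
  set η := ε ^ (1 / 2 : ℝ) with hη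
  have hη0 : 0 < η := Real.rpow_pos_of_pos hε _
  have hη2 : η * η = ε := by
    rw [hη, ← Real.rpow_add hε]
    norm_num
  have hw0 : 0 < |(C.part i).omega S (κ i) j| := hη0.trans hj
  have hε2 : 0 < ε ^ (-2 : ℤ) := zpow_pos hε _
  have hne : (C.part i).omega S (κ i) j * ε ^ (-2 : ℤ) ≠ 0 :=
    mul_ne_zero (abs_pos.1 hw0) hε2.ne'
  refine (norm_timeIntegral_le_of_ne_zero (fun i => (C.part i).tree) ht.1
    (fun i j => (C.part i).omega S (κ i) j * ε ^ (-2 : ℤ)) i j hne).trans ?_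
  have hδ : 0 < δ := hε.trans_le hεδ
  have hnT : C.nT = (C.nT - 1) + 1 := by
    have : 0 < C.nT := by
      rw [nT]
      exact Finset.sum_pos' (fun _ _ => Nat.zero_le _)
        ⟨i, Finset.mem_univ _, Fintype.card_pos_iff.2 ⟨j⟩⟩
    omega
  have h1 : 2 / |(C.part i).omega S (κ i) j * ε ^ (-2 : ℤ)| ≤ δ * (2 * η) := by
    rw [abs_mul, abs_of_pos hε2, div_le_iff₀ (by positivity)]
    have e1 : ε ^ (-2 : ℤ) = 1 / (ε * ε) := by
      rw [zpow_neg, one_div]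
      congr 1
      rw [← sq]
      norm_cast
    rw [e1]
    have : 2 = ε * (2 * η) * (η * (1 / (ε * ε))) := by
      rw [show ε * (2 * η) * (η * (1 / (ε * ε))) = 2 * ε * (η * η) / (ε * ε) by ring, hη2]
      field_simp
    calc (2 : ℝ) = ε * (2 * η) * (η * (1 / (ε * ε))) := this
      _ ≤ δ * (2 * η) * (|(C.part i).omega S (κ i) j| * (1 / (ε * ε))) := by gcongr
  calc t ^ (∑ i, Fintype.card (C.part i).tree.TNode - 1)
        * (2 / |(C.part i).omega S (κ i) j * ε ^ (-2 : ℤ)|)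
      ≤ δ ^ (C.nT - 1) * (δ * (2 * η)) :=
        mul_le_mul (pow_le_pow_left₀ ht.1 ht.2 _) h1 (by positivity) (by positivity)
    _ = δ ^ C.nT * (2 * η) := by
        conv_rhs => rw [hnT, pow_succ]
        ring

/-- The contribution of one decoration. -/
noncomputable def term (S : System d) (K : Cutoff) (ε t : ℝ)
    (κ : ∀ i, (C.part i).tree.Vertex → E d) : ℂ :=
  Complex.exp (Complex.I *
      ((ε ^ (-2 : ℤ) * (∑ i, (C.part i).omegaRoot S (κ i)) * t : ℝ) : ℂ))
    * C.nodeProd S K ε κ * C.timeIntegral S ε t κ * C.leafProd S κ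

theorem norm_term (S : System d) (K : Cutoff) (ε t : ℝ)
    (κ : ∀ i, (C.part i).tree.Vertex → E d) :
    ‖C.term S K ε t κ‖ = ‖C.nodeProd S K ε κ‖ * ‖C.timeIntegral S ε t κ‖ * ‖C.leafProd S κ‖ := by
  rw [term, norm_mul, norm_mul, norm_mul, mul_comm Complex.I, Complex.norm_exp_ofReal_mul_I,
    one_mul]

theorem norm_Fhat (S : System d) (K : Cutoff) {L ε t : ℝ} (hL : 0 < L) (hε : 0 < ε) (k : E d) :
    ‖C.Fhat S K L ε t k‖ = ε ^ C.nB / L ^ ((C.n : ℝ) * d / 2) *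
      ‖∑' κ : {κ : ∀ i, (C.part i).tree.Vertex → E d // C.IsKDecoration L k κ},
        C.term S K ε t κ.1‖ := by
  have h1 : 0 < L ^ ((C.n : ℝ) * d / 2) := Real.rpow_pos_of_pos hL _
  have : C.Fhat S K L ε t k = ((ε ^ C.nB / L ^ ((C.n : ℝ) * d / 2) : ℝ) : ℂ) * (-Complex.I) ^ C.nT *
      ∑' κ : {κ : ∀ i, (C.part i).tree.Vertex → E d // C.IsKDecoration L k κ},
        C.term S K ε t κ.1 := rfl
  rw [this, norm_mul, norm_mul, norm_pow, norm_neg, Complex.norm_I, one_pow, mul_one,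
    Complex.norm_real, Real.norm_eq_abs, abs_of_pos (by positivity)]

/-- Counting decorations against the normalization. -/
theorem ncard_leafSet_le (hcross : ∃ ℓ ∈ C.firstLeaves, C.σ ℓ ∉ C.firstLeaves) {L ρ R : ℝ}
    (hL : 0 < L) (hρ : 0 ≤ ρ) (hR : 0 < R) (hρR : ρ ≤ R + 1) (hRL : 1 ≤ R * L) (k : E d) :
    ((C.leafSet L k ρ).ncard : ℝ) ≤ ((3 * R + 2) ^ d) ^ C.n * L ^ ((C.n : ℝ) * d / 2) := by
  refine (C.leafSet_finite_card hcross hL hρ k).2.trans ?_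
  -- The condition `1 ≤ R L` absorbs the additive `1`, leaving a pure power of `L` to match the
  -- normalization; evenness of `n` makes the exponent `n / 2` exact.
  have h1 : 2 * ρ * L + 1 ≤ (3 * R + 2) * L := by nlinarith
  have h2 : L ^ ((C.n : ℝ) * d / 2) = (L ^ d) ^ (C.n / 2) := by
    have h3 : (C.n : ℝ) = 2 * ((C.n / 2 : ℕ) : ℝ) := by exact_mod_cast C.even_n.symm
    rw [← pow_mul, ← Real.rpow_natCast]
    congr 1
    push_cast
    rw [h3]
    ring
  rw [h2]
  calc ((2 * ρ * L + 1) ^ d) ^ (C.n / 2) ≤ (((3 * R + 2) * L) ^ d) ^ (C.n / 2) := by gcongr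
    _ = ((3 * R + 2) ^ d) ^ (C.n / 2) * (L ^ d) ^ (C.n / 2) := by rw [mul_pow, mul_pow]
    _ ≤ ((3 * R + 2) ^ d) ^ C.n * (L ^ d) ^ (C.n / 2) := by
        gcongr
        · exact one_le_pow₀ (by linarith)
        · exact Nat.div_le_self _ _

end Coupling

theorem eq_zero_of_mem_lattice {d : ℕ} {L : ℝ} (hL : 0 < L) {x : E d} (hx : x ∈ lattice d L)
    (h : L * ‖x‖ < 1) : x = 0 := by
  ext i
  obtain ⟨n, hn⟩ := hx i
  have h1 : |x i| ≤ ‖x‖ := by simpa using PiLp.norm_apply_le x i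
  have h2 : |(n : ℝ)| < 1 := by
    have : (n : ℝ) = L * x i := by rw [hn]; field_simp
    rw [this, abs_mul, abs_of_pos hL]
    exact (mul_le_mul_of_nonneg_left h1 hL.le).trans_lt h
  have h3 : n = 0 := Int.abs_lt_one_iff.1 (by exact_mod_cast h2)
  rw [hn, h3]
  simp

/-! ### Vanishing cases and bounds for the contribution of a coupling. -/

namespace Coupling

variable (C : Coupling) {d : ℕ}

theorem Fhat_eq_zero (S : System d) (K : Cutoff) {L ε t : ℝ} (hL : 0 < L) (hε : 0 < ε) {k : E d}
    (h : ∀ κ, C.IsKDecoration L k κ → C.leafProd S κ ≠ 0 → C.nodeProd S K ε κ = 0) :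
    C.Fhat S K L ε t k = 0 := by
  rw [← norm_eq_zero, C.norm_Fhat S K hL hε]
  have : ∀ κ : {κ : ∀ i, (C.part i).tree.Vertex → E d // C.IsKDecoration L k κ},
      C.term S K ε t κ.1 = 0 := by
    intro κ
    by_cases hl : C.leafProd S κ.1 = 0
    · rw [term, hl, mul_zero]
    · rw [term, h κ.1 κ.2 hl, mul_zero, zero_mul, zero_mul]
  simp only [this, tsum_zero, norm_zero, mul_zero]

theorem Fhat_eq_zero_of_not_crossing (S : System d) (K : Cutoff) {L ε t : ℝ} (hL : 0 < L)
    (hε : 0 < ε) {k : E d} (hcross : ¬ ∃ ℓ ∈ C.firstLeaves, C.σ ℓ ∉ C.firstLeaves) :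
    C.Fhat S K L ε t k = 0 := by
  refine C.Fhat_eq_zero S K hL hε fun κ h _ => ?_
  refine C.nodeProd_eq_zero S K ε h.decoration (C.isNode_root hcross) ?_
  rw [← C.sum_firstLeaves h.decoration]
  push Not at hcross
  exact Finset.sum_involution (fun ℓ _ => C.σ ℓ) (fun ℓ _ => h.pairing ℓ)
    (fun ℓ _ _ => C.σ_ne ℓ) hcross (fun ℓ _ => C.involutive ℓ)

theorem Fhat_eq_zero_of_lt (S : System d) (K : Cutoff) {L ε t : ℝ} (hL : 0 < L)
    (hε : 0 < ε) {k : E d} (j : C.Node) (hRL : S.R * L < 1) :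
    C.Fhat S K L ε t k = 0 := by
  refine C.Fhat_eq_zero S K hL hε fun κ h hl => ?_
  refine C.nodeProd_eq_zero S K ε h.decoration j.2.2 ?_
  have hm := C.leafValues_mem h fun ℓ hℓ => C.norm_leafValues_le_of_leafProd_ne_zero S hl hℓ
  rw [C.eq_val h.decoration, val]
  refine Finset.sum_eq_zero fun ℓ _ => eq_zero_of_mem_lattice hL (hm.2.2 ℓ).1 ?_
  have := mul_le_mul_of_nonneg_left (hm.2.2 ℓ).2 hL.le
  linarith

theorem norm_term_le (S : System d) (K : Cutoff) {ε t : ℝ} {a b c : ℝ}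
    {κ : ∀ i, (C.part i).tree.Vertex → E d} (ha : ‖C.nodeProd S K ε κ‖ ≤ a)
    (hb : ‖C.timeIntegral S ε t κ‖ ≤ b) (hc : ‖C.leafProd S κ‖ ≤ c) :
    ‖C.term S K ε t κ‖ ≤ a * c * b := by
  rw [norm_term, mul_right_comm]
  have h0 : 0 ≤ a := (norm_nonneg _).trans ha
  have h1 : 0 ≤ c := (norm_nonneg _).trans hc
  gcongr

/-- Bounds for the node factors and for the correlations. -/
structure IsBound (S : System d) (K : Cutoff) (Bq BM : ℝ) : Prop where
  one_le_q : 1 ≤ Bq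
  one_le_M : 1 ≤ BM
  norm_q_le : ∀ (T : SCTree) (ε : ℝ), 0 ≤ ε → ∀ κ : T.tree.Vertex → E d, Tree.IsDecoration κ →
    ∀ j : T.tree.Vertex, j.kind.isNode = true → ‖T.q S K ε κ j‖ ≤ Bq
  norm_M_le : ∀ η η' ξ, ‖S.M η η' ξ‖ ≤ BM

variable {S : System d} {K : Cutoff} {Bq BM : ℝ}

theorem IsBound.norm_term_le (h : IsBound S K Bq BM) {ε t b : ℝ} (hε : 0 ≤ ε)
    {κ : ∀ i, (C.part i).tree.Vertex → E d} (hκ : ∀ i, Tree.IsDecoration (κ i))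
    (hb : ‖C.timeIntegral S ε t κ‖ ≤ b) :
    ‖C.term S K ε t κ‖ ≤ Bq ^ C.n * BM ^ (C.n + 2) * b :=
  C.norm_term_le S K (C.norm_nodeProd_le S K h.one_le_q fun i j hj =>
    h.norm_q_le (C.part i) ε hε (κ i) (hκ i) j hj) hb
    (C.norm_leafProd_le S h.one_le_M h.norm_M_le κ)

theorem IsBound.pow_le (h : IsBound S K Bq BM) {A : ℝ} (hA : 1 ≤ A) (n : ℕ) :
    Bq ^ n * BM ^ (n + 2) * A ^ n ≤ (A * Bq * BM ^ 2) ^ (n + 1) := by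
  have h1 := h.one_le_q
  have h2 := h.one_le_M
  rw [mul_pow, mul_pow, ← pow_mul]
  calc Bq ^ n * BM ^ (n + 2) * A ^ n ≤ Bq ^ (n + 1) * BM ^ (2 * (n + 1)) * A ^ (n + 1) := by
        gcongr <;> first | assumption | omega
    _ = _ := by ring

theorem IsBound.leafSet_mul_le (h : IsBound S K Bq BM)
    (hcross : ∃ ℓ ∈ C.firstLeaves, C.σ ℓ ∉ C.firstLeaves) {L ρ : ℝ}
    (hL : 0 < L) (hρ : 0 ≤ ρ) (hρR : ρ ≤ S.R + 1) (hRL : 1 ≤ S.R * L) (k : E d) :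
    Bq ^ C.n * BM ^ (C.n + 2) * (C.leafSet L k ρ).ncard
      ≤ ((3 * S.R + 2) ^ d * Bq * BM ^ 2) ^ (C.n + 1) * L ^ ((C.n : ℝ) * d / 2) := by
  have h1 := h.one_le_q
  have h2 := h.one_le_M
  have hA : 1 ≤ (3 * S.R + 2) ^ d := one_le_pow₀ (by linarith [S.R_pos])
  have h3 := C.ncard_leafSet_le hcross hL hρ S.R_pos hρR hRL k
  have h4 : 0 < L ^ ((C.n : ℝ) * d / 2) := Real.rpow_pos_of_pos hL _
  calc Bq ^ C.n * BM ^ (C.n + 2) * (C.leafSet L k ρ).ncard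
      ≤ Bq ^ C.n * BM ^ (C.n + 2) * (((3 * S.R + 2) ^ d) ^ C.n * L ^ ((C.n : ℝ) * d / 2)) := by
        gcongr
    _ = Bq ^ C.n * BM ^ (C.n + 2) * ((3 * S.R + 2) ^ d) ^ C.n * L ^ ((C.n : ℝ) * d / 2) := by ring
    _ ≤ _ := by
        gcongr
        exact h.pow_le hA C.n

/-- The bound without gain. -/
theorem norm_Fhat_le (h : IsBound S K Bq BM)
    (hcross : ∃ ℓ ∈ C.firstLeaves, C.σ ℓ ∉ C.firstLeaves) {L ε t δ : ℝ} (hL : 0 < L)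
    (hε : 0 < ε) (ht : t ∈ Set.Icc 0 δ) (hRL : 1 ≤ S.R * L) (k : E d) :
    ‖C.Fhat S K L ε t k‖
      ≤ ε ^ C.nB * δ ^ C.nT * ((3 * S.R + 2) ^ d * Bq * BM ^ 2) ^ (C.n + 1) := by
  have h1 := h.one_le_q
  have h2 := h.one_le_M
  have hδ : 0 ≤ δ := ht.1.trans ht.2
  have hR := S.R_pos
  have hL' : 0 < L ^ ((C.n : ℝ) * d / 2) := Real.rpow_pos_of_pos hL _
  have hfin := (C.leafSet_finite_card hcross hL hR.le k).1
  have hsum := norm_tsum_le_of_support (f := fun κ : {κ : ∀ i, (C.part i).tree.Vertex → E d //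
      C.IsKDecoration L k κ} => C.term S K ε t κ.1) C.leafValues_injective hfin subset_rfl
    (a := Bq ^ C.n * BM ^ (C.n + 2) * δ ^ C.nT) (b := 0) ?_ (by positivity) le_rfl
    (fun κ => h.norm_term_le C hε.le κ.2.decoration (C.norm_timeIntegral_le_pow S ht κ.1)) ?_
  · rw [C.norm_Fhat S K hL hε]
    have h5 := h.leafSet_mul_le C hcross hL hR.le (by linarith) hRL k
    rw [zero_mul, add_zero] at hsum
    calc _ ≤ ε ^ C.nB / L ^ ((C.n : ℝ) * d / 2) * (Bq ^ C.n * BM ^ (C.n + 2) * δ ^ C.nT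
          * (C.leafSet L k S.R).ncard) := by gcongr
      _ = ε ^ C.nB / L ^ ((C.n : ℝ) * d / 2) * (δ ^ C.nT * (Bq ^ C.n * BM ^ (C.n + 2)
          * (C.leafSet L k S.R).ncard)) := by ring
      _ ≤ ε ^ C.nB / L ^ ((C.n : ℝ) * d / 2) * (δ ^ C.nT *
          (((3 * S.R + 2) ^ d * Bq * BM ^ 2) ^ (C.n + 1) * L ^ ((C.n : ℝ) * d / 2))) := by gcongr
      _ = _ := by field_simp
  · intro κ hκ
    refine C.leafValues_mem κ.2 fun ℓ hℓ => C.norm_leafValues_le_of_leafProd_ne_zero S ?_ hℓ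
    exact right_ne_zero_of_mul hκ
  · intro κ hκ
    by_contra hne
    refine hκ (C.leafValues_mem κ.2 fun ℓ hℓ => C.norm_leafValues_le_of_leafProd_ne_zero S ?_ hℓ)
    have h0 : C.term S K ε t κ.1 ≠ 0 := fun h0 => hne (norm_eq_zero.2 h0).le
    exact right_ne_zero_of_mul h0

/-- The bound with gain, without binary nodes. -/
theorem norm_Fhat_le_of_nonresonant (h : IsBound S K Bq BM) (hd : 1 ≤ d)
    (hB : ∀ (i : Fin 2) (v : (C.part i).tree.Vertex), ¬ v.kind.isBinary = true)
    (hres : ∃ j : C.Node, ¬ C.IsResonant j)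
    (hcross : ∃ ℓ ∈ C.firstLeaves, C.σ ℓ ∉ C.firstLeaves) {L ε t δ : ℝ} (hL : 0 < L)
    (hε : 0 < ε) (hε1 : ε ≤ 1) (hLε : 1 / L ≤ ε) (hεδ : ε ≤ δ) (ht : t ∈ Set.Icc 0 δ)
    (hRL : 1 ≤ S.R * L) (k : E d) :
    ‖C.Fhat S K L ε t k‖ ≤ ε ^ C.nB * δ ^ C.nT *
      ((3 * S.R + 2) ^ d * Bq * BM ^ 2) ^ (C.n + 1) *
      (((3 * S.gainConst + 15 + 1 / √S.m) * ((C.n + 2 : ℕ) : ℝ) ^ 3 + 2)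
        * ε ^ (min K.γ (1 / 4))) := by
  have h1 := h.one_le_q
  have h2 := h.one_le_M
  have hδ : 0 ≤ δ := ht.1.trans ht.2
  have hR := S.R_pos
  have hG := S.gainConst_pos
  have hL' : 0 < L ^ ((C.n : ℝ) * d / 2) := Real.rpow_pos_of_pos hL _
  have hα : 0 < ε ^ (min K.γ (1 / 4)) := Real.rpow_pos_of_pos hε _
  have hhalf : ε ^ (1 / 2 : ℝ) ≤ ε ^ (min K.γ (1 / 4)) :=
    Real.rpow_le_rpow_of_exponent_ge hε hε1 ((min_le_right _ _).trans (by norm_num))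
  obtain ⟨i, j, s, hs, hgain⟩ := C.exists_gain hB hres S K hd
  have hj : j.kind.isTernary = true := (Tree.isTernary_iff _).2 ⟨s, hs⟩
  have hjn : j.kind.isNode = true := (Tree.isNode_iff _).2 (.inr hj)
  have hfin := (C.leafSet_finite_card hcross hL (show 0 ≤ S.R + 1 by linarith) k).1
  -- `Q` collects the families at which the cut-off is active and the phase is too small for the
  -- time integral to gain. A nonzero term outside `Q` must have a large phase, because its node
  -- factor at `j` does not vanish.
  set Q : Set (C.Leaf → E d) := {x ∈ C.leafSet L k S.R |
    K.chi ε (C.val x i (j.child .left)) (C.val x i (j.child .mid))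
      (C.val x i (j.child .right)) s ≠ 0 ∧ |C.ternaryPhase S i j x| ≤ ε ^ (1 / 2 : ℝ)} with hQ
  have hQc := hgain L ε k hL hε hε1 hLε hfin Q (fun x hx => hx.1) (fun x hx => hx.2.1)
    (fun x hx => hx.2.2)
  have hmono : C.leafSet L k S.R ⊆ C.leafSet L k (S.R + 1) := pairedSet_mono (by linarith)
  have hmem : ∀ κ : {κ : ∀ i, (C.part i).tree.Vertex → E d // C.IsKDecoration L k κ},
      C.term S K ε t κ.1 ≠ 0 → C.leafValues κ.1 ∈ C.leafSet L k S.R := fun κ hκ =>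
    C.leafValues_mem κ.2 fun ℓ hℓ =>
      C.norm_leafValues_le_of_leafProd_ne_zero S (right_ne_zero_of_mul hκ) hℓ
  have hsum := norm_tsum_le_of_support (f := fun κ : {κ : ∀ i, (C.part i).tree.Vertex → E d //
      C.IsKDecoration L k κ} => C.term S K ε t κ.1) C.leafValues_injective hfin
    (Q := Q) (fun x hx => hmono hx.1)
    (a := Bq ^ C.n * BM ^ (C.n + 2) * δ ^ C.nT)
    (b := Bq ^ C.n * BM ^ (C.n + 2) * (δ ^ C.nT * (2 * ε ^ (1 / 2 : ℝ))))
    (fun κ hκ => hmono (hmem κ hκ)) (by positivity) (by positivity)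
    (fun κ => h.norm_term_le C hε.le κ.2.decoration (C.norm_timeIntegral_le_pow S ht κ.1)) ?_
  · rw [C.norm_Fhat S K hL hε]
    have h5 := h.leafSet_mul_le C hcross hL (show 0 ≤ S.R + 1 by linarith) le_rfl hRL k
    set P : ℝ := ((C.leafSet L k (S.R + 1)).ncard : ℝ)
    set N : ℝ := ((C.n + 2 : ℕ) : ℝ)
    set G : ℝ := 3 * S.gainConst + 15 + 1 / √S.m
    have hG0 : 0 ≤ G := by positivity
    calc _ ≤ ε ^ C.nB / L ^ ((C.n : ℝ) * d / 2) * (Bq ^ C.n * BM ^ (C.n + 2) * δ ^ C.nT * Q.ncard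
          + Bq ^ C.n * BM ^ (C.n + 2) * (δ ^ C.nT * (2 * ε ^ (1 / 2 : ℝ))) * P) := by gcongr
      _ ≤ ε ^ C.nB / L ^ ((C.n : ℝ) * d / 2) * (Bq ^ C.n * BM ^ (C.n + 2) * δ ^ C.nT *
            (G * N ^ 3 * ε ^ (min K.γ (1 / 4)) * P)
          + Bq ^ C.n * BM ^ (C.n + 2) * (δ ^ C.nT * (2 * ε ^ (min K.γ (1 / 4)))) * P) := by gcongr
      _ = ε ^ C.nB / L ^ ((C.n : ℝ) * d / 2) * (δ ^ C.nT * ((G * N ^ 3 + 2)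
            * ε ^ (min K.γ (1 / 4))) * (Bq ^ C.n * BM ^ (C.n + 2) * P)) := by ring
      _ ≤ ε ^ C.nB / L ^ ((C.n : ℝ) * d / 2) * (δ ^ C.nT * ((G * N ^ 3 + 2)
            * ε ^ (min K.γ (1 / 4))) *
          (((3 * S.R + 2) ^ d * Bq * BM ^ 2) ^ (C.n + 1) * L ^ ((C.n : ℝ) * d / 2))) := by gcongr
      _ = _ := by field_simp
  · intro κ hκ
    by_cases h0 : C.term S K ε t κ.1 = 0
    · rw [h0, norm_zero]
      positivity
    refine h.norm_term_le C hε.le κ.2.decoration ?_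
    refine C.norm_timeIntegral_le_of_lt S hε hεδ ht (⟨j, hj⟩ : (C.part i).tree.TNode) ?_
    rw [C.omega_eq hB S κ.2.decoration]
    by_contra hle
    refine hκ ⟨hmem κ h0, ?_, not_lt.1 hle⟩
    simp only [← C.eq_val κ.2.decoration]
    refine SCTree.chi_ne_zero_of_q_ne_zero S K (C.part i) hs fun hq => h0 ?_
    have : C.nodeProd S K ε κ.1 = 0 := Finset.prod_eq_zero (Finset.mem_univ i)
      (Finset.prod_eq_zero (Finset.mem_univ (⟨j, hjn⟩ : (C.part i).tree.Node)) hq)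
    rw [term, this, mul_zero, zero_mul, zero_mul]

end Coupling

theorem add_two_pow_three_le (n : ℕ) : ((n + 2 : ℕ) : ℝ) ^ 3 ≤ 8 ^ (n + 1) := by
  have h : n + 2 ≤ 2 ^ (n + 1) := Nat.lt_two_pow_self (n := n + 1)
  calc ((n + 2 : ℕ) : ℝ) ^ 3 ≤ ((2 ^ (n + 1) : ℕ) : ℝ) ^ 3 := by gcongr
    _ = 8 ^ (n + 1) := by
      push_cast
      rw [← pow_mul, mul_comm, pow_mul]
      norm_num

end KleinGordon

/-! ### The proposition. -/

theorem proposition4p2 {d : ℕ} (hd : 1 ≤ d) (S : KleinGordon.System d) (K : KleinGordon.Cutoff)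
    (β : ℝ) (hβ : 2 < β) :
    ∃ α : ℝ, 0 < α ∧ ∃ Λ : ℝ, 0 < Λ ∧
      ∀ C : KleinGordon.Coupling, (∃ j : C.Node, ¬ C.IsResonant j) →
        ∀ L ε δ : ℝ, 0 < L → ε = L ^ (-(1 / β)) → ε ≤ δ →
          ∀ k ∈ KleinGordon.lattice d L, ∀ t ∈ Set.Icc 0 δ,
            ‖C.Fhat S K L ε t k‖ ≤ Λ ^ (C.n + 1) * δ ^ ((C.n : ℝ) / 2) * ε ^ α := by
  obtain ⟨Bq, hq1, hq⟩ := KleinGordon.SCTree.exists_q_bound S K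
  obtain ⟨BM, hM1, hM⟩ := S.exists_M_bound
  have hbd : KleinGordon.Coupling.IsBound S K Bq BM := ⟨hq1, hM1, hq, hM⟩
  have hR := S.R_pos
  have hG := S.gainConst_pos
  set α : ℝ := min K.γ (1 / 4) with hα
  set G : ℝ := 3 * S.gainConst + 15 + 1 / √S.m with hGdef
  set W : ℝ := (3 * S.R + 2) ^ d * Bq * BM ^ 2 with hW
  set D : ℝ := max 1 S.R with hD
  have hα0 : 0 < α := lt_min K.γ_pos (by norm_num)
  have hG1 : 0 ≤ G := by positivity
  have hD1 : 1 ≤ D := le_max_left _ _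
  have hW0 : 0 < W := by positivity
  -- `W` comes from the bound without gain, `D` handles `ε ≥ 1`, and `8 * (G + 2)` absorbs the
  -- polynomial loss `(n + 2) ^ 3 ≤ 8 ^ (n + 1)`.
  refine ⟨α, hα0, W * (D * (8 * (G + 2))), by positivity, ?_⟩
  intro C hres L ε δ hL hεL hεδ k _ t ht
  have hε : 0 < ε := hεL ▸ Real.rpow_pos_of_pos hL _
  have hδ : 0 < δ := hε.trans_le hεδ
  have hεα : 0 < ε ^ α := Real.rpow_pos_of_pos hε _
  have hεβ : ε ^ β = 1 / L := by
    rw [hεL, ← Real.rpow_mul hL.le, neg_mul, one_div_mul_cancel (by linarith), Real.rpow_neg_one,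
      one_div]
  by_cases hcross : ∃ ℓ ∈ C.firstLeaves, C.σ ℓ ∉ C.firstLeaves
  swap
  · rw [C.Fhat_eq_zero_of_not_crossing S K hL hε hcross, norm_zero]
    positivity
  by_cases hRL : S.R * L < 1
  · obtain ⟨j, -⟩ := hres
    rw [C.Fhat_eq_zero_of_lt S K hL hε j hRL, norm_zero]
    positivity
  rw [not_lt] at hRL
  set n := C.n with hn
  -- it suffices to gain `ε ^ α` over `ε ^ (nB / 2)`
  have hδn : δ ^ ((n : ℝ) / 2) = δ ^ ((C.nB : ℝ) / 2) * δ ^ C.nT := by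
    rw [← Real.rpow_natCast δ C.nT, ← Real.rpow_add hδ]
    congr 1
    rw [hn, C.n_eq]
    push_cast
    ring
  have hεn : ε ^ C.nB = ε ^ ((C.nB : ℝ) / 2) * ε ^ ((C.nB : ℝ) / 2) := by
    rw [← Real.rpow_natCast, ← Real.rpow_add hε]
    congr 1
    ring
  have hmon : ε ^ ((C.nB : ℝ) / 2) ≤ δ ^ ((C.nB : ℝ) / 2) :=
    Real.rpow_le_rpow hε.le hεδ (by positivity)
  have hred : ∀ x : ℝ, 0 ≤ x → ‖C.Fhat S K L ε t k‖ ≤ ε ^ C.nB * δ ^ C.nT * W ^ (n + 1) * x →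
      ε ^ ((C.nB : ℝ) / 2) * x ≤ (D * (8 * (G + 2))) ^ (n + 1) * ε ^ α →
      ‖C.Fhat S K L ε t k‖ ≤ (W * (D * (8 * (G + 2)))) ^ (n + 1) * δ ^ ((n : ℝ) / 2) * ε ^ α := by
    intro x hx h1 h2
    refine h1.trans ?_
    rw [hεn, hδn, mul_pow W]
    calc ε ^ ((C.nB : ℝ) / 2) * ε ^ ((C.nB : ℝ) / 2) * δ ^ C.nT * W ^ (n + 1) * x
        = ε ^ ((C.nB : ℝ) / 2) * δ ^ C.nT * W ^ (n + 1) * (ε ^ ((C.nB : ℝ) / 2) * x) := by ring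
      _ ≤ δ ^ ((C.nB : ℝ) / 2) * δ ^ C.nT * W ^ (n + 1)
          * ((D * (8 * (G + 2))) ^ (n + 1) * ε ^ α) := by gcongr
      _ = _ := by ring
  have htriv := C.norm_Fhat_le hbd hcross hL hε ht hRL k
  have hbase : D ≤ D * (8 * (G + 2)) := le_mul_of_one_le_right (by positivity) (by linarith)
  have hbase1 : 1 ≤ (D * (8 * (G + 2))) ^ (n + 1) := one_le_pow₀ (hD1.trans hbase)
  rcases le_total 1 ε with hε1 | hε1
  · refine hred 1 zero_le_one (by rwa [mul_one]) ?_
    -- For `ε ≥ 1` one has `ε ≤ ε ^ β = 1 / L ≤ R`, so powers of `ε` are absorbed in the constant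
    -- and no gain is needed.
    have hεD : ε ≤ D := by
      have h1 : ε ≤ ε ^ β := by
        simpa using Real.rpow_le_rpow_of_exponent_le hε1 (show (1 : ℝ) ≤ β by linarith)
      rw [hεβ] at h1
      exact h1.trans (((div_le_iff₀ hL).2 hRL).trans (le_max_right _ _))
    have h1 : (C.nB : ℝ) / 2 ≤ ((n + 1 : ℕ) : ℝ) := by
      have : C.nB ≤ n := by have := C.n_eq; omega
      have : (C.nB : ℝ) ≤ n := by exact_mod_cast this
      push_cast
      linarith [Nat.cast_nonneg (α := ℝ) C.nB]
    calc ε ^ ((C.nB : ℝ) / 2) * 1 ≤ ε ^ (((n + 1 : ℕ) : ℝ)) := by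
          rw [mul_one]
          exact Real.rpow_le_rpow_of_exponent_le hε1 h1
      _ = ε ^ (n + 1) := Real.rpow_natCast _ _
      _ ≤ (D * (8 * (G + 2))) ^ (n + 1) := pow_le_pow_left₀ hε.le (hεD.trans hbase) _
      _ ≤ (D * (8 * (G + 2))) ^ (n + 1) * ε ^ α :=
          le_mul_of_one_le_right (by positivity) (Real.one_le_rpow hε1 hα0.le)
  rcases Nat.eq_zero_or_pos C.nB with hB0 | hBpos
  swap
  -- One binary node leaves at least `ε ^ (1/2)`, which is better than `ε ^ α` because `α ≤ 1/4`.
  · refine hred 1 zero_le_one (by rwa [mul_one]) ?_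
    rw [mul_one]
    have h1 : (1 : ℝ) ≤ C.nB := by exact_mod_cast hBpos
    have h2 : ε ^ ((C.nB : ℝ) / 2) ≤ ε ^ α :=
      Real.rpow_le_rpow_of_exponent_ge hε hε1 ((min_le_right _ _).trans (by linarith))
    exact h2.trans (le_mul_of_one_le_left hεα.le hbase1)
  have hB : ∀ (i : Fin 2) (v : (C.part i).tree.Vertex), ¬ v.kind.isBinary = true := by
    intro i v hv
    have h1 : Fintype.card (C.part i).tree.BNode = 0 :=
      Finset.sum_eq_zero_iff.1 hB0 i (Finset.mem_univ i)
    exact (Fintype.card_eq_zero_iff.1 h1).false ⟨v, hv⟩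
  have hLε : 1 / L ≤ ε := by
    rw [← hεβ]
    simpa using Real.rpow_le_rpow_of_exponent_ge hε hε1 (show (1 : ℝ) ≤ β by linarith)
  refine hred _ (by positivity) (C.norm_Fhat_le_of_nonresonant hbd hd hB hres hcross hL hε hε1
    hLε hεδ ht hRL k) ?_
  rw [hB0, Nat.cast_zero, zero_div, Real.rpow_zero, one_mul]
  refine mul_le_mul_of_nonneg_right ?_ hεα.le
  have h8 := KleinGordon.add_two_pow_three_le n
  have h81 : (1 : ℝ) ≤ 8 ^ (n + 1) := one_le_pow₀ (by norm_num)
  calc G * ((n + 2 : ℕ) : ℝ) ^ 3 + 2 ≤ G * 8 ^ (n + 1) + 2 * 8 ^ (n + 1) := by gcongr; linarith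
    _ = (G + 2) ^ 1 * 8 ^ (n + 1) := by ring
    _ ≤ (G + 2) ^ (n + 1) * 8 ^ (n + 1) := by
        gcongr
        · linarith
        · omega
    _ = 1 ^ (n + 1) * (8 * (G + 2)) ^ (n + 1) := by rw [mul_pow]; ring
    _ ≤ D ^ (n + 1) * (8 * (G + 2)) ^ (n + 1) := by gcongr
    _ = _ := (mul_pow _ _ _).symm
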